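/- Let $\Omega\subset\mathbb{R}^3$ be an open half-space, i.e. $\Omega=\{x\in\mathbb{R}^3 : n\cdot x<c\}$ with $n\in\mathbb{R}^3$, $|n|=1$ (the outward unit normal) and $c\in\mathbb{R}$, and let $\sigma$ be the surface measure on the plane $\partial\Omega$. All functions are complex-valued, and $H^m(\Omega)$ is the space of all $u\in L^2(\Omega)$ whose weak derivatives of order at most $m$ exist in $L^2(\Omega)$. Let $f\in L^2(\Omega)$ and $g\in H^{1/2}(\partial\Omega)$, that is, $g\in L^2(\partial\Omega)$ and $$\int_{\partial\Omega}\int_{\partial\Omega}\frac{|g(x)-g(y)|^2}{|x-y|^{3}}\,d\sigma(y)\,d\sigma(x)<\infty .$$ Then the Neumann problem $$-\Delta\psi+\psi=f\ \text{ in }\Omega,\qquad \frac{\partial\psi}{\partial n}=g\ \text{ on }\partial\Omega$$ has a unique weak solution in $H^1(\Omega)$: there is exactly one $\psi\in H^1(\Omega)$ such that $$\int_\Omega\overline{\nabla\psi}\cdot\nabla\phi\,dx+\int_\Omega\overline{\psi}\,\phi\,dx=\int_\Omega\overline{f}\,\phi\,dx+\int_{\partial\Omega}\overline{g}\,\gamma\phi\,d\sigma\qquad\text{for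 all }\phi\in H^1(\Omega),$$ where $\gamma\phi\in L^2(\partial\Omega)$ is the trace of $\phi$, i.e. the limit in $L^2(\partial\Omega)$ of $\phi_k|_{\partial\Omega}$ for functions $\phi_k\in C_0^\infty(\mathbb{R}^3)$ with $\phi_k|_\Omega\to\phi$ in $H^1(\Omega)$. Moreover, this solution $\psi$ belongs to $H^2(\Omega)$. -/

import Mathlib

open MeasureTheory Filter Topology
open scoped ContDiff ENNReal

noncomputable section

namespace HalfSpaceNeumann

/-- Euclidean three-space. -/
abbrev E3 : Type := EuclideanSpace ℝ (Fin 3)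

/-- `Ω` is an open half-space `{x | ⟪n, x⟫ < c}` with outward unit normal `n`. -/
def IsHalfSpace (Ω : Set E3) : Prop :=
  ∃ (n : E3) (c : ℝ), ‖n‖ = 1 ∧ Ω = {x | inner ℝ n x < c}

/-- Surface measure on `∂Ω`: the two-dimensional Hausdorff measure, normalised so that it agrees
with Lebesgue measure on planes, restricted to the topological boundary. -/
def surf (Ω : Set E3) : Measure E3 :=
  (Measure.euclideanHausdorffMeasure 2).restrict (frontier Ω)

/-- The complex Lebesgue space `L²(Ω)`. -/
abbrev L2 (Ω : Set E3) : Type := Lp ℂ 2 ((volume : Measure E3).restrict Ω)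

/-- The complex Lebesgue space `L²(∂Ω)`. -/
abbrev L2Bdry (Ω : Set E3) : Type := Lp ℂ 2 (surf Ω)

/-- The classical partial derivative `∂ᵢ φ`. -/
def pd (i : Fin 3) (φ : E3 → ℂ) : E3 → ℂ :=
  fun x => fderiv ℝ φ x (EuclideanSpace.single i 1)

/-- The classical derivative `D^α φ = ∂₀^{α₀} ∂₁^{α₁} ∂₂^{α₂} φ` for a multi-index `α`. -/
def classicalD (α : Fin 3 → ℕ) (φ : E3 → ℂ) : E3 → ℂ :=
  (pd 0)^[α 0] ((pd 1)^[α 1] ((pd 2)^[α 2] φ))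

/-- `φ ∈ C₀^∞(Ω)`: a smooth function whose support is a compact subset of `Ω`. -/
def IsTest (Ω : Set E3) (φ : E3 → ℂ) : Prop :=
  ContDiff ℝ ∞ φ ∧ HasCompactSupport φ ∧ tsupport φ ⊆ Ω

/-- `v = D^α u` in the weak sense on `Ω`. -/
def HasWeakD (Ω : Set E3) (α : Fin 3 → ℕ) (u v : L2 Ω) : Prop :=
  ∀ φ : E3 → ℂ, IsTest Ω φ →
    ∫ x in Ω, u x * classicalD α φ x = (-1) ^ (∑ i, α i) * ∫ x in Ω, v x * φ x

/-- `u ∈ H^m(Ω)`: all weak derivatives of `u` of order at most `m` exist in `L²(Ω)`. -/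
def MemH (Ω : Set E3) (m : ℕ) (u : L2 Ω) : Prop :=
  ∀ α : Fin 3 → ℕ, ∑ i, α i ≤ m → ∃ v : L2 Ω, HasWeakD Ω α u v

open Classical in
/-- The weak partial derivative `∂ᵢ u` (only used when it exists in `L²(Ω)`; it is then unique when
`Ω` is open, see `weakPD_eq`). -/
def weakPD (Ω : Set E3) (i : Fin 3) (u : L2 Ω) : L2 Ω :=
  if h : ∃ v : L2 Ω, HasWeakD Ω (Pi.single i 1) u v then h.choose else 0

/-- `g ∈ H^{1/2}(∂Ω)`: finite Sobolev–Slobodeckij seminorm on the two-dimensional surface `∂Ω`. -/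
def MemHHalf (Ω : Set E3) (g : L2Bdry Ω) : Prop :=
  ∫⁻ x, ∫⁻ y, ‖g x - g y‖ₑ ^ 2 / ‖x - y‖ₑ ^ 3 ∂(surf Ω) ∂(surf Ω) < ⊤

/-- `t ∈ L²(∂Ω)` is the trace of `u ∈ H¹(Ω)`: some functions in `C₀^∞(ℝ³)` converge to `u` in
`H¹(Ω)` while their restrictions to `∂Ω` converge to `t` in `L²(∂Ω)`. -/
def IsTrace (Ω : Set E3) (u : L2 Ω) (t : L2Bdry Ω) : Prop :=
  ∃ w : ℕ → E3 → ℂ,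
    (∀ k, IsTest Set.univ (w k)) ∧
    Tendsto (fun k => eLpNorm (fun x => w k x - u x) 2 (volume.restrict Ω)) atTop (𝓝 0) ∧
    (∀ i, Tendsto (fun k => eLpNorm (fun x => pd i (w k) x - weakPD Ω i u x) 2
      (volume.restrict Ω)) atTop (𝓝 0)) ∧
    Tendsto (fun k => eLpNorm (fun x => w k x - t x) 2 (surf Ω)) atTop (𝓝 0)

/-- `ψ ∈ H¹(Ω)` is a weak solution of `-Δψ + ψ = f` in `Ω`, `∂ψ/∂n = g` on `∂Ω`:
`∫_Ω conj ∇ψ · ∇φ + ∫_Ω conj ψ φ = ∫_Ω conj f φ + ∫_∂Ω conj g φ` for every `φ ∈ H¹(Ω)`, where `φ` is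
understood on `∂Ω` in the sense of traces. -/
def IsWeakSolution (Ω : Set E3) (f : L2 Ω) (g : L2Bdry Ω) (ψ : L2 Ω) : Prop :=
  MemH Ω 1 ψ ∧ ∀ φ : L2 Ω, MemH Ω 1 φ → ∃ t : L2Bdry Ω, IsTrace Ω φ t ∧
    (∑ i, ∫ x in Ω, starRingEnd ℂ (weakPD Ω i ψ x) * weakPD Ω i φ x)
        + ∫ x in Ω, starRingEnd ℂ (ψ x) * φ x
      = (∫ x in Ω, starRingEnd ℂ (f x) * φ x) + ∫ x, starRingEnd ℂ (g x) * t x ∂(surf Ω)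

/-- Weak derivatives on open sets are unique. -/
theorem HasWeakD.unique {Ω : Set E3} (hΩ : IsOpen Ω) {α : Fin 3 → ℕ} {u v v' : L2 Ω}
    (h : HasWeakD Ω α u v) (h' : HasWeakD Ω α u v') : v = v' := by
  have hint : ∀ w : L2 Ω, LocallyIntegrable (w : E3 → ℂ) (volume.restrict Ω) := fun w =>
    (Lp.memLp w).locallyIntegrable (by norm_num)
  have hw : ∀ w : L2 Ω, LocallyIntegrableOn (w : E3 → ℂ) Ω (volume.restrict Ω) := fun w =>
    (hint w).locallyIntegrableOn Ω
  have key : ∀ᵐ x ∂((volume : Measure E3).restrict Ω), x ∈ Ω → (v x - v' x) = 0 := by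
    refine hΩ.ae_eq_zero_of_integral_contDiff_smul_eq_zero (f := fun x => v x - v' x)
      ((hw v).sub (hw v')) ?_
    intro φ hφ hc hs
    have hts : tsupport (fun x => (φ x : ℂ)) ⊆ tsupport φ :=
      closure_mono (Function.support_subset_iff'.2 fun x hx => by
        simp [Function.notMem_support.1 hx])
    have ht : IsTest Ω (fun x => (φ x : ℂ)) :=
      ⟨Complex.ofRealCLM.contDiff.comp hφ, hc.comp_left (g := fun r : ℝ => (r : ℂ)) (by simp),
        hts.trans hs⟩
    have e := (h _ ht).symm.trans (h' _ ht)
    have e' := mul_left_cancel₀ (pow_ne_zero _ (by norm_num : (-1 : ℂ) ≠ 0)) e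
    have i1 : ∀ w : L2 Ω, Integrable (fun x => φ x • w x) (volume.restrict Ω) := fun w =>
      (hint w).integrable_smul_left_of_hasCompactSupport hφ.continuous hc
    simp only [smul_sub]
    rw [integral_sub (i1 v) (i1 v'), sub_eq_zero]
    simpa [mul_comm] using e'
  apply Lp.ext
  filter_upwards [key, ae_restrict_mem hΩ.measurableSet] with x hx hm
  exact sub_eq_zero.1 (hx hm)

/-- The chosen weak partial derivative is the weak partial derivative. -/
theorem weakPD_eq {Ω : Set E3} (hΩ : IsOpen Ω) {i : Fin 3} {u v : L2 Ω}
    (h : HasWeakD Ω (Pi.single i 1) u v) : weakPD Ω i u = v := by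
  have hex : ∃ v : L2 Ω, HasWeakD Ω (Pi.single i 1) u v := ⟨v, h⟩
  unfold weakPD
  rw [dif_pos hex]
  exact hex.choose_spec.unique hΩ h

end HalfSpaceNeumann

end

/-!
The half-space is handled in Cartesian coordinates `(y, t)`, with `y` in the plane and `t` the depth
below the boundary; they identify `Ω` with `ℝ² × (0, ∞)` and the surface measure with Lebesgue
measure on the plane. Regularity is obtained by splitting a weak solution `ψ` as `u + (ψ - u)`,
where `u ∈ H²(Ω)` is an explicit function with Neumann data `g`.

*Homogeneous Neumann data.* If `v ∈ H¹(Ω)` satisfies `∫ ∇v · ∇φ + ∫ v φ = ∫ F φ` for all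
`φ ∈ C₀^∞(ℝ³)`, then its even reflection in the boundary plane solves `v - Δv = F` on `ℝ³`
(`Frame.evenExt_equation`): pairing with `φ` amounts to pairing `v` on `Ω` with the even function
`φ + φ ∘ refl`, whose gradient is tangential on the boundary. On `ℝ³` the Fourier multiplier
`(1 + 4π²|ξ|²)⁻¹` gives `v = 0` if `F = 0` (`Frame.eq_zero_of_neumann`) and `v ∈ H²` in general
(`Frame.memH_two_of_neumann`).

*Existence and uniqueness.* By the fundamental theorem of calculus along normal lines, the `L²` norm
of a smooth function on `∂Ω` is at most its `H¹` norm (`Frame.lintegral_surf_le`), so restriction to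
the boundary extends to a trace operator on the closure of the smooth functions in `H¹`. This
closure is all of `H¹`, since an element orthogonal to the smooth functions solves the homogeneous problem
with `F = 0` (`Frame.mem_smoothJets`). The weak solution is then given by the Riesz representation
theorem (`Frame.existsUnique_weakSolution`).

*The lifting of `g`.* Let `u(x) = ∫ K(x - y) g(y) dσ(y)`, where `K(z) = t⁻¹ B(t, z / t)` and `t` is
the normal component of `z`, with a smooth profile `B` of compact support. Up to the cutoff in `t`,
the kernels of `u`, `∇u` and `∇²u` are homogeneous of degrees `-1`, `-2` and `-3`. The first two are
bounded from `L²(∂Ω)` to `L²(Ω)`. The kernels of the second derivatives have vanishing integral over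
the plane `t = 0` (`Frame.moment_dProf`), so that up to a bounded term they act on the differences
`g(y) - g(x)`, and integration in `t` leads to the Slobodeckij seminorm of `g`
(`Frame.memLp_pot_three`). The profiles of the first derivatives have moments proportional to the
components of `n`; hence `∇u` tends to a multiple of `g n` at the boundary, and normalising `B`
turns the Neumann datum of `u` into `g` (`Frame.exists_lift`).
-/

noncomputable section

namespace HalfSpaceNeumann

/-! ### Cartesian coordinates on a half-space -/

/-- The Euclidean plane, which parametrises `∂Ω`. -/
abbrev E2 : Type := EuclideanSpace ℝ (Fin 2)

/-- A half-space `{x | ⟪n, x⟫ < c}` together with an isometric parametrisation `L` of the plane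
orthogonal to its outward unit normal `n`. -/
structure Frame where
  n : E3
  c : ℝ
  L : E2 →ₗᵢ[ℝ] E3
  norm_n : ‖n‖ = 1
  perp : ∀ y, inner ℝ n (L y) = 0

namespace Frame

variable (S : Frame)

/-- The half-space of a frame. -/
def dom : Set E3 := {x | inner ℝ S.n x < S.c}

/-- The signed distance to the boundary plane, positive inside the half-space. -/
def depth (x : E3) : ℝ := S.c - inner ℝ S.n x

/-- Cartesian coordinates adapted to the half-space: `(y, t)` is the point at depth `t` below the
boundary point with tangential coordinate `y`. -/
def chart (p : E2 × ℝ) : E3 := S.L p.1 + (S.c - p.2) • S.n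

theorem inner_n_n : inner ℝ S.n S.n = (1 : ℝ) := by
  rw [real_inner_self_eq_norm_sq, S.norm_n]; norm_num

theorem mem_dom {x : E3} : x ∈ S.dom ↔ 0 < S.depth x := by
  simp [dom, depth]

theorem isOpen_dom : IsOpen S.dom :=
  isOpen_lt (by fun_prop) continuous_const

@[simp] theorem depth_chart (p : E2 × ℝ) : S.depth (S.chart p) = p.2 := by
  simp [depth, chart, inner_add_right, inner_smul_right, S.perp, S.norm_n]

@[fun_prop] theorem continuous_depth : Continuous S.depth := by unfold depth; fun_prop

@[fun_prop] theorem contDiff_depth : ContDiff ℝ ∞ S.depth := by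
  unfold depth; exact contDiff_const.sub (contDiff_const.inner ℝ contDiff_id)

@[fun_prop] theorem continuous_chart : Continuous S.chart := by
  unfold chart
  exact (S.L.continuous.comp continuous_fst).add
    ((continuous_const.sub continuous_snd).smul continuous_const)

/-- The chart as a linear isometry, up to the affine change of the normal coordinate. -/
def linChart : WithLp 2 (E2 × ℝ) ≃ₗᵢ[ℝ] E3 :=
  LinearIsometry.toLinearIsometryEquiv
    { toFun := fun p => S.L p.fst + p.snd • S.n
      map_add' := fun p q => by simp [add_smul]; abel
      map_smul' := fun r p => by simp [smul_smul]
      norm_map' := fun p => by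
        have h : ‖S.L p.fst + p.snd • S.n‖ ^ 2 = ‖p‖ ^ 2 := by
          rw [@norm_add_sq_real, WithLp.prod_norm_sq_eq_of_L2, norm_smul, S.norm_n,
            real_inner_comm]
          simp [inner_smul_left, S.perp]
        exact (sq_eq_sq₀ (norm_nonneg _) (norm_nonneg _)).1 h }
    (by
      rw [LinearEquiv.finrank_eq (WithLp.linearEquiv 2 ℝ (E2 × ℝ))]
      simp)

theorem linChart_apply (p : WithLp 2 (E2 × ℝ)) :
    S.linChart p = S.L p.fst + p.snd • S.n := rfl

theorem measurePreserving_chart : MeasurePreserving S.chart := by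
  have h1 : MeasurePreserving (fun p : E2 × ℝ => (p.1, S.c - p.2)) := by
    have := (MeasurePreserving.id (volume : Measure E2)).prod
      (Measure.measurePreserving_sub_left (volume : Measure ℝ) S.c)
    exact this
  have h2 := (S.linChart.measurePreserving.comp (WithLp.volume_preserving_toLp E2 ℝ)).comp h1
  exact h2

theorem chart_surj (x : E3) : ∃ y, S.chart (y, S.depth x) = x := by
  obtain ⟨p, hp⟩ := S.linChart.surjective x
  refine ⟨p.fst, ?_⟩
  rw [← hp]
  simp [chart, depth, linChart_apply, inner_add_right, inner_smul_right, S.perp, S.norm_n]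

theorem chart_injective : Function.Injective S.chart := by
  intro p q h
  have h2 : p.2 = q.2 := by rw [← S.depth_chart p, h, S.depth_chart]
  have h1 : S.L p.1 = S.L q.1 := by
    simp only [chart, h2] at h
    exact add_right_cancel h
  exact Prod.ext (S.L.injective h1) h2

theorem measurableEmbedding_chart : MeasurableEmbedding S.chart :=
  S.continuous_chart.measurableEmbedding S.chart_injective

/-- Integration over the half-space is integration over `E2 × (0, ∞)`. -/
theorem measurePreserving_chart_dom :
    MeasurePreserving S.chart ((volume : Measure E2).prod (volume.restrict (Set.Ioi 0)))
      (volume.restrict S.dom) := by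
  have h := S.measurePreserving_chart.restrict_preimage S.isOpen_dom.measurableSet
  have e : S.chart ⁻¹' S.dom = Set.univ ×ˢ Set.Ioi (0 : ℝ) := by
    ext p; simp [mem_dom]
  rw [e, Measure.volume_eq_prod, ← Measure.prod_restrict, Measure.restrict_univ] at h
  exact h

theorem closure_dom : closure S.dom = {x | 0 ≤ S.depth x} := by
  apply subset_antisymm
  · exact closure_minimal (fun x hx => (S.mem_dom.1 hx).le)
      (isClosed_le continuous_const S.continuous_depth)
  · intro x hx
    have hx : 0 ≤ S.depth x := hx
    have h1 : Tendsto (fun ε : ℝ => x - ε • S.n) (𝓝[>] 0) (𝓝 x) := by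
      have : Tendsto (fun ε : ℝ => x - ε • S.n) (𝓝 0) (𝓝 (x - (0 : ℝ) • S.n)) :=
        Continuous.tendsto (by fun_prop) 0
      simpa using this.mono_left nhdsWithin_le_nhds
    refine mem_closure_of_tendsto h1 ?_
    filter_upwards [self_mem_nhdsWithin] with ε hε
    have hε : 0 < ε := hε
    rw [mem_dom]
    simp only [depth, inner_sub_right, inner_smul_right, S.inner_n_n] at hx ⊢
    linarith

theorem frontier_dom : frontier S.dom = {x | S.depth x = 0} := by
  rw [frontier, S.closure_dom, S.isOpen_dom.interior_eq]
  ext x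
  simp only [Set.mem_sdiff, Set.mem_ofPred_eq, mem_dom]
  constructor
  · rintro ⟨h1, h2⟩; linarith
  · intro h; rw [h]; simp

/-- The isometric parametrisation of the boundary plane. -/
def bd (y : E2) : E3 := S.chart (y, 0)

theorem isometry_bd : Isometry S.bd := by
  apply Isometry.of_dist_eq
  intro x y
  rw [bd, bd, chart, chart, dist_add_right, S.L.isometry.dist_eq]

@[fun_prop] theorem continuous_bd : Continuous S.bd := S.isometry_bd.continuous

theorem range_bd : Set.range S.bd = frontier S.dom := by
  rw [frontier_dom]
  ext x
  constructor
  · rintro ⟨y, rfl⟩; simp [bd]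
  · intro h
    obtain ⟨y, hy⟩ := S.chart_surj x
    rw [Set.mem_ofPred_eq] at h
    rw [h] at hy
    exact ⟨y, hy⟩

theorem measurableEmbedding_bd : MeasurableEmbedding S.bd :=
  S.isometry_bd.isClosedEmbedding.measurableEmbedding

/-- The surface measure is Lebesgue measure in the tangential coordinate. -/
theorem measurePreserving_bd : MeasurePreserving S.bd volume (surf S.dom) := by
  refine ⟨S.continuous_bd.measurable, ?_⟩
  have := S.isometry_bd.map_euclideanHausdorffMeasure (d := 2)
  rw [EuclideanSpace.euclideanHausdorffMeasure_eq_volume] at this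
  rw [this, S.range_bd, surf]

@[simp] theorem depth_bd (y : E2) : S.depth (S.bd y) = 0 := by simp [bd]

theorem depth_add (x v : E3) : S.depth (x + v) = S.depth x - inner ℝ S.n v := by
  simp only [depth, inner_add_right]; ring

end Frame

theorem IsHalfSpace.exists_frame {Ω : Set E3} (h : IsHalfSpace Ω) : ∃ S : Frame, Ω = S.dom := by
  obtain ⟨n, c, hn, rfl⟩ := h
  have hn0 : n ≠ 0 := by rintro rfl; simp at hn
  have hfin : Module.finrank ℝ (ℝ ∙ n)ᗮ = 2 := by
    have := (ℝ ∙ n).finrank_add_finrank_orthogonal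
    rw [finrank_span_singleton hn0] at this
    simp at this
    omega
  let b := (stdOrthonormalBasis ℝ (ℝ ∙ n)ᗮ).reindex (finCongr hfin)
  refine ⟨⟨n, c, (Submodule.subtypeₗᵢ _).comp b.repr.symm.toLinearIsometry, hn, ?_⟩, rfl⟩
  intro y
  have := (b.repr.symm y).2
  rw [Submodule.mem_orthogonal_singleton_iff_inner_right] at this
  exact this

/-! ### Test functions and weak derivatives -/

theorem IsTest.mono {Ω Ω' : Set E3} (h : Ω ⊆ Ω') {φ : E3 → ℂ} (hφ : IsTest Ω φ) : IsTest Ω' φ :=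
  ⟨hφ.1, hφ.2.1, hφ.2.2.trans h⟩

theorem isTest_univ {φ : E3 → ℂ} (h : ContDiff ℝ ∞ φ) (hc : HasCompactSupport φ) :
    IsTest Set.univ φ := ⟨h, hc, Set.subset_univ _⟩

theorem IsTest.continuous {Ω : Set E3} {φ : E3 → ℂ} (hφ : IsTest Ω φ) : Continuous φ :=
  hφ.1.continuous

theorem IsTest.differentiable {Ω : Set E3} {φ : E3 → ℂ} (hφ : IsTest Ω φ) : Differentiable ℝ φ :=
  hφ.1.differentiable (by simp)

theorem IsTest.pd {Ω : Set E3} {φ : E3 → ℂ} (hφ : IsTest Ω φ) (i : Fin 3) :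
    IsTest Ω (pd i φ) := by
  refine ⟨?_, hφ.2.1.fderiv_apply ℝ _, (tsupport_fderiv_apply_subset ℝ _).trans hφ.2.2⟩
  exact (hφ.1.fderiv_right (m := ∞) (by simp)).clm_apply contDiff_const

theorem IsTest.add {Ω : Set E3} {φ ψ : E3 → ℂ} (hφ : IsTest Ω φ) (hψ : IsTest Ω ψ) :
    IsTest Ω (fun x => φ x + ψ x) :=
  ⟨hφ.1.add hψ.1, hφ.2.1.add hψ.2.1,
    (tsupport_add φ ψ).trans (Set.union_subset hφ.2.2 hψ.2.2)⟩

theorem IsTest.mul_left {Ω : Set E3} {f φ : E3 → ℂ} (hf : ContDiff ℝ ∞ f) (hφ : IsTest Ω φ) :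
    IsTest Ω (fun x => f x * φ x) :=
  ⟨hf.mul hφ.1, hφ.2.1.mul_left, (tsupport_mul_subset_right (f := f) (g := φ)).trans hφ.2.2⟩

theorem IsTest.sub {Ω : Set E3} {φ ψ : E3 → ℂ} (hφ : IsTest Ω φ) (hψ : IsTest Ω ψ) :
    IsTest Ω (fun x => φ x - ψ x) := by
  have := hφ.add (hψ.mul_left (f := fun _ => -1) contDiff_const)
  simpa [sub_eq_add_neg] using this

theorem IsTest.conj {Ω : Set E3} {φ : E3 → ℂ} (hφ : IsTest Ω φ) :
    IsTest Ω (fun x => starRingEnd ℂ (φ x)) := by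
  refine ⟨Complex.conjCLE.contDiff.comp hφ.1, hφ.2.1.comp_left (g := starRingEnd ℂ) (by simp), ?_⟩
  exact (closure_mono (Function.support_comp_subset (g := starRingEnd ℂ) (by simp) φ)).trans hφ.2.2

theorem pd_conj {φ : E3 → ℂ} (hφ : Differentiable ℝ φ) (i : Fin 3) (x : E3) :
    pd i (fun x => starRingEnd ℂ (φ x)) x = starRingEnd ℂ (pd i φ x) := by
  have := (Complex.conjCLE.toContinuousLinearMap.hasFDerivAt.comp x (hφ x).hasFDerivAt).fderiv
  simp only [pd]
  change fderiv ℝ (Complex.conjCLE.toContinuousLinearMap ∘ φ) x _ = _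
  rw [this]; rfl

theorem pd_mul {f g : E3 → ℂ} (i : Fin 3) {x : E3} (hf : DifferentiableAt ℝ f x)
    (hg : DifferentiableAt ℝ g x) :
    pd i (fun x => f x * g x) x = f x * pd i g x + pd i f x * g x := by
  simp only [pd]
  rw [fderiv_fun_mul hf hg]
  simp [mul_comm]

theorem pd_add {f g : E3 → ℂ} (i : Fin 3) {x : E3} (hf : DifferentiableAt ℝ f x)
    (hg : DifferentiableAt ℝ g x) : pd i (fun x => f x + g x) x = pd i f x + pd i g x := by
  simp only [pd]
  rw [fderiv_fun_add hf hg]; rfl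

theorem fderiv_eq_sum_pd (φ : E3 → ℂ) (x v : E3) :
    fderiv ℝ φ x v = ∑ i, (v i : ℂ) * pd i φ x := by
  have hv : v = ∑ i, v i • EuclideanSpace.single i (1 : ℝ) := by
    ext j; simp [Finset.sum_apply, Pi.single_apply]
  conv_lhs => rw [hv]
  simp only [map_sum, map_smul, pd, Complex.real_smul]

theorem pd_comm {Ω : Set E3} {φ : E3 → ℂ} (hφ : IsTest Ω φ) (i j : Fin 3) :
    pd i (pd j φ) = pd j (pd i φ) := by
  have h (i j : Fin 3) (x : E3) : pd i (pd j φ) x =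
      fderiv ℝ (fderiv ℝ φ) x (EuclideanSpace.single i 1) (EuclideanSpace.single j 1) := by
    have hd : DifferentiableAt ℝ (fderiv ℝ φ) x :=
      (hφ.1.fderiv_right (m := ∞) (by simp)).differentiable (by simp) x
    change fderiv ℝ (fun y => fderiv ℝ φ y (EuclideanSpace.single j 1)) x _ = _
    rw [fderiv_clm_apply hd (differentiableAt_const _)]
    simp
  funext x
  rw [h, h]
  exact (hφ.1.contDiffAt.isSymmSndFDerivAt (n := ∞)
    (by
      simp only [minSmoothness_of_isRCLikeNormedField]
      exact WithTop.coe_le_coe.2 (le_top (a := (2 : ℕ∞))))) _ _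

theorem memLp_test {Ω : Set E3} {φ : E3 → ℂ} (hφ : IsTest Ω φ) (p : ℝ≥0∞) (Ω' : Set E3) :
    MemLp φ p (volume.restrict Ω') :=
  (hφ.continuous.memLp_of_hasCompactSupport hφ.2.1).restrict Ω'

theorem integrable_mul_test {Ω Ω' : Set E3} {φ : E3 → ℂ} (hφ : IsTest Ω' φ) (u : L2 Ω) :
    Integrable (fun x => u x * φ x) (volume.restrict Ω) :=
  (Lp.memLp u).integrable_mul (memLp_test hφ 2 Ω)

theorem classicalD_zero (φ : E3 → ℂ) : classicalD 0 φ = φ := rfl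

theorem classicalD_single (i : Fin 3) (φ : E3 → ℂ) : classicalD (Pi.single i 1) φ = pd i φ := by
  fin_cases i <;> rfl

theorem classicalD_single_add_single {Ω : Set E3} {φ : E3 → ℂ} (hφ : IsTest Ω φ) (i j : Fin 3) :
    classicalD (Pi.single i 1 + Pi.single j 1) φ = pd i (pd j φ) := by
  fin_cases i <;> fin_cases j <;> first | rfl | exact (pd_comm hφ _ _)

theorem IsTest.classicalD {Ω : Set E3} {φ : E3 → ℂ} (hφ : IsTest Ω φ) (α : Fin 3 → ℕ) :
    IsTest Ω (classicalD α φ) := by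
  have h (i : Fin 3) (k : ℕ) {ψ : E3 → ℂ} (hψ : IsTest Ω ψ) :
      IsTest Ω ((HalfSpaceNeumann.pd i)^[k] ψ) := by
    induction k with
    | zero => exact hψ
    | succ k ih => rw [Function.iterate_succ_apply']; exact ih.pd i
  exact h 0 _ (h 1 _ (h 2 _ hφ))

/-- A multi-index of positive order is obtained from another one by one more differentiation. -/
theorem exists_eq_add_single {α : Fin 3 → ℕ} {k : ℕ} (h : ∑ i, α i = k + 1) :
    ∃ (i : Fin 3) (β : Fin 3 → ℕ), α = β + Pi.single i 1 ∧ ∑ i, β i = k := by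
  obtain ⟨i, -, hi⟩ : ∃ i ∈ Finset.univ, α i ≠ 0 := by
    apply Finset.exists_ne_zero_of_sum_ne_zero; omega
  have e : α = (α - Pi.single i 1) + Pi.single i 1 := by
    refine (tsub_add_cancel_of_le ?_).symm
    intro j
    by_cases hj : j = i
    · subst hj; simp; omega
    · simp [hj]
  refine ⟨i, _, e, ?_⟩
  have := congrArg (fun a : Fin 3 → ℕ => ∑ i, a i) e
  simp only [Pi.add_apply, Finset.sum_add_distrib, Finset.sum_pi_single', Finset.mem_univ,
    if_true] at this
  omega

theorem sum_eq_zero_iff_eq_zero {α : Fin 3 → ℕ} : ∑ i, α i = 0 ↔ α = 0 := by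
  simp [funext_iff]

theorem hasWeakD_zero {Ω : Set E3} (u : L2 Ω) : HasWeakD Ω 0 u u := by
  intro φ _; simp [classicalD_zero]

theorem hasWeakD_single_iff {Ω : Set E3} {i : Fin 3} {u v : L2 Ω} :
    HasWeakD Ω (Pi.single i 1) u v ↔
      ∀ φ, IsTest Ω φ → ∫ x in Ω, u x * pd i φ x = -∫ x in Ω, v x * φ x := by
  simp [HasWeakD, classicalD_single]

theorem memH_one_iff {Ω : Set E3} {u : L2 Ω} :
    MemH Ω 1 u ↔ ∀ i, ∃ v : L2 Ω, HasWeakD Ω (Pi.single i 1) u v := by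
  constructor
  · intro h i
    exact h _ (by simp)
  · intro h α hα
    rcases Nat.le_one_iff_eq_zero_or_eq_one.1 hα with h0 | h1
    · rw [sum_eq_zero_iff_eq_zero.1 h0]; exact ⟨u, hasWeakD_zero u⟩
    · obtain ⟨i, β, rfl, hβ⟩ := exists_eq_add_single h1
      rw [sum_eq_zero_iff_eq_zero.1 hβ, zero_add]
      exact h i

/-- Membership in `H²` in terms of first derivatives and iterated second derivatives. -/
theorem memH_two_of {Ω : Set E3} {u : L2 Ω}
    (h1 : ∀ i, ∃ v : L2 Ω, HasWeakD Ω (Pi.single i 1) u v)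
    (h2 : ∀ i j, ∃ v : L2 Ω, ∀ φ, IsTest Ω φ →
      ∫ x in Ω, u x * pd i (pd j φ) x = ∫ x in Ω, v x * φ x) : MemH Ω 2 u := by
  intro α hα
  rcases Nat.lt_or_ge (∑ i, α i) 2 with h | h
  · exact memH_one_iff.2 h1 α (by omega)
  obtain ⟨j, β, rfl, hβ⟩ := exists_eq_add_single (k := 1) (le_antisymm hα h)
  obtain ⟨i, γ, rfl, hγ⟩ := exists_eq_add_single hβ
  rw [sum_eq_zero_iff_eq_zero.1 hγ, zero_add]
  obtain ⟨v, hv⟩ := h2 i j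
  refine ⟨v, fun φ hφ => ?_⟩
  rw [classicalD_single_add_single hφ, hv φ hφ]
  simp [Finset.sum_add_distrib]

theorem integral_add_mul {Ω Ω' : Set E3} (u v : L2 Ω) {φ : E3 → ℂ} (hφ : IsTest Ω' φ) :
    ∫ x in Ω, (u + v : L2 Ω) x * φ x = (∫ x in Ω, u x * φ x) + ∫ x in Ω, v x * φ x := by
  rw [← integral_add (integrable_mul_test hφ u) (integrable_mul_test hφ v)]
  refine integral_congr_ae ?_
  filter_upwards [Lp.coeFn_add u v] with x hx
  rw [hx, Pi.add_apply, add_mul]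

theorem integral_smul_mul {Ω : Set E3} (a : ℂ) (u : L2 Ω) (φ : E3 → ℂ) :
    ∫ x in Ω, (a • u : L2 Ω) x * φ x = a * ∫ x in Ω, u x * φ x := by
  rw [← integral_const_mul]
  refine integral_congr_ae ?_
  filter_upwards [Lp.coeFn_smul a u] with x hx
  rw [hx, Pi.smul_apply, smul_eq_mul, mul_assoc]

theorem integral_sub_mul {Ω Ω' : Set E3} (u v : L2 Ω) {φ : E3 → ℂ} (hφ : IsTest Ω' φ) :
    ∫ x in Ω, (u - v : L2 Ω) x * φ x = (∫ x in Ω, u x * φ x) - ∫ x in Ω, v x * φ x := by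
  have e : u - v = u + (-1 : ℂ) • v := by simp [sub_eq_add_neg]
  rw [e, integral_add_mul u _ hφ, integral_smul_mul]; ring

theorem HasWeakD.add {Ω : Set E3} {α : Fin 3 → ℕ} {u v u' v' : L2 Ω} (h : HasWeakD Ω α u v)
    (h' : HasWeakD Ω α u' v') : HasWeakD Ω α (u + u') (v + v') := by
  intro φ hφ
  rw [integral_add_mul _ _ (hφ.classicalD α), integral_add_mul _ _ hφ, h φ hφ, h' φ hφ, mul_add]

theorem HasWeakD.smul {Ω : Set E3} {α : Fin 3 → ℕ} {u v : L2 Ω} (a : ℂ) (h : HasWeakD Ω α u v) :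
    HasWeakD Ω α (a • u) (a • v) := by
  intro φ hφ
  rw [integral_smul_mul, integral_smul_mul, h φ hφ]; ring

theorem HasWeakD.sub {Ω : Set E3} {α : Fin 3 → ℕ} {u v u' v' : L2 Ω} (h : HasWeakD Ω α u v)
    (h' : HasWeakD Ω α u' v') : HasWeakD Ω α (u - u') (v - v') := by
  intro φ hφ
  rw [integral_sub_mul _ _ (hφ.classicalD α), integral_sub_mul _ _ hφ, h φ hφ, h' φ hφ, mul_sub]

theorem MemH.add {Ω : Set E3} {m : ℕ} {u v : L2 Ω} (hu : MemH Ω m u) (hv : MemH Ω m v) :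
    MemH Ω m (u + v) := fun α hα => by
  obtain ⟨a, ha⟩ := hu α hα
  obtain ⟨b, hb⟩ := hv α hα
  exact ⟨a + b, ha.add hb⟩

theorem MemH.hasWeakD_weakPD {Ω : Set E3} {u : L2 Ω} (hu : MemH Ω 1 u) (i : Fin 3) :
    HasWeakD Ω (Pi.single i 1) u (weakPD Ω i u) := by
  have h := memH_one_iff.1 hu i
  unfold weakPD
  rw [dif_pos h]
  exact h.choose_spec

/-- Integration by parts against a test function, for a function which is only smooth near the
support of the latter. -/
theorem integral_mul_pd {f φ : E3 → ℂ} {Ω : Set E3} (hf : ∀ x ∈ tsupport φ, ContDiffAt ℝ 1 f x)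
    (hφ : IsTest Ω φ) (i : Fin 3) :
    ∫ x, f x * pd i φ x = -∫ x, pd i f x * φ x := by
  have hcont {ψ g : E3 → ℂ} (hψ : IsTest Ω ψ) (hs : tsupport ψ ⊆ tsupport φ)
      (hg : ∀ x ∈ tsupport φ, ContinuousAt g x) :
      Integrable (fun x => g x * ψ x) := by
    have h0 : ∀ x, x ∉ tsupport ψ → g x * ψ x = 0 := fun x hx => by
      rw [image_eq_zero_of_notMem_tsupport hx, mul_zero]
    rw [← integrableOn_iff_integrable_of_support_subset (s := tsupport ψ)
      (fun x hx => by by_contra h; exact hx (h0 x h))]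
    refine ContinuousOn.integrableOn_compact hψ.2.1 fun x hx => ?_
    exact ((hg x (hs hx)).mul hψ.continuous.continuousAt).continuousWithinAt
  refine integral_mul_fderiv_eq_neg_fderiv_mul_of_integrable ?_ ?_ ?_ ?_ ?_
  · refine hcont hφ subset_rfl fun x hx => ?_
    exact (((hf x hx).fderiv_right (m := 0) (by simp)).continuousAt).clm_apply
      continuousAt_const
  · exact hcont (hφ.pd i) (tsupport_fderiv_apply_subset ℝ _) fun x hx => (hf x hx).continuousAt
  · exact hcont hφ subset_rfl fun x hx => (hf x hx).continuousAt
  · exact fun x hx => (hf x hx).differentiableAt (by simp)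
  · exact fun x _ => hφ.differentiable x

theorem setIntegral_mul_test {Ω : Set E3} {φ : E3 → ℂ} (hφ : IsTest Ω φ)
    (f : E3 → ℂ) : ∫ x in Ω, f x * φ x = ∫ x, f x * φ x := by
  refine setIntegral_eq_integral_of_forall_compl_eq_zero fun x hx => ?_
  rw [image_eq_zero_of_notMem_tsupport fun h => hx (hφ.2.2 h), mul_zero]

/-! ### The whole space -/

open scoped SchwartzMap LineDeriv Laplacian

theorem pd_comp_smul (i : Fin 3) (r : ℝ) (f : E3 → ℂ) :
    pd i (fun x => f (r • x)) = fun x => (r : ℂ) * pd i f (r • x) := by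
  funext x
  simp only [pd]
  rw [fderiv_comp_smul]
  simp

theorem SchwartzMap.coe_lineDerivOp_single (φ : 𝓢(E3, ℂ)) (i : Fin 3) :
    ((∂_{(EuclideanSpace.single i (1 : ℝ) : E3)} φ : 𝓢(E3, ℂ)) : E3 → ℂ) = pd i φ := by
  funext x
  rw [SchwartzMap.lineDerivOp_apply_eq_fderiv]; rfl

theorem SchwartzMap.coe_laplacian (φ : 𝓢(E3, ℂ)) :
    ((Δ φ : 𝓢(E3, ℂ)) : E3 → ℂ) = fun x => ∑ i, pd i (pd i φ) x := by
  funext x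
  rw [SchwartzMap.laplacian_eq_sum (EuclideanSpace.basisFun (Fin 3) ℝ)]
  simp only [sum_apply, EuclideanSpace.basisFun_apply,
    SchwartzMap.coe_lineDerivOp_single]

theorem integrable_mul_schwartz (h : Lp ℂ 2 (volume : Measure E3)) (φ : 𝓢(E3, ℂ)) :
    Integrable (fun x => h x * φ x) :=
  (Lp.memLp h).integrable_mul (φ.memLp 2)

/-- A smooth cutoff, equal to one near the origin. -/
theorem exists_cutoff : ∃ χ : E3 → ℂ, ContDiff ℝ ∞ χ ∧ HasCompactSupport χ ∧
    ∀ x, ‖x‖ ≤ 1 → χ x = 1 := by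
  let b : ContDiffBump (0 : E3) := ⟨1, 2, by norm_num, by norm_num⟩
  refine ⟨fun x => (b x : ℂ), Complex.ofRealCLM.contDiff.comp b.contDiff,
    b.hasCompactSupport.comp_left (g := fun r : ℝ => (r : ℂ)) (by simp), fun x hx => ?_⟩
  change ((b x : ℝ) : ℂ) = 1
  rw [b.one_of_mem_closedBall (by simpa using hx)]; simp

/-- The equation `h - Δh = F`, if it holds against compactly supported smooth functions, holds
against Schwartz functions. -/
theorem integral_schwartz_of_test {h F : Lp ℂ 2 (volume : Measure E3)}
    (H : ∀ φ, IsTest Set.univ φ →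
      ∫ x, h x * (φ x - ∑ i, pd i (pd i φ) x) = ∫ x, F x * φ x) (φ : 𝓢(E3, ℂ)) :
    ∫ x, h x * (φ x - (Δ φ : 𝓢(E3, ℂ)) x) = ∫ x, F x * φ x := by
  -- `φ` is approximated by the test functions `χ(r • x) φ(x)` with `r = 1 / (k + 1)`; all terms
  -- with derivatives of the cutoff vanish eventually at each point.
  obtain ⟨χ, hχ, hχc, hχ1⟩ := exists_cutoff
  have hχt := isTest_univ hχ hχc
  let r : ℕ → ℝ := fun k => 1 / ((k : ℝ) + 1)
  have hr0 : ∀ k, 0 < r k := fun k => Nat.one_div_pos_of_nat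
  have hr1 : ∀ k, r k ≤ 1 := fun k => by
    have : (0 : ℝ) ≤ k := k.cast_nonneg
    exact (div_le_one (by positivity)).2 (by linarith)
  have hrt : Tendsto r atTop (𝓝 0) := tendsto_one_div_add_atTop_nhds_zero_nat
  let χk : ℕ → E3 → ℂ := fun k x => χ (r k • x)
  let φk : ℕ → E3 → ℂ := fun k x => χk k x * φ x
  have hχks : ∀ k, ContDiff ℝ ∞ (χk k) := fun k => hχ.comp (contDiff_const_smul (r k))
  have hχkc : ∀ k, HasCompactSupport (χk k) := fun k =>
    hχc.comp_homeomorph (Homeomorph.smulOfNeZero (r k) (hr0 k).ne')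
  have hφk : ∀ k, IsTest Set.univ (φk k) := fun k =>
    isTest_univ ((hχks k).mul (φ.smooth ⊤)) (hχkc k).mul_right
  obtain ⟨C0, hC0⟩ := hχc.exists_bound_of_continuous hχ.continuous
  have hC1 : ∃ C, ∀ i x, ‖pd i χ x‖ ≤ C ∧ ‖pd i (pd i χ) x‖ ≤ C := by
    have h1 : ∀ i, ∃ C, ∀ x, ‖pd i χ x‖ ≤ C := fun i =>
      (hχt.pd i).2.1.exists_bound_of_continuous (hχt.pd i).continuous
    have h2 : ∀ i, ∃ C, ∀ x, ‖pd i (pd i χ) x‖ ≤ C := fun i =>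
      ((hχt.pd i).pd i).2.1.exists_bound_of_continuous ((hχt.pd i).pd i).continuous
    choose A hA using h1
    choose B hB using h2
    have hA0 : ∀ i, 0 ≤ A i := fun i => (norm_nonneg _).trans (hA i 0)
    have hB0 : ∀ i, 0 ≤ B i := fun i => (norm_nonneg _).trans (hB i 0)
    refine ⟨∑ i, (A i + B i), fun i x => ?_⟩
    have := Finset.single_le_sum (f := fun i => A i + B i)
      (fun i _ => add_nonneg (hA0 i) (hB0 i)) (Finset.mem_univ i)
    exact ⟨(hA i x).trans (by linarith [hB0 i]), (hB i x).trans (by linarith [hA0 i])⟩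
  obtain ⟨C1, hC1⟩ := hC1
  have hC0' : 0 ≤ C0 := (norm_nonneg _).trans (hC0 0)
  have hC1' : 0 ≤ C1 := (norm_nonneg _).trans (hC1 0 0).1
  let D : Fin 3 → 𝓢(E3, ℂ) := fun i => ∂_{(EuclideanSpace.single i (1 : ℝ) : E3)} φ
  let D2 : Fin 3 → 𝓢(E3, ℂ) := fun i => ∂_{(EuclideanSpace.single i (1 : ℝ) : E3)} (D i)
  have hD : ∀ i, pd i φ = D i := fun i => (SchwartzMap.coe_lineDerivOp_single φ i).symm
  have hD2 : ∀ i, pd i (D i) = D2 i := fun i => (SchwartzMap.coe_lineDerivOp_single _ i).symm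
  have hdχk : ∀ k i, pd i (χk k) = fun x => (r k : ℂ) * pd i χ (r k • x) := fun k i =>
    pd_comp_smul i (r k) χ
  have hd2χk : ∀ k i, pd i (pd i (χk k)) = fun x => (r k : ℂ) ^ 2 * pd i (pd i χ) (r k • x) := by
    intro k i
    have hs : Differentiable ℝ (fun x => pd i χ (r k • x)) :=
      ((hχt.pd i).1.comp (contDiff_const_smul (r k))).differentiable (by simp)
    funext x
    rw [hdχk, pd_mul i (differentiableAt_const _) (hs x),
      pd_comp_smul i (r k) (pd i χ)]
    simp [pd]; ring
  have hpp : ∀ k i x, pd i (pd i (φk k)) x =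
      χk k x * D2 i x + 2 * pd i (χk k) x * D i x + pd i (pd i (χk k)) x * φ x := by
    intro k i x
    have hk : Differentiable ℝ (χk k) := (hχks k).differentiable (by simp)
    have hk' : Differentiable ℝ (pd i (χk k)) :=
      ((isTest_univ (hχks k) (hχkc k)).pd i).differentiable
    have e : pd i (φk k) = fun x => χk k x * D i x + pd i (χk k) x * φ x := by
      funext x
      rw [← hD, pd_mul i (hk x) φ.differentiableAt]
    rw [e, pd_add i ((hk x).fun_mul (D i).differentiableAt)
      ((hk' x).fun_mul φ.differentiableAt), pd_mul i (hk x) (D i).differentiableAt,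
      pd_mul i (hk' x) φ.differentiableAt, hD2, hD]
    ring
  have hev : ∀ x, ∀ᶠ k in atTop, χk k x = 1 ∧
      ∀ i, pd i (χk k) x = 0 ∧ pd i (pd i (χk k)) x = 0 := by
    intro x
    have hx : ∀ᶠ k in atTop, r k * ‖x‖ < 1 := by
      have : Tendsto (fun k => r k * ‖x‖) atTop (𝓝 (0 * ‖x‖)) := hrt.mul_const _
      rw [zero_mul] at this
      exact this.eventually_lt_const one_pos
    filter_upwards [hx] with k hk
    have hn : χk k =ᶠ[𝓝 x] fun _ => 1 := by
      have : ∀ᶠ y in 𝓝 x, r k * ‖y‖ < 1 :=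
        (continuous_const.mul continuous_norm).continuousAt.eventually_lt_const hk
      filter_upwards [this] with y hy
      refine hχ1 _ ?_
      rw [norm_smul, Real.norm_of_nonneg (hr0 k).le]; exact hy.le
    have hpd {f : E3 → ℂ} {a : ℂ} (i : Fin 3) (hf : f =ᶠ[𝓝 x] fun _ => a) :
        pd i f =ᶠ[𝓝 x] fun _ => 0 := by
      filter_upwards [hf.fderiv (𝕜 := ℝ)] with y hy
      simp [pd, hy]
    exact ⟨hn.eq_of_nhds, fun i => ⟨(hpd i hn).eq_of_nhds, (hpd i (hpd i hn)).eq_of_nhds⟩⟩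
  have hrn : ∀ k, ‖(r k : ℂ)‖ ≤ 1 := fun k => by
    rw [Complex.norm_real, Real.norm_of_nonneg (hr0 k).le]; exact hr1 k
  have hb1 : ∀ k i x, ‖pd i (χk k) x‖ ≤ C1 := fun k i x => by
    rw [hdχk, norm_mul]
    exact (mul_le_of_le_one_left (norm_nonneg _) (hrn k)).trans (hC1 i _).1
  have hb2 : ∀ k i x, ‖pd i (pd i (χk k)) x‖ ≤ C1 := fun k i x => by
    rw [hd2χk, norm_mul, norm_pow]
    exact (mul_le_of_le_one_left (norm_nonneg _) (pow_le_one₀ (norm_nonneg _) (hrn k))).trans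
      (hC1 i _).2
  have hΔ : ∀ x, (Δ φ : 𝓢(E3, ℂ)) x = ∑ i, D2 i x := fun x => by
    rw [SchwartzMap.coe_laplacian]
    simp only [hD, hD2]
  have lim1 : Tendsto (fun k => ∫ x, h x * (φk k x - ∑ i, pd i (pd i (φk k)) x)) atTop
      (𝓝 (∫ x, h x * (φ x - (Δ φ : 𝓢(E3, ℂ)) x))) := by
    refine tendsto_integral_of_dominated_convergence
      (fun x => ‖h x‖ * (C0 * ‖φ x‖ + ∑ i, (C0 * ‖D2 i x‖ + 2 * C1 * ‖D i x‖ + C1 * ‖φ x‖)))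
      ?_ ?_ ?_ ?_
    · intro k
      refine (Lp.memLp h).1.mul (Continuous.aestronglyMeasurable ?_)
      exact (hφk k).continuous.sub
        (continuous_finsetSum _ fun i _ => (((hφk k).pd i).pd i).continuous)
    · have hm {φ : 𝓢(E3, ℂ)} (C : ℝ) : MemLp (fun x => C * ‖φ x‖) 2 (volume : Measure E3) :=
        (φ.memLp 2).norm.const_mul C
      refine (Lp.memLp h).norm.integrable_mul (MemLp.add (hm _) ?_)
      exact memLp_finsetSum _ fun i _ => ((hm _).add (hm _)).add (hm _)
    · intro k
      refine Eventually.of_forall fun x => ?_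
      rw [norm_mul]
      refine mul_le_mul_of_nonneg_left ?_ (norm_nonneg _)
      refine (norm_sub_le _ _).trans (add_le_add ?_ ((norm_sum_le _ _).trans
        (Finset.sum_le_sum fun i _ => ?_)))
      · rw [norm_mul]
        exact mul_le_mul_of_nonneg_right (hC0 _) (norm_nonneg _)
      · rw [hpp]
        refine (norm_add₃_le).trans (add_le_add (add_le_add ?_ ?_) ?_)
        · rw [norm_mul]
          exact mul_le_mul_of_nonneg_right (hC0 _) (norm_nonneg _)
        · rw [norm_mul, norm_mul, Complex.norm_ofNat]
          gcongr
          exact hb1 k i x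
        · rw [norm_mul]
          exact mul_le_mul_of_nonneg_right (hb2 k i x) (norm_nonneg _)
    · refine Eventually.of_forall fun x => ?_
      refine tendsto_const_nhds.congr' ?_
      filter_upwards [hev x] with k hk
      simp only [hpp, hk.1, (hk.2 _).1, (hk.2 _).2, hΔ, φk]
      simp
  have lim2 : Tendsto (fun k => ∫ x, F x * φk k x) atTop (𝓝 (∫ x, F x * φ x)) := by
    refine tendsto_integral_of_dominated_convergence (fun x => ‖F x‖ * (C0 * ‖φ x‖)) ?_ ?_ ?_ ?_
    · exact fun k => (Lp.memLp F).1.mul (hφk k).continuous.aestronglyMeasurable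
    · exact (Lp.memLp F).norm.integrable_mul ((φ.memLp 2).norm.const_mul C0)
    · intro k
      refine Eventually.of_forall fun x => ?_
      rw [norm_mul, norm_mul]
      gcongr
      exact hC0 _
    · refine Eventually.of_forall fun x => ?_
      refine tendsto_const_nhds.congr' ?_
      filter_upwards [hev x] with k hk
      simp [φk, hk.1]
  refine tendsto_nhds_unique lim1 (lim2.congr fun k => (H _ (hφk k)).symm)

/-- The Fourier symbol `1 + 4π²|x|²` of the operator `1 - Δ`. -/
def helmholtzSymbol (x : E3) : ℂ := ((1 + ‖(2 * Real.pi) • x‖ ^ 2 : ℝ) : ℂ)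

/-- The reciprocal of the Fourier symbol of `1 - Δ`, written as a real power to match the symbols of
the Bessel potentials. -/
def helmholtzSymbolInv (x : E3) : ℂ := (((1 + ‖(2 * Real.pi) • x‖ ^ 2) ^ (-1 : ℝ) : ℝ) : ℂ)

theorem hasTemperateGrowth_helmholtzSymbol : Function.HasTemperateGrowth helmholtzSymbol := by
  have h : ∀ x, helmholtzSymbol x = ((1 + (2 * Real.pi) ^ 2 * ‖x‖ ^ 2 : ℝ) : ℂ) := fun x => by
    simp [helmholtzSymbol, norm_smul, mul_pow]
  rw [funext h]; fun_prop

theorem hasTemperateGrowth_helmholtzSymbolInv : Function.HasTemperateGrowth helmholtzSymbolInv := by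
  have h1 : Function.HasTemperateGrowth (fun x : E3 => (2 * Real.pi) • x) := by fun_prop
  have h2 := (Function.hasTemperateGrowth_one_add_norm_sq_rpow E3 (-1)).comp h1
  unfold helmholtzSymbolInv
  have h3 : Function.HasTemperateGrowth Complex.ofReal := by fun_prop
  exact h3.comp h2

open TemperedDistribution in
/-- `1 - Δ` is the Fourier multiplier with symbol `1 + 4π²|x|²`. -/
theorem sub_laplacian_eq (T : 𝓢'(E3, ℂ)) :
    T - Δ T = fourierMultiplierCLM ℂ helmholtzSymbol T := by
  rw [TemperedDistribution.laplacian_eq_fourierMultiplierCLM]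
  -- the symbol is presented as a sum over `Fin 2` for `fourierMultiplierCLM_sum`
  have e : helmholtzSymbol = fun x => ∑ i : Fin 2,
      (![fun _ => (1 : ℂ),
        ((2 * Real.pi) ^ 2 : ℂ) • fun x : E3 => Complex.ofReal (‖x‖ ^ 2)] i) x := by
    funext x
    simp [helmholtzSymbol, norm_smul, mul_pow, abs_of_pos Real.pi_pos]
  have hg : ∀ i ∈ (Finset.univ : Finset (Fin 2)), Function.HasTemperateGrowth
      (![fun _ => (1 : ℂ),
        ((2 * Real.pi) ^ 2 : ℂ) • fun x : E3 => Complex.ofReal (‖x‖ ^ 2)] i) := by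
    intro i _
    fin_cases i
    · exact Function.HasTemperateGrowth.const _
    · exact Function.HasTemperateGrowth.mul (f := fun _ => ((2 * Real.pi) ^ 2 : ℂ))
        (Function.HasTemperateGrowth.const _) (by fun_prop)
  rw [e, fourierMultiplierCLM_sum ℂ hg, Fin.sum_univ_two]
  simp only [Matrix.cons_val_zero, Matrix.cons_val_one]
  rw [fourierMultiplierCLM_const, fourierMultiplierCLM_smul (by fun_prop)]
  simp [sub_eq_add_neg]
  norm_cast

section WholeSpace

variable {h F : Lp ℂ 2 (volume : Measure E3)}

theorem toTemperedDistribution_sub_laplacian (H : ∀ φ, IsTest Set.univ φ →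
      ∫ x, h x * (φ x - ∑ i, pd i (pd i φ) x) = ∫ x, F x * φ x) :
    (h : 𝓢'(E3, ℂ)) - Δ (h : 𝓢'(E3, ℂ)) = F := by
  ext φ
  have := integral_schwartz_of_test H φ
  have e : ∀ (T S : 𝓢'(E3, ℂ)), (T - S) φ = T φ - S φ := fun _ _ => rfl
  rw [e, TemperedDistribution.laplacian_apply_apply, Lp.toTemperedDistribution_apply,
    Lp.toTemperedDistribution_apply, Lp.toTemperedDistribution_apply]
  simp only [mul_sub] at this
  rw [integral_sub (integrable_mul_schwartz h φ) (integrable_mul_schwartz h _)] at this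
  simpa [mul_comm] using this

theorem eq_fourierMultiplier_of_sub_laplacian {T R : 𝓢'(E3, ℂ)} (h : T - Δ T = R) :
    T = TemperedDistribution.fourierMultiplierCLM ℂ helmholtzSymbolInv R := by
  rw [sub_laplacian_eq] at h
  rw [← h, TemperedDistribution.fourierMultiplierCLM_fourierMultiplierCLM_apply
    hasTemperateGrowth_helmholtzSymbol hasTemperateGrowth_helmholtzSymbolInv]
  have e : helmholtzSymbol * helmholtzSymbolInv = fun _ => (1 : ℂ) := by
    funext x
    have : (1 + ‖(2 * Real.pi) • x‖ ^ 2 : ℝ) ≠ 0 := by positivity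
    simp only [Pi.mul_apply, helmholtzSymbol, helmholtzSymbolInv, ← Complex.ofReal_mul]
    rw [Real.rpow_neg_one, mul_inv_cancel₀ this, Complex.ofReal_one]
  rw [e, TemperedDistribution.fourierMultiplierCLM_const]
  simp

/-- The only `L²` solution of `h - Δh = 0` on the whole space is zero. -/
theorem eq_zero_of_sub_laplacian (H : ∀ φ, IsTest Set.univ φ →
      ∫ x, h x * (φ x - ∑ i, pd i (pd i φ) x) = 0) : h = 0 := by
  have h0 := toTemperedDistribution_sub_laplacian (h := h) (F := 0) (fun φ hφ => by
    rw [H φ hφ, integral_congr_ae (g := fun _ => 0)]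
    · simp
    · filter_upwards [Lp.coeFn_zero ℂ 2 (volume : Measure E3)] with x hx
      rw [hx]; simp)
  have h1 := eq_fourierMultiplier_of_sub_laplacian h0
  have hz : ((0 : Lp ℂ 2 (volume : Measure E3)) : 𝓢'(E3, ℂ)) = 0 := by
    rw [← Lp.toTemperedDistributionCLM_apply, map_zero]
  rw [hz, map_zero] at h1
  have hk := Lp.ker_toTemperedDistributionCLM_eq_bot (F := ℂ) (p := 2)
    (μ := (volume : Measure E3))
  rw [LinearMap.ker_eq_bot'] at hk
  exact hk h h1

/-- Regularity on the whole space: an `L²` solution of `h - Δh = F ∈ L²` is in `H²`. -/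
theorem memSobolev_two_of_sub_laplacian (H : ∀ φ, IsTest Set.univ φ →
      ∫ x, h x * (φ x - ∑ i, pd i (pd i φ) x) = ∫ x, F x * φ x) :
    TemperedDistribution.MemSobolev 2 2 (h : 𝓢'(E3, ℂ)) := by
  have h0 := eq_fourierMultiplier_of_sub_laplacian (toTemperedDistribution_sub_laplacian H)
  have h1 : TemperedDistribution.MemSobolev 0 2 (F : 𝓢'(E3, ℂ)) :=
    TemperedDistribution.memSobolev_zero_iff.2 ⟨F, rfl⟩
  have e : (2 : ℝ) = 2 + 0 := by norm_num
  rw [e, ← TemperedDistribution.memSobolev_besselPotential_iff, h0,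
    TemperedDistribution.besselPotential,
    TemperedDistribution.fourierMultiplierCLM_fourierMultiplierCLM_apply
      hasTemperateGrowth_helmholtzSymbolInv (by fun_prop)]
  refine h1.fourierMultiplierCLM_of_bounded
    (hasTemperateGrowth_helmholtzSymbolInv.mul (by fun_prop)) ⟨1, fun x => ?_⟩
  have hp : (1 : ℝ) ≤ 2 * Real.pi := by linarith [Real.pi_gt_three]
  have hx : ‖x‖ ≤ ‖(2 * Real.pi) • x‖ := by
    rw [norm_smul, Real.norm_of_nonneg (by positivity)]
    exact le_mul_of_one_le_left (norm_nonneg _) hp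
  rw [Pi.mul_apply, helmholtzSymbolInv, ← Complex.ofReal_mul, Complex.norm_real,
    Real.norm_of_nonneg (by positivity), Real.rpow_neg_one, div_self two_ne_zero, Real.rpow_one,
    inv_mul_le_one₀ (by positivity)]
  gcongr

/-- The first and second weak derivatives of an `L²` solution of `h - Δh = F ∈ L²` are in `L²`. -/
theorem exists_weak_derivatives (H : ∀ φ, IsTest Set.univ φ →
      ∫ x, h x * (φ x - ∑ i, pd i (pd i φ) x) = ∫ x, F x * φ x) :
    (∀ i, ∃ v : Lp ℂ 2 (volume : Measure E3), ∀ φ, IsTest Set.univ φ →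
      ∫ x, h x * pd i φ x = -∫ x, v x * φ x) ∧
    ∀ i j, ∃ v : Lp ℂ 2 (volume : Measure E3), ∀ φ, IsTest Set.univ φ →
      ∫ x, h x * pd i (pd j φ) x = ∫ x, v x * φ x := by
  have h2 := memSobolev_two_of_sub_laplacian H
  constructor
  · intro i
    have h3 := (h2.lineDerivOp (m := (EuclideanSpace.single i (1 : ℝ) : E3))).mono
      (s' := 0) (by norm_num)
    obtain ⟨v, hv⟩ := TemperedDistribution.memSobolev_zero_iff.1 h3
    refine ⟨v, fun φ hφ => ?_⟩
    have h4 := DFunLike.congr_fun hv (hφ.2.1.toSchwartzMap hφ.1)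
    rw [TemperedDistribution.lineDerivOp_apply_apply, Lp.toTemperedDistribution_apply,
      Lp.toTemperedDistribution_apply] at h4
    simp only [neg_apply, SchwartzMap.coe_lineDerivOp_single, smul_eq_mul,
      mul_comm _ (h _), mul_comm _ (v _)] at h4
    simp only [mul_neg, integral_neg] at h4
    rw [← neg_eq_iff_eq_neg]
    exact h4
  · intro i j
    have h3 := ((h2.lineDerivOp (m := (EuclideanSpace.single i (1 : ℝ) : E3))).lineDerivOp
      (m := (EuclideanSpace.single j (1 : ℝ) : E3))).mono (s' := 0) (by norm_num)
    obtain ⟨v, hv⟩ := TemperedDistribution.memSobolev_zero_iff.1 h3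
    refine ⟨v, fun φ hφ => ?_⟩
    have h4 := DFunLike.congr_fun hv (hφ.2.1.toSchwartzMap hφ.1)
    rw [TemperedDistribution.lineDerivOp_apply_apply, TemperedDistribution.lineDerivOp_apply_apply,
      Lp.toTemperedDistribution_apply, Lp.toTemperedDistribution_apply,
      LineDeriv.lineDerivOp_neg] at h4
    simp only [neg_neg, SchwartzMap.coe_lineDerivOp_single, smul_eq_mul,
      mul_comm _ (h _), mul_comm _ (v _)] at h4
    exact h4

end WholeSpace

/-! ### Cutting off near the boundary plane -/

/-- The derivative of the smooth transition function. -/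
def bumpDeriv : ℝ → ℝ := deriv Real.smoothTransition

theorem hasDerivAt_smoothTransition (s : ℝ) :
    HasDerivAt Real.smoothTransition (bumpDeriv s) s :=
  (Real.smoothTransition.contDiff (n := 1).differentiable (by simp) s).hasDerivAt

theorem continuous_bumpDeriv : Continuous bumpDeriv :=
  (Real.smoothTransition.contDiff (n := 1)).continuous_deriv (by simp)

theorem bumpDeriv_of_lt {s : ℝ} (h : s < 0) : bumpDeriv s = 0 := by
  have : Real.smoothTransition =ᶠ[𝓝 s] fun _ => 0 := by
    filter_upwards [gt_mem_nhds h] with y hy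
    exact Real.smoothTransition.zero_of_nonpos hy.le
  rw [bumpDeriv, this.deriv_eq, deriv_const]

theorem bumpDeriv_of_gt {s : ℝ} (h : 1 < s) : bumpDeriv s = 0 := by
  have : Real.smoothTransition =ᶠ[𝓝 s] fun _ => 1 := by
    filter_upwards [lt_mem_nhds h] with y hy
    exact Real.smoothTransition.one_of_one_le hy.le
  rw [bumpDeriv, this.deriv_eq, deriv_const]

theorem hasCompactSupport_bumpDeriv : HasCompactSupport bumpDeriv :=
  HasCompactSupport.intro (K := Set.Icc 0 1) isCompact_Icc fun s hs => by
    by_cases h : s < 0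
    · exact bumpDeriv_of_lt h
    · exact bumpDeriv_of_gt (by by_contra h'; exact hs ⟨not_lt.1 h, not_lt.1 h'⟩)

namespace Frame

variable (S : Frame)

/-- A cutoff vanishing at depth at most `1 / (k + 1)` and equal to one at depth at least
`2 / (k + 1)`. -/
def cut (k : ℕ) (x : E3) : ℂ := (Real.smoothTransition (((k : ℝ) + 1) * S.depth x - 1) : ℝ)

theorem contDiff_cut (k : ℕ) : ContDiff ℝ ∞ (S.cut k) :=
  Complex.ofRealCLM.contDiff.comp (Real.smoothTransition.contDiff.comp
    ((contDiff_const.mul S.contDiff_depth).sub contDiff_const))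

theorem norm_cut_le (k : ℕ) (x : E3) : ‖S.cut k x‖ ≤ 1 := by
  rw [cut, Complex.norm_real, Real.norm_of_nonneg (Real.smoothTransition.nonneg _)]
  exact Real.smoothTransition.le_one _

theorem eventually_cut {x : E3} (hx : x ∈ S.dom) :
    ∀ᶠ k : ℕ in atTop, 1 < ((k : ℝ) + 1) * S.depth x - 1 := by
  have h : Tendsto (fun k : ℕ => ((k : ℝ) + 1) * S.depth x - 1) atTop atTop := by
    refine tendsto_atTop_add_const_right _ _ (Tendsto.atTop_mul_const (S.mem_dom.1 hx) ?_)
    exact tendsto_atTop_add_const_right _ _ tendsto_natCast_atTop_atTop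
  exact h.eventually_gt_atTop 1

theorem tendsto_cut {x : E3} (hx : x ∈ S.dom) :
    Tendsto (fun k => S.cut k x) atTop (𝓝 1) := by
  refine tendsto_const_nhds.congr' ?_
  filter_upwards [S.eventually_cut hx] with k hk
  rw [cut, Real.smoothTransition.one_of_one_le hk.le, Complex.ofReal_one]

theorem isTest_cut_mul {φ : E3 → ℂ} (hφ : IsTest Set.univ φ) (k : ℕ) :
    IsTest S.dom (fun x => S.cut k x * φ x) := by
  have h := hφ.mul_left (S.contDiff_cut k)
  refine ⟨h.1, h.2.1, ?_⟩
  have hk : (0 : ℝ) < (k : ℝ) + 1 := by positivity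
  have hc : IsClosed {x : E3 | 1 ≤ ((k : ℝ) + 1) * S.depth x} :=
    isClosed_le continuous_const (continuous_const.mul S.continuous_depth)
  refine (closure_minimal (fun x hx => ?_) hc).trans (fun x hx => ?_)
  · by_contra h'
    have h' : ((k : ℝ) + 1) * S.depth x < 1 := not_le.1 h'
    apply hx
    simp only [cut]
    rw [Real.smoothTransition.zero_of_nonpos (by linarith)]
    simp
  · have hx : 1 ≤ ((k : ℝ) + 1) * S.depth x := hx
    rw [mem_dom]
    by_contra h'
    nlinarith

theorem pd_cut (k : ℕ) (i : Fin 3) (x : E3) : pd i (S.cut k) x =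
    -(((k : ℝ) + 1) * bumpDeriv (((k : ℝ) + 1) * S.depth x - 1) : ℝ) * (S.n i : ℂ) := by
  have h1 : HasFDerivAt S.depth (-(innerSL ℝ S.n)) x := by
    have := (innerSL ℝ S.n).hasFDerivAt (x := x) |>.const_sub S.c
    exact this
  have h2 : HasFDerivAt (fun x => ((k : ℝ) + 1) * S.depth x - 1)
      (((k : ℝ) + 1) • -(innerSL ℝ S.n)) x := (h1.const_mul _).sub_const _
  have h3 := (hasDerivAt_smoothTransition (((k : ℝ) + 1) * S.depth x - 1)).comp_hasFDerivAt x h2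
  have h4 := Complex.ofRealCLM.hasFDerivAt.comp x h3
  have h5 : fderiv ℝ (S.cut k) x = _ := h4.fderiv
  simp only [pd, h5]
  have : inner ℝ S.n (EuclideanSpace.single i (1 : ℝ)) = S.n i := by
    rw [EuclideanSpace.inner_single_right]; simp
  simp [this]
  ring

/-- The Lipschitz bound for a function vanishing on the boundary plane. -/
theorem exists_norm_le_depth {W : E3 → ℂ} (hW : IsTest Set.univ W)
    (h0 : ∀ x, S.depth x = 0 → W x = 0) : ∃ C : ℝ, 0 ≤ C ∧ ∀ x, ‖W x‖ ≤ C * |S.depth x| := by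
  obtain ⟨C, hC⟩ := ContDiff.lipschitzWith_of_hasCompactSupport hW.2.1 hW.1 (by simp)
  refine ⟨C, C.2, fun x => ?_⟩
  have h1 : S.depth (x + S.depth x • S.n) = 0 := by
    rw [S.depth_add, inner_smul_right, S.inner_n_n]; ring
  have h2 := hC.dist_le_mul x (x + S.depth x • S.n)
  rw [dist_eq_norm, h0 _ h1, sub_zero, dist_self_add_right, norm_smul, S.norm_n, mul_one] at h2
  exact h2

/-- The weak derivatives of `u` may be tested against vector fields which are merely tangential
on the boundary. -/
theorem integral_mul_div {u : L2 S.dom} {p : Fin 3 → L2 S.dom}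
    (hp : ∀ i, HasWeakD S.dom (Pi.single i 1) u (p i)) {V : Fin 3 → E3 → ℂ}
    (hV : ∀ i, IsTest Set.univ (V i))
    (h0 : ∀ x, S.depth x = 0 → ∑ i, (S.n i : ℂ) * V i x = 0) :
    ∫ x in S.dom, u x * ∑ i, pd i (V i) x = -∑ i, ∫ x in S.dom, p i x * V i x := by
  have hWt : IsTest Set.univ (fun x => ∑ i, (S.n i : ℂ) * V i x) := by
    have h (i : Fin 3) : IsTest Set.univ (fun x => (S.n i : ℂ) * V i x) :=
      (hV i).mul_left contDiff_const
    simp only [Fin.sum_univ_three]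
    exact ((h 0).add (h 1)).add (h 2)
  obtain ⟨C, hC0, hC⟩ := S.exists_norm_le_depth hWt h0
  set W : E3 → ℂ := fun x => ∑ i, (S.n i : ℂ) * V i x with hWdef
  obtain ⟨B, hB⟩ := hasCompactSupport_bumpDeriv.exists_bound_of_continuous continuous_bumpDeriv
  have hB0 : 0 ≤ B := (norm_nonneg _).trans (hB 0)
  have hdiv : IsTest Set.univ (fun x => ∑ i, pd i (V i) x) := by
    simp only [Fin.sum_univ_three]
    exact (((hV 0).pd 0).add ((hV 1).pd 1)).add ((hV 2).pd 2)
  -- the layer term is bounded because `W` vanishes on the boundary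
  have hlayer : ∀ (k : ℕ) x, 0 < S.depth x →
      ‖(((k : ℝ) + 1) * bumpDeriv (((k : ℝ) + 1) * S.depth x - 1) : ℝ) * W x‖ ≤ 2 * B * C := by
    intro k x hx
    have hk : (0 : ℝ) < (k : ℝ) + 1 := by positivity
    by_cases h : 1 < ((k : ℝ) + 1) * S.depth x - 1
    · rw [bumpDeriv_of_gt h, mul_zero, Complex.ofReal_zero, zero_mul, norm_zero]
      exact mul_nonneg (mul_nonneg zero_le_two hB0) hC0
    · rw [norm_mul, Complex.norm_real, norm_mul, Real.norm_of_nonneg hk.le]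
      have h1 := hC x
      rw [abs_of_pos hx] at h1
      calc ((k : ℝ) + 1) * ‖bumpDeriv (((k : ℝ) + 1) * S.depth x - 1)‖ * ‖W x‖
          ≤ ((k : ℝ) + 1) * B * (C * S.depth x) := by gcongr; exact hB _
        _ = (((k : ℝ) + 1) * S.depth x) * (B * C) := by ring
        _ ≤ 2 * (B * C) := by
            have := mul_nonneg hB0 hC0
            gcongr; linarith
        _ = _ := by ring
  have key : ∀ k, ∫ x in S.dom, u x * (S.cut k x * ∑ i, pd i (V i) x
        - (((k : ℝ) + 1) * bumpDeriv (((k : ℝ) + 1) * S.depth x - 1) : ℝ) * W x)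
      = -∑ i, ∫ x in S.dom, p i x * (S.cut k x * V i x) := by
    intro k
    have h1 : ∀ i, _ := fun i => hasWeakD_single_iff.1 (hp i) _ (S.isTest_cut_mul (hV i) k)
    rw [← Finset.sum_neg_distrib, ← Finset.sum_congr rfl fun i _ => h1 i, ← integral_finsetSum]
    · congr 1
      funext x
      rw [← Finset.mul_sum]
      congr 1
      rw [hWdef, Finset.mul_sum, Finset.mul_sum, ← Finset.sum_sub_distrib]
      refine Finset.sum_congr rfl fun i _ => ?_
      rw [pd_mul i ((S.contDiff_cut k).differentiable (by simp) x) ((hV i).differentiable x),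
        S.pd_cut]
      ring
    · exact fun i _ => integrable_mul_test ((S.isTest_cut_mul (hV i) k).pd i) u
  have hdom : ∀ᵐ x ∂(volume.restrict S.dom), x ∈ S.dom := ae_restrict_mem S.isOpen_dom.measurableSet
  have lim1 : Tendsto (fun k : ℕ => ∫ x in S.dom, u x * (S.cut k x * ∑ i, pd i (V i) x
        - (((k : ℝ) + 1) * bumpDeriv (((k : ℝ) + 1) * S.depth x - 1) : ℝ) * W x)) atTop
      (𝓝 (∫ x in S.dom, u x * ∑ i, pd i (V i) x)) := by
    refine tendsto_integral_of_dominated_convergence (fun x => ‖u x‖ *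
      (‖∑ i, pd i (V i) x‖ + (tsupport W).indicator (fun _ => 2 * B * C) x)) ?_ ?_ ?_ ?_
    · intro k
      refine (Lp.memLp u).1.mul (Continuous.aestronglyMeasurable ?_)
      refine ((S.contDiff_cut k).continuous.mul hdiv.continuous).sub
        (Continuous.mul (Complex.continuous_ofReal.comp (continuous_const.mul
          (continuous_bumpDeriv.comp ((continuous_const.mul S.continuous_depth).sub
            continuous_const)))) hWt.continuous)
    · refine (Lp.memLp u).norm.integrable_mul (MemLp.add (memLp_test hdiv 2 _).norm ?_)
      refine (memLp_indicator_const 2 (isClosed_tsupport W).measurableSet _ (Or.inr ?_))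
      exact ((Measure.restrict_apply_le _ _).trans_lt hWt.2.1.measure_lt_top).ne
    · intro k
      filter_upwards [hdom] with x hx
      rw [norm_mul]
      refine mul_le_mul_of_nonneg_left ((norm_sub_le _ _).trans (add_le_add ?_ ?_)) (norm_nonneg _)
      · rw [norm_mul]
        exact mul_le_of_le_one_left (norm_nonneg _) (S.norm_cut_le k x)
      · by_cases h : x ∈ tsupport W
        · rw [Set.indicator_of_mem h]; exact hlayer k x (S.mem_dom.1 hx)
        · rw [Set.indicator_of_notMem h, image_eq_zero_of_notMem_tsupport h]; simp
    · filter_upwards [hdom] with x hx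
      refine Tendsto.const_mul _ ?_
      have h2 : Tendsto (fun k : ℕ => ((((k : ℝ) + 1) *
          bumpDeriv (((k : ℝ) + 1) * S.depth x - 1) : ℝ) : ℂ) * W x) atTop (𝓝 0) := by
        refine tendsto_const_nhds.congr' ?_
        filter_upwards [S.eventually_cut hx] with k hk
        rw [bumpDeriv_of_gt hk]; simp
      simpa using ((S.tendsto_cut hx).mul_const _).sub h2
  have lim2 : Tendsto (fun k : ℕ => -∑ i, ∫ x in S.dom, p i x * (S.cut k x * V i x)) atTop
      (𝓝 (-∑ i, ∫ x in S.dom, p i x * V i x)) := by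
    refine (tendsto_finsetSum _ fun i _ => ?_).neg
    refine tendsto_integral_of_dominated_convergence (fun x => ‖p i x‖ * ‖V i x‖) ?_ ?_ ?_ ?_
    · exact fun k => (Lp.memLp (p i)).1.mul
        ((S.contDiff_cut k).continuous.mul (hV i).continuous).aestronglyMeasurable
    · exact (Lp.memLp (p i)).norm.integrable_mul (memLp_test (hV i) 2 _).norm
    · intro k
      refine Eventually.of_forall fun x => ?_
      rw [norm_mul, norm_mul]
      gcongr
      exact mul_le_of_le_one_left (norm_nonneg _) (S.norm_cut_le k x)
    · filter_upwards [hdom] with x hx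
      simpa using ((S.tendsto_cut hx).mul_const (V i x)).const_mul (p i x)
  exact tendsto_nhds_unique lim1 (lim2.congr fun k => (key k).symm)

end Frame

/-! ### Reflection in the boundary plane -/

namespace Frame

variable (S : Frame)

/-- The reflection in the boundary plane. -/
def refl (x : E3) : E3 := x + (2 * S.depth x) • S.n

theorem depth_refl (x : E3) : S.depth (S.refl x) = -S.depth x := by
  rw [refl, S.depth_add, inner_smul_right, S.inner_n_n]; ring

theorem refl_refl (x : E3) : S.refl (S.refl x) = x := by
  have h : S.refl (S.refl x) = S.refl x + (2 * S.depth (S.refl x)) • S.n := rfl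
  rw [h, S.depth_refl, refl, add_assoc, ← add_smul]
  simp

theorem contDiff_refl : ContDiff ℝ ∞ S.refl :=
  contDiff_id.add ((contDiff_const.mul S.contDiff_depth).smul contDiff_const)

@[fun_prop] theorem continuous_refl : Continuous S.refl := S.contDiff_refl.continuous

/-- The reflection as a homeomorphism. -/
def reflHomeo : E3 ≃ₜ E3 where
  toFun := S.refl
  invFun := S.refl
  left_inv := S.refl_refl
  right_inv := S.refl_refl
  continuous_toFun := S.continuous_refl
  continuous_invFun := S.continuous_refl

theorem refl_chart (p : E2 × ℝ) : S.refl (S.chart p) = S.chart (p.1, -p.2) := by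
  rw [refl, S.depth_chart, chart, chart, add_assoc, ← add_smul]
  congr 2; ring

theorem measurePreserving_refl : MeasurePreserving S.refl := by
  have h1 : MeasurePreserving (fun p : E2 × ℝ => (p.1, -p.2)) :=
    (MeasurePreserving.id (volume : Measure E2)).prod (Measure.measurePreserving_neg volume)
  have h2 : MeasurePreserving (S.refl ∘ S.chart) := by
    have := S.measurePreserving_chart.comp h1
    convert this using 1
    funext p; exact S.refl_chart p
  refine ⟨S.continuous_refl.measurable, ?_⟩
  rw [← S.measurePreserving_chart.map_eq, Measure.map_map S.continuous_refl.measurable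
    S.continuous_chart.measurable, h2.map_eq, S.measurePreserving_chart.map_eq]

theorem volume_boundary : volume {x | S.depth x = 0} = 0 := by
  have hm : MeasurableSet {x | S.depth x = 0} :=
    (isClosed_eq S.continuous_depth continuous_const).measurableSet
  rw [← S.measurePreserving_chart.measure_preimage hm.nullMeasurableSet]
  have e : S.chart ⁻¹' {x | S.depth x = 0} = Set.univ ×ˢ {(0 : ℝ)} := by
    ext p; simp
  rw [e, Measure.volume_eq_prod, Measure.prod_prod]
  simp

theorem measurePreserving_refl_compl :
    MeasurePreserving S.refl (volume.restrict S.domᶜ) (volume.restrict S.dom) := by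
  have h := S.measurePreserving_refl.restrict_preimage S.isOpen_dom.measurableSet
  have e : (S.refl ⁻¹' S.dom : Set E3) =ᵐ[volume] (S.domᶜ : Set E3) := by
    have h0 : ∀ᵐ x ∂(volume : Measure E3), S.depth x ≠ 0 := by
      rw [ae_iff]; simpa using S.volume_boundary
    filter_upwards [h0] with x hx
    apply propext
    change x ∈ S.refl ⁻¹' S.dom ↔ x ∈ S.domᶜ
    rw [Set.mem_preimage, mem_dom, depth_refl, Set.mem_compl_iff, mem_dom, not_lt]
    constructor
    · intro h; linarith
    · intro h; have := lt_of_le_of_ne h hx; linarith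
  rwa [Measure.restrict_congr_set e] at h

/-- The even reflection of a function on the half-space. -/
def evenExt (u : E3 → ℂ) : E3 → ℂ := by
  classical exact S.dom.piecewise u (u ∘ S.refl)

theorem memLp_evenExt (u : L2 S.dom) : MemLp (S.evenExt u) 2 := by
  classical
  exact MemLp.piecewise S.isOpen_dom.measurableSet (Lp.memLp u)
    ((Lp.memLp u).comp_measurePreserving S.measurePreserving_refl_compl)

theorem evenExt_of_mem {u : E3 → ℂ} {x : E3} (hx : x ∈ S.dom) : S.evenExt u x = u x := by
  classical exact Set.piecewise_eq_of_mem _ _ _ hx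

theorem integral_evenExt_mul (u : L2 S.dom) {φ : E3 → ℂ} (hφ : IsTest Set.univ φ) :
    ∫ x, S.evenExt u x * φ x = ∫ x in S.dom, u x * (φ x + φ (S.refl x)) := by
  have hi : Integrable (fun x => S.evenExt u x * φ x) := by
    have h : MemLp φ 2 volume := hφ.continuous.memLp_of_hasCompactSupport hφ.2.1
    exact (S.memLp_evenExt u).integrable_mul h
  have hφr : IsTest Set.univ (fun x => φ (S.refl x)) :=
    isTest_univ (hφ.1.comp S.contDiff_refl) (hφ.2.1.comp_homeomorph S.reflHomeo)
  rw [← integral_add_compl S.isOpen_dom.measurableSet hi]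
  simp only [mul_add]
  rw [integral_add (integrable_mul_test hφ u) (integrable_mul_test hφr u)]
  congr 1
  · exact setIntegral_congr_fun S.isOpen_dom.measurableSet fun x hx => by
      simp only [S.evenExt_of_mem hx]
  · rw [← S.measurePreserving_refl_compl.integral_comp S.reflHomeo.measurableEmbedding]
    refine setIntegral_congr_fun S.isOpen_dom.measurableSet.compl fun x hx => ?_
    classical
    simp only [evenExt, S.refl_refl]
    rw [Set.piecewise_eq_of_notMem _ _ _ hx]; rfl

/-- The chain rule for the reflection, whose linear part is `v ↦ v - 2⟪n, v⟫n`. -/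
theorem pd_comp_refl {φ : E3 → ℂ} (hφ : Differentiable ℝ φ) (j : Fin 3) :
    pd j (fun x => φ (S.refl x)) =
      fun x => pd j φ (S.refl x) - 2 * S.n j * ∑ k, (S.n k : ℂ) * pd k φ (S.refl x) := by
  funext x
  have h1 : HasFDerivAt S.depth (-(innerSL ℝ S.n)) x :=
    (innerSL ℝ S.n).hasFDerivAt (x := x) |>.const_sub S.c
  have h2 : HasFDerivAt S.refl (ContinuousLinearMap.id ℝ E3 +
      ((2 : ℝ) • -(innerSL ℝ S.n)).smulRight S.n) x :=
    (hasFDerivAt_id x).add ((h1.const_mul 2).smul_const S.n)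
  have h3 := (hφ (S.refl x)).hasFDerivAt.comp x h2
  have h4 : fderiv ℝ (fun x => φ (S.refl x)) x = _ := h3.fderiv
  have : inner ℝ S.n (EuclideanSpace.single j (1 : ℝ)) = S.n j := by
    rw [EuclideanSpace.inner_single_right]; simp
  simp only [pd, h4]
  rw [← pd.eq_1 j]
  simp only [ContinuousLinearMap.comp_apply, add_apply, ContinuousLinearMap.id_apply,
    ContinuousLinearMap.smulRight_apply, smul_apply, neg_apply, innerSL_apply_apply, this, map_add,
    map_smul, fderiv_eq_sum_pd φ (S.refl x) S.n]
  simp [pd]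
  ring

theorem sum_n_sq : ∑ i, (S.n i : ℂ) ^ 2 = 1 := by
  have := S.inner_n_n
  rw [PiLp.inner_apply] at this
  simp only [RCLike.inner_apply, conj_trivial] at this
  have h2 := congrArg (fun r : ℝ => (r : ℂ)) this
  simp only [Complex.ofReal_sum, Complex.ofReal_mul, Complex.ofReal_one] at h2
  rw [← h2]
  exact Finset.sum_congr rfl fun i _ => by ring

/-- The Laplacian commutes with the reflection. -/
theorem laplacian_comp_refl {φ : E3 → ℂ} (hφ : IsTest Set.univ φ) (x : E3) :
    ∑ j, pd j (pd j (fun x => φ (S.refl x))) x = ∑ j, pd j (pd j φ) (S.refl x) := by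
  have hd : ∀ i, Differentiable ℝ (fun x => pd i φ (S.refl x)) := fun i =>
    (hφ.pd i).differentiable.comp (S.contDiff_refl.differentiable (by simp))
  have h : ∀ j, pd j (pd j (fun x => φ (S.refl x))) x =
      pd j (fun x => pd j φ (S.refl x)) x
        - 2 * S.n j * ∑ k, (S.n k : ℂ) * pd j (fun x => pd k φ (S.refl x)) x := by
    intro j
    rw [S.pd_comp_refl hφ.differentiable]
    have e : ∀ k, pd j (fun x => pd k φ (S.refl x)) x =
      fderiv ℝ (fun x => pd k φ (S.refl x)) x (EuclideanSpace.single j 1) := fun _ => rfl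
    simp only [e]
    rw [pd, fderiv_fun_sub (hd j x)
      ((DifferentiableAt.fun_sum fun k _ => (hd k x).const_mul _).const_mul _),
      fderiv_const_mul (DifferentiableAt.fun_sum fun k _ => (hd k x).const_mul _),
      fderiv_fun_sum fun k _ => (hd k x).const_mul _]
    simp only [sub_apply, smul_apply, sum_apply, smul_eq_mul]
    congr 2
    refine Finset.sum_congr rfl fun k _ => ?_
    rw [fderiv_const_mul (hd k x)]; rfl
  simp only [h, S.pd_comp_refl (hφ.pd _).differentiable]
  have hn := S.sum_n_sq
  have c01 := congrFun (pd_comm hφ 0 1) (S.refl x)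
  have c02 := congrFun (pd_comm hφ 0 2) (S.refl x)
  have c12 := congrFun (pd_comm hφ 1 2) (S.refl x)
  simp only [Fin.sum_univ_three] at hn ⊢
  rw [c01, c02, c12]
  generalize pd 0 (pd 0 φ) (S.refl x) = a00
  generalize pd 1 (pd 1 φ) (S.refl x) = a11
  generalize pd 2 (pd 2 φ) (S.refl x) = a22
  generalize pd 1 (pd 0 φ) (S.refl x) = a10
  generalize pd 2 (pd 0 φ) (S.refl x) = a20
  generalize pd 2 (pd 1 φ) (S.refl x) = a21
  generalize (S.n 0 : ℂ) = n0 at *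
  generalize (S.n 1 : ℂ) = n1 at *
  generalize (S.n 2 : ℂ) = n2 at *
  linear_combination (4 * (n0 ^ 2 * a00 + n1 ^ 2 * a11 + n2 ^ 2 * a22
    + 2 * n0 * n1 * a10 + 2 * n0 * n2 * a20 + 2 * n1 * n2 * a21)) * hn

/-- The even reflection of a weak solution of the homogeneous Neumann problem solves the equation
on the whole space. -/
theorem evenExt_equation {u F : L2 S.dom} {p : Fin 3 → L2 S.dom}
    (hp : ∀ i, HasWeakD S.dom (Pi.single i 1) u (p i))
    (hF : ∀ φ, IsTest Set.univ φ → (∑ i, ∫ x in S.dom, p i x * pd i φ x)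
      + ∫ x in S.dom, u x * φ x = ∫ x in S.dom, F x * φ x) {φ : E3 → ℂ}
    (hφ : IsTest Set.univ φ) :
    ∫ x, S.evenExt u x * (φ x - ∑ i, pd i (pd i φ) x) = ∫ x, S.evenExt F x * φ x := by
  have hφr : IsTest Set.univ (fun x => φ (S.refl x)) :=
    isTest_univ (hφ.1.comp S.contDiff_refl) (hφ.2.1.comp_homeomorph S.reflHomeo)
  have hθ := hφ.add hφr
  set θ : E3 → ℂ := fun x => φ x + φ (S.refl x) with hθdef
  have hL {ψ : E3 → ℂ} (hψ : IsTest Set.univ ψ) :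
      IsTest Set.univ (fun x => ∑ i, pd i (pd i ψ) x) := by
    simp only [Fin.sum_univ_three]
    exact (((hψ.pd 0).pd 0).add ((hψ.pd 1).pd 1)).add ((hψ.pd 2).pd 2)
  have hpd : ∀ i, pd i θ = fun x => pd i φ x + pd i (fun x => φ (S.refl x)) x := fun i =>
    funext fun x => pd_add i (hφ.differentiable x) (hφr.differentiable x)
  have hΔ : ∀ x, ∑ i, pd i (pd i θ) x =
      (∑ i, pd i (pd i φ) x) + ∑ i, pd i (pd i φ) (S.refl x) := by
    intro x
    rw [← S.laplacian_comp_refl hφ, ← Finset.sum_add_distrib]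
    refine Finset.sum_congr rfl fun i _ => ?_
    rw [hpd, pd_add i ((hφ.pd i).differentiable x) ((hφr.pd i).differentiable x)]
  -- `θ` is even, so its normal derivative vanishes on the boundary
  have h0 : ∀ x, S.depth x = 0 → ∑ i, (S.n i : ℂ) * pd i θ x = 0 := by
    intro x hx
    have hxr : S.refl x = x := by simp [refl, hx]
    simp only [hpd, S.pd_comp_refl hφ.differentiable, hxr]
    have hn := S.sum_n_sq
    simp only [Fin.sum_univ_three] at hn ⊢
    linear_combination (-2 * ((S.n 0 : ℂ) * pd 0 φ x + S.n 1 * pd 1 φ x + S.n 2 * pd 2 φ x)) * hn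
  rw [S.integral_evenExt_mul u (hφ.sub (hL hφ)), S.integral_evenExt_mul F hφ, ← hF θ hθ,
    ← neg_eq_iff_eq_neg.2 (S.integral_mul_div hp (fun i => hθ.pd i) h0), neg_add_eq_sub,
    ← integral_sub (integrable_mul_test hθ u) (integrable_mul_test (hL hθ) u)]
  congr 1
  funext x
  rw [hΔ, hθdef]
  ring

/-- Uniqueness for the homogeneous Neumann problem in the weak formulation with smooth test
functions; this amounts to the density of these functions in `H¹`. -/
theorem eq_zero_of_neumann {u : L2 S.dom} {p : Fin 3 → L2 S.dom}
    (hp : ∀ i, HasWeakD S.dom (Pi.single i 1) u (p i))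
    (h : ∀ φ, IsTest Set.univ φ → (∑ i, ∫ x in S.dom, p i x * pd i φ x)
      + ∫ x in S.dom, u x * φ x = 0) : u = 0 := by
  have hz : ∀ φ : E3 → ℂ, ∫ x in S.dom, (0 : L2 S.dom) x * φ x = 0 := fun φ => by
    rw [integral_congr_ae (g := fun _ => 0)]
    · simp
    · filter_upwards [Lp.coeFn_zero ℂ 2 (volume.restrict S.dom)] with x hx
      rw [hx]; simp
  have hu := S.memLp_evenExt u
  have h1 : hu.toLp = 0 := by
    refine eq_zero_of_sub_laplacian fun φ hφ => ?_
    have := S.evenExt_equation (F := 0) hp (fun φ hφ => by rw [h φ hφ, hz φ]) hφ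
    rw [S.integral_evenExt_mul 0 hφ, hz (fun x => φ x + φ (S.refl x))] at this
    rw [← this]
    refine integral_congr_ae ?_
    filter_upwards [hu.coeFn_toLp] with x hx
    rw [hx]
  have h2 : S.evenExt u =ᵐ[volume] 0 :=
    hu.coeFn_toLp.symm.trans (by rw [h1]; exact Lp.coeFn_zero _ _ _)
  rw [Lp.eq_zero_iff_ae_eq_zero]
  filter_upwards [ae_restrict_of_ae h2, ae_restrict_mem S.isOpen_dom.measurableSet] with x hx hm
  rw [← S.evenExt_of_mem (u := u) hm, hx]

/-- Regularity for the homogeneous Neumann problem. -/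
theorem memH_two_of_neumann {u F : L2 S.dom} {p : Fin 3 → L2 S.dom}
    (hp : ∀ i, HasWeakD S.dom (Pi.single i 1) u (p i))
    (hF : ∀ φ, IsTest Set.univ φ → (∑ i, ∫ x in S.dom, p i x * pd i φ x)
      + ∫ x in S.dom, u x * φ x = ∫ x in S.dom, F x * φ x) : MemH S.dom 2 u := by
  have hu := S.memLp_evenExt u
  have hFe := S.memLp_evenExt F
  have H := exists_weak_derivatives (h := hu.toLp) (F := hFe.toLp) fun φ hφ => by
    have e := S.evenExt_equation hp hF hφ
    refine (integral_congr_ae (hu.coeFn_toLp.mono fun x hx => ?_)).trans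
      (e.trans (integral_congr_ae (hFe.coeFn_toLp.mono fun x hx => ?_)))
    · simp only [hx]
    · simp only [hx]
  have hres : ∀ φ, IsTest S.dom φ → ∫ x, hu.toLp _ x * φ x = ∫ x in S.dom, u x * φ x := by
    intro φ hφ
    rw [integral_congr_ae (g := fun x => S.evenExt u x * φ x)
      (hu.coeFn_toLp.mono fun x hx => by simp only [hx]), ← setIntegral_mul_test hφ]
    exact setIntegral_congr_fun S.isOpen_dom.measurableSet fun x hx => by
      simp only [S.evenExt_of_mem hx]
  have hres' : ∀ (v : Lp ℂ 2 (volume : Measure E3)) φ, IsTest S.dom φ →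
      ∫ x in S.dom, ((Lp.memLp v).restrict S.dom).toLp _ x * φ x = ∫ x, v x * φ x := by
    intro v φ hφ
    rw [integral_congr_ae (g := fun x => v x * φ x)
      (((Lp.memLp v).restrict S.dom).coeFn_toLp.mono fun x hx => by simp only [hx]),
      setIntegral_mul_test hφ]
  refine memH_two_of (fun i => ?_) fun i j => ?_
  · obtain ⟨v, hv⟩ := H.1 i
    refine ⟨((Lp.memLp v).restrict S.dom).toLp, hasWeakD_single_iff.2 fun φ hφ => ?_⟩
    rw [hres' v φ hφ, ← hv φ (hφ.mono (Set.subset_univ _)), hres _ (hφ.pd i)]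
  · obtain ⟨v, hv⟩ := H.2 i j
    refine ⟨((Lp.memLp v).restrict S.dom).toLp, fun φ hφ => ?_⟩
    rw [hres' v φ hφ, ← hv φ (hφ.mono (Set.subset_univ _)), hres _ ((hφ.pd j).pd i)]

end Frame

/-! ### Traces -/

/-- A smooth function has weak derivatives given by the classical ones. -/
theorem integral_test_mul_pd {Ω Ω' : Set E3} {w φ : E3 → ℂ} (hw : IsTest Ω' w) (hφ : IsTest Ω φ)
    (i : Fin 3) : ∫ x in Ω, w x * pd i φ x = -∫ x in Ω, pd i w x * φ x := by
  rw [setIntegral_mul_test (hφ.pd i), setIntegral_mul_test hφ]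
  exact integral_mul_pd (fun x _ => (hw.1.of_le (by simp)).contDiffAt) hφ i

namespace Frame

variable (S : Frame)

instance : IsFiniteMeasureOnCompacts (surf S.dom) := by
  constructor
  intro K hK
  rw [← S.measurePreserving_bd.measure_preimage_emb S.measurableEmbedding_bd]
  exact (S.isometry_bd.isClosedEmbedding.isCompact_preimage hK).measure_lt_top

theorem memLp_test_surf {Ω : Set E3} {φ : E3 → ℂ} (hφ : IsTest Ω φ) (p : ℝ≥0∞) :
    MemLp φ p (surf S.dom) :=
  hφ.continuous.memLp_of_hasCompactSupport hφ.2.1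

theorem norm_fderiv_n_sq_le (w : E3 → ℂ) (x : E3) :
    ‖fderiv ℝ w x S.n‖ ^ 2 ≤ ∑ i, ‖pd i w x‖ ^ 2 := by
  have hn : ∑ i, ‖(S.n i : ℂ)‖ ^ 2 = 1 := by
    have := EuclideanSpace.real_norm_sq_eq S.n
    rw [S.norm_n] at this
    simp only [Complex.norm_real, Real.norm_eq_abs, sq_abs]
    rw [← this]; norm_num
  calc ‖fderiv ℝ w x S.n‖ ^ 2 ≤ (∑ i, ‖(S.n i : ℂ)‖ * ‖pd i w x‖) ^ 2 := by
        rw [fderiv_eq_sum_pd]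
        gcongr
        exact (norm_sum_le _ _).trans (Finset.sum_le_sum fun i _ => (norm_mul _ _).le)
    _ ≤ (∑ i, ‖(S.n i : ℂ)‖ ^ 2) * ∑ i, ‖pd i w x‖ ^ 2 := Finset.sum_mul_sq_le_sq_mul_sq _ _ _
    _ = _ := by rw [hn, one_mul]

theorem hasDerivAt_chart (y : E2) (t : ℝ) :
    HasDerivAt (fun t => S.chart (y, t)) (-S.n) t := by
  have h : HasDerivAt (fun t : ℝ => S.c - t) (-1) t := by
    simpa using (hasDerivAt_id t).const_sub S.c
  have := (h.smul_const S.n).const_add (S.L y)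
  simpa [chart] using this

/-- The trace inequality for smooth functions, from the fundamental theorem of calculus along the
normal lines. -/
theorem lintegral_surf_le {w : E3 → ℂ} (hw : IsTest Set.univ w) :
    ∫⁻ x, ‖w x‖ₑ ^ 2 ∂(surf S.dom) ≤
      ∫⁻ x in S.dom, ENNReal.ofReal (‖w x‖ ^ 2 + ∑ i, ‖pd i w x‖ ^ 2) := by
  have hcont : Continuous fun x => ‖w x‖ ^ 2 + ∑ i, ‖pd i w x‖ ^ 2 :=
    (hw.continuous.norm.pow 2).add
      (continuous_finsetSum _ fun i _ => (hw.pd i).continuous.norm.pow 2)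
  have hmeas : Measurable fun p : E2 × ℝ =>
      ENNReal.ofReal (‖w (S.chart p)‖ ^ 2 + ∑ i, ‖pd i w (S.chart p)‖ ^ 2) :=
    ENNReal.measurable_ofReal.comp (hcont.comp S.continuous_chart).measurable
  rw [← S.measurePreserving_bd.lintegral_comp_emb S.measurableEmbedding_bd,
    ← S.measurePreserving_chart_dom.lintegral_comp_emb S.measurableEmbedding_chart,
    lintegral_prod _ hmeas.aemeasurable]
  refine lintegral_mono fun y => ?_
  let γ : ℝ → E3 := fun t => S.chart (y, t)
  have hγ : ContDiff ℝ ∞ γ := by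
    have e : γ = fun t => S.L y + (S.c - t) • S.n := rfl
    rw [e]; fun_prop
  have hγe : Topology.IsClosedEmbedding γ := by
    refine Isometry.isClosedEmbedding (Isometry.of_dist_eq fun s t => ?_)
    change dist (S.L y + (S.c - s) • S.n) (S.L y + (S.c - t) • S.n) = _
    rw [dist_add_left, dist_eq_norm, ← sub_smul, norm_smul, S.norm_n, mul_one, Real.norm_eq_abs,
      sub_sub_sub_cancel_left, ← Real.dist_eq, dist_comm]
  let φ : ℝ → ℝ := fun t => ‖w (γ t)‖ ^ 2
  have hφ : ContDiff ℝ 1 φ := ((hw.1.comp hγ).norm_sq ℝ).of_le (by simp)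
  have hφc : HasCompactSupport φ := by
    have : HasCompactSupport (fun t => w (γ t)) := hw.2.1.comp_isClosedEmbedding hγe
    exact this.comp_left (g := fun z : ℂ => ‖z‖ ^ 2) (by simp)
  have hd : ∀ t, ‖deriv φ t‖ ≤ ‖w (γ t)‖ ^ 2 + ∑ i, ‖pd i w (γ t)‖ ^ 2 := by
    intro t
    have h1 : HasDerivAt (fun t => w (γ t)) (fderiv ℝ w (γ t) (-S.n)) t :=
      (hw.differentiable (γ t)).hasFDerivAt.comp_hasDerivAt t (S.hasDerivAt_chart y t)
    have h2 : HasDerivAt φ _ t := h1.norm_sq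
    rw [h2.deriv, norm_mul, Real.norm_ofNat, map_neg, inner_neg_right, norm_neg]
    have h3 : ‖inner ℝ (w (γ t)) (fderiv ℝ w (γ t) S.n)‖ ≤ ‖w (γ t)‖ * ‖fderiv ℝ w (γ t) S.n‖ :=
      norm_inner_le_norm _ _
    have h4 := S.norm_fderiv_n_sq_le w (γ t)
    nlinarith [sq_nonneg (‖w (γ t)‖ - ‖fderiv ℝ w (γ t) S.n‖)]
  have hint := hφc.integral_Ioi_deriv_eq hφ 0
  have h5 : φ 0 ≤ ∫ t in Set.Ioi (0 : ℝ), ‖deriv φ t‖ := by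
    have := norm_integral_le_integral_norm (μ := volume.restrict (Set.Ioi (0 : ℝ))) (deriv φ)
    rw [hint, norm_neg, Real.norm_of_nonneg (by positivity)] at this
    exact this
  have hdi : Integrable (deriv φ) (volume.restrict (Set.Ioi (0 : ℝ))) :=
    ((hφ.continuous_deriv le_rfl).integrable_of_hasCompactSupport hφc.deriv).restrict
  calc ‖w (S.bd y)‖ₑ ^ 2 = ENNReal.ofReal (φ 0) := by
        simp only [φ, γ, bd]
        rw [ENNReal.ofReal_pow (norm_nonneg _), ofReal_norm]
    _ ≤ ENNReal.ofReal (∫ t in Set.Ioi (0 : ℝ), ‖deriv φ t‖) := ENNReal.ofReal_le_ofReal h5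
    _ = ∫⁻ t in Set.Ioi (0 : ℝ), ENNReal.ofReal ‖deriv φ t‖ :=
        ofReal_integral_eq_lintegral_ofReal hdi.norm (Eventually.of_forall fun _ => norm_nonneg _)
    _ ≤ _ := lintegral_mono fun t => ENNReal.ofReal_le_ofReal (hd t)

/-! ### The space of first order jets -/

/-- Pairs `(u, p)` of an `L²` function and an `L²` vector field, with the Hilbert norm of `H¹`. -/
abbrev Jet : Type := WithLp 2 (L2 S.dom × PiLp 2 (fun _ : Fin 3 => L2 S.dom))

/-- The jet of an element of `H¹`. -/
def jet (u : L2 S.dom) : S.Jet :=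
  WithLp.toLp 2 (u, WithLp.toLp 2 fun i => weakPD S.dom i u)

/-- Pairs consisting of the jet of a smooth compactly supported function on `ℝ³` and its
restriction to the boundary. -/
def smoothPairs : Submodule ℂ (S.Jet × L2Bdry S.dom) where
  carrier := {z | ∃ w, IsTest Set.univ w ∧ z.1.fst =ᵐ[volume.restrict S.dom] w ∧
    (∀ i, z.1.snd i =ᵐ[volume.restrict S.dom] pd i w) ∧ z.2 =ᵐ[surf S.dom] w}
  zero_mem' := by
    refine ⟨fun _ => 0, isTest_univ contDiff_const HasCompactSupport.zero, ?_, fun i => ?_, ?_⟩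
    · exact Lp.coeFn_zero _ _ _
    · have : pd i (fun _ => 0) = 0 := by funext x; simp [pd]
      rw [this]; exact Lp.coeFn_zero _ _ _
    · exact Lp.coeFn_zero _ _ _
  add_mem' := by
    rintro a b ⟨v, hv, h1, h2, h3⟩ ⟨w, hw, k1, k2, k3⟩
    refine ⟨_, hv.add hw, ?_, fun i => ?_, ?_⟩
    · exact (Lp.coeFn_add _ _).trans (h1.add k1)
    · have : pd i (fun x => v x + w x) = fun x => pd i v x + pd i w x := funext fun x =>
        pd_add i (hv.differentiable x) (hw.differentiable x)
      rw [this]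
      exact (Lp.coeFn_add _ _).trans ((h2 i).add (k2 i))
    · exact (Lp.coeFn_add _ _).trans (h3.add k3)
  smul_mem' := by
    rintro c a ⟨v, hv, h1, h2, h3⟩
    refine ⟨_, hv.mul_left (f := fun _ => c) contDiff_const, ?_, fun i => ?_, ?_⟩
    · exact (Lp.coeFn_smul _ _).trans (h1.const_smul c)
    · have : pd i (fun x => c * v x) = fun x => c * pd i v x := funext fun x => by
        rw [pd_mul i (differentiableAt_const _) (hv.differentiable x)]; simp [pd]
      rw [this]
      exact (Lp.coeFn_smul _ _).trans ((h2 i).const_smul c)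
    · exact (Lp.coeFn_smul _ _).trans (h3.const_smul c)

/-- The jet of a smooth function and its boundary values. -/
theorem exists_mem_smoothPairs {w : E3 → ℂ} (hw : IsTest Set.univ w) :
    ∃ z ∈ S.smoothPairs, z.1.fst =ᵐ[volume.restrict S.dom] w ∧
    (∀ i, z.1.snd i =ᵐ[volume.restrict S.dom] pd i w) ∧ z.2 =ᵐ[surf S.dom] w := by
  let z : S.Jet × L2Bdry S.dom := (WithLp.toLp 2 ((memLp_test hw 2 S.dom).toLp,
    WithLp.toLp 2 fun i => (memLp_test (hw.pd i) 2 S.dom).toLp), (S.memLp_test_surf hw 2).toLp)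
  have h1 : z.1.fst =ᵐ[volume.restrict S.dom] w :=
    (memLp_test hw 2 S.dom).coeFn_toLp
  have h2 : ∀ i, z.1.snd i =ᵐ[volume.restrict S.dom] pd i w := fun i =>
    (memLp_test (hw.pd i) 2 S.dom).coeFn_toLp
  have h3 : z.2 =ᵐ[surf S.dom] w := (S.memLp_test_surf hw 2).coeFn_toLp
  exact ⟨z, ⟨w, hw, h1, h2, h3⟩, h1, h2, h3⟩

theorem enorm_sq_eq_lintegral {μ : Measure E3} (u : Lp ℂ 2 μ) :
    ENNReal.ofReal (‖u‖ ^ 2) = ∫⁻ x, ‖u x‖ₑ ^ 2 ∂μ := by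
  rw [ENNReal.ofReal_pow (norm_nonneg _), ofReal_norm, Lp.enorm_def]
  have := eLpNorm_nnreal_pow_eq_lintegral (f := (u : E3 → ℂ)) (μ := μ) (p := 2) two_ne_zero
  simpa using this

/-- The trace inequality in terms of jets. -/
theorem norm_snd_le_of_mem {z : S.Jet × L2Bdry S.dom} (hz : z ∈ S.smoothPairs) :
    ‖z.2‖ ≤ ‖z.1‖ := by
  obtain ⟨w, hw, h1, h2, h3⟩ := hz
  rw [← sq_le_sq₀ (norm_nonneg _) (norm_nonneg _), ← ENNReal.ofReal_le_ofReal_iff (by positivity),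
    enorm_sq_eq_lintegral, WithLp.prod_norm_sq_eq_of_L2, PiLp.norm_sq_eq_of_L2,
    ENNReal.ofReal_add (by positivity) (by positivity),
    ENNReal.ofReal_sum_of_nonneg (fun _ _ => by positivity)]
  simp only [enorm_sq_eq_lintegral]
  have h6 : ∫⁻ x, ‖z.2 x‖ₑ ^ 2 ∂(surf S.dom) = ∫⁻ x, ‖w x‖ₑ ^ 2 ∂(surf S.dom) :=
    lintegral_congr_ae (h3.mono fun x hx => by simp only [hx])
  rw [h6]
  refine (S.lintegral_surf_le hw).trans_eq ?_
  have h5 : ∫⁻ x in S.dom, ‖z.1.fst x‖ₑ ^ 2 = ∫⁻ x in S.dom, ‖w x‖ₑ ^ 2 :=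
    lintegral_congr_ae (h1.mono fun x hx => by simp only [hx])
  have h4 : ∀ i, ∫⁻ x in S.dom, ‖z.1.snd i x‖ₑ ^ 2 = ∫⁻ x in S.dom, ‖pd i w x‖ₑ ^ 2 := fun i =>
    lintegral_congr_ae ((h2 i).mono fun x hx => by simp only [hx])
  have hm : ∀ {φ : E3 → ℂ}, IsTest Set.univ φ → Measurable fun x => ‖φ x‖ₑ ^ 2 := fun hφ =>
    (hφ.continuous.enorm.measurable).pow_const 2
  rw [h5, Finset.sum_congr rfl fun i _ => h4 i, ← lintegral_finsetSum _ fun i _ => hm (hw.pd i),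
    ← lintegral_add_left (hm hw)]
  refine lintegral_congr fun x => ?_
  rw [ENNReal.ofReal_add (by positivity) (by positivity),
    ENNReal.ofReal_sum_of_nonneg (fun _ _ => by positivity)]
  simp only [ENNReal.ofReal_pow (norm_nonneg _), ofReal_norm]

end Frame

/-! ### The trace operator and density of smooth functions -/

namespace Frame

variable (S : Frame)

/-- The graph of the trace operator on jets: the closure of the pairs coming from smooth
functions. -/
def traceGraph : Submodule ℂ (S.Jet × L2Bdry S.dom) := S.smoothPairs.topologicalClosure

theorem norm_snd_le_of_mem_traceGraph {z : S.Jet × L2Bdry S.dom} (hz : z ∈ S.traceGraph) :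
    ‖z.2‖ ≤ ‖z.1‖ := by
  have hc : IsClosed {z : S.Jet × L2Bdry S.dom | ‖z.2‖ ≤ ‖z.1‖} :=
    isClosed_le continuous_snd.norm continuous_fst.norm
  exact closure_minimal (fun z hz => S.norm_snd_le_of_mem hz) hc hz

/-- The closure in `H¹` of the smooth functions. -/
def smoothJets : Submodule ℂ S.Jet :=
  (S.smoothPairs.map (LinearMap.fst ℂ S.Jet (L2Bdry S.dom))).topologicalClosure

/-- The trace inequality turns convergence of jets into convergence of the boundary values. -/
theorem exists_trace {x : S.Jet} (hx : x ∈ S.smoothJets) : ∃ t, (x, t) ∈ S.traceGraph := by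
  obtain ⟨ξ, hξ, hlim⟩ := mem_closure_iff_seq_limit.1 hx
  have h1 : ∀ k, ∃ t, (ξ k, t) ∈ S.smoothPairs := fun k => by
    obtain ⟨z, hz, e⟩ := hξ k
    exact ⟨z.2, by rw [← e]; exact hz⟩
  choose t ht using h1
  have hcau : CauchySeq t := by
    have h2 : CauchySeq ξ := hlim.cauchySeq
    rw [Metric.cauchySeq_iff'] at h2 ⊢
    intro ε hε
    obtain ⟨N, hN⟩ := h2 ε hε
    refine ⟨N, fun k hk => lt_of_le_of_lt ?_ (hN k hk)⟩
    rw [dist_eq_norm, dist_eq_norm]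
    have := S.norm_snd_le_of_mem (S.smoothPairs.sub_mem (ht k) (ht N))
    rw [Prod.mk_sub_mk] at this
    exact this
  obtain ⟨s, hs⟩ := cauchySeq_tendsto_of_complete hcau
  exact ⟨s, mem_closure_of_tendsto (hlim.prodMk_nhds hs) (Eventually.of_forall ht)⟩

theorem trace_unique {x : S.Jet} {s t : L2Bdry S.dom} (hs : (x, s) ∈ S.traceGraph)
    (ht : (x, t) ∈ S.traceGraph) : s = t := by
  have := S.norm_snd_le_of_mem_traceGraph (S.traceGraph.sub_mem hs ht)
  simp only [Prod.mk_sub_mk, sub_self, norm_zero] at this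
  exact sub_eq_zero.1 (norm_le_zero_iff.1 this)

/-- The trace of a jet in the closure of the smooth functions. -/
def traceFun (x : S.smoothJets) : L2Bdry S.dom := (S.exists_trace x.2).choose

theorem traceFun_mem (x : S.smoothJets) : ((x : S.Jet), S.traceFun x) ∈ S.traceGraph :=
  (S.exists_trace x.2).choose_spec

theorem traceFun_add (x y : S.smoothJets) :
    S.traceFun (x + y) = S.traceFun x + S.traceFun y := by
  have h := S.traceGraph.add_mem (S.traceFun_mem x) (S.traceFun_mem y)
  rw [Prod.mk_add_mk] at h
  exact S.trace_unique (S.traceFun_mem (x + y)) h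

theorem traceFun_smul (c : ℂ) (x : S.smoothJets) : S.traceFun (c • x) = c • S.traceFun x := by
  have h := S.traceGraph.smul_mem c (S.traceFun_mem x)
  rw [Prod.smul_mk] at h
  exact S.trace_unique (S.traceFun_mem (c • x)) h

theorem norm_traceFun_le (x : S.smoothJets) : ‖S.traceFun x‖ ≤ 1 * ‖x‖ := by
  have h := S.norm_snd_le_of_mem_traceGraph (S.traceFun_mem x)
  rw [one_mul, Submodule.coe_norm]
  exact h

/-- The trace operator on the closure of the smooth functions. -/
def trace : S.smoothJets →L[ℂ] L2Bdry S.dom :=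
  LinearMap.mkContinuous ⟨⟨S.traceFun, S.traceFun_add⟩, S.traceFun_smul⟩ 1 S.norm_traceFun_le

theorem trace_mem (x : S.smoothJets) : ((x : S.Jet), S.trace x) ∈ S.traceGraph :=
  S.traceFun_mem x

theorem tendsto_toLp_iff {μ : Measure E3} {w : ℕ → E3 → ℂ} {v : ℕ → Lp ℂ 2 μ} {u : Lp ℂ 2 μ}
    (h : ∀ k, v k =ᵐ[μ] w k) :
    Tendsto v atTop (𝓝 u) ↔ Tendsto (fun k => eLpNorm (fun x => w k x - u x) 2 μ) atTop (𝓝 0) := by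
  rw [Lp.tendsto_Lp_iff_tendsto_eLpNorm']
  refine tendsto_congr fun k => eLpNorm_congr_ae ?_
  filter_upwards [h k] with x hx
  rw [Pi.sub_apply, hx]

theorem tendsto_jet_iff {ξ : ℕ → S.Jet} {x : S.Jet} : Tendsto ξ atTop (𝓝 x) ↔
    Tendsto (fun k => (ξ k).fst) atTop (𝓝 x.fst) ∧
      ∀ i, Tendsto (fun k => (ξ k).snd i) atTop (𝓝 (x.snd i)) := by
  constructor
  · intro h
    have h1 : Tendsto (fun k => (ξ k).ofLp) atTop (𝓝 x.ofLp) :=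
      ((WithLp.prod_continuous_ofLp 2 _ _).tendsto x).comp h
    refine ⟨(continuous_fst.tendsto _).comp h1, fun i => ?_⟩
    have h2 : Tendsto (fun k => (ξ k).snd) atTop (𝓝 x.snd) := (continuous_snd.tendsto _).comp h1
    have h3 : Tendsto (fun k => (ξ k).snd.ofLp) atTop (𝓝 x.snd.ofLp) :=
      ((PiLp.continuous_ofLp 2 _).tendsto x.snd).comp h2
    exact (tendsto_pi_nhds.1 h3) i
  · rintro ⟨h1, h2⟩
    have h3 : Tendsto (fun k => (ξ k).snd.ofLp) atTop (𝓝 x.snd.ofLp) := tendsto_pi_nhds.2 h2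
    have h4 : Tendsto (fun k => (ξ k).snd) atTop (𝓝 x.snd) :=
      ((PiLp.continuous_toLp 2 _).tendsto x.snd.ofLp).comp h3
    exact ((WithLp.prod_continuous_toLp 2 _ _).tendsto x.ofLp).comp (h1.prodMk_nhds h4)

/-- The trace relation is the closure of the graph of restriction to the boundary. -/
theorem isTrace_iff {u : L2 S.dom} {t : L2Bdry S.dom} :
    IsTrace S.dom u t ↔ (S.jet u, t) ∈ S.traceGraph := by
  constructor
  · rintro ⟨w, hw, h1, h2, h3⟩
    choose z hz k1 k2 k3 using fun k => S.exists_mem_smoothPairs (hw k)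
    have l1 : Tendsto (fun k => (z k).1) atTop (𝓝 (S.jet u)) :=
      S.tendsto_jet_iff.2 ⟨(tendsto_toLp_iff k1).2 h1,
        fun i => (tendsto_toLp_iff fun k => k2 k i).2 (h2 i)⟩
    have l2 : Tendsto (fun k => (z k).2) atTop (𝓝 t) := (tendsto_toLp_iff k3).2 h3
    exact mem_closure_of_tendsto (l1.prodMk_nhds l2) (Eventually.of_forall hz)
  · intro h
    obtain ⟨z, hz, hlim⟩ := mem_closure_iff_seq_limit.1 h
    choose w hw k1 k2 k3 using hz
    have l1 := S.tendsto_jet_iff.1 ((continuous_fst.tendsto _).comp hlim)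
    have l2 := (continuous_snd.tendsto _).comp hlim
    exact ⟨w, hw, (tendsto_toLp_iff k1).1 l1.1,
      fun i => (tendsto_toLp_iff fun k => k2 k i).1 (l1.2 i), (tendsto_toLp_iff k3).1 l2⟩

theorem inner_eq_integral {μ : Measure E3} (u v : Lp ℂ 2 μ) :
    inner ℂ u v = ∫ x, starRingEnd ℂ (u x) * v x ∂μ := by
  rw [L2.inner_def]
  exact integral_congr_ae (Eventually.of_forall fun x => by
    simp only [RCLike.inner_apply]; exact mul_comm _ _)

theorem inner_jet (x y : S.Jet) : inner ℂ x y =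
    (∑ i, ∫ a in S.dom, starRingEnd ℂ (x.snd i a) * y.snd i a)
      + ∫ a in S.dom, starRingEnd ℂ (x.fst a) * y.fst a := by
  rw [WithLp.prod_inner_apply, PiLp.inner_apply, add_comm]
  simp only [inner_eq_integral]
  rfl

theorem continuous_integral_mul {φ : E3 → ℂ} (hφ : IsTest S.dom φ) :
    Continuous fun u : L2 S.dom => ∫ x in S.dom, u x * φ x := by
  have hc := memLp_test hφ.conj 2 S.dom
  have e : (fun u : L2 S.dom => ∫ x in S.dom, u x * φ x) = fun u => inner ℂ hc.toLp u := by
    funext u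
    rw [inner_eq_integral]
    refine integral_congr_ae ?_
    filter_upwards [hc.coeFn_toLp] with x hx
    rw [hx, Complex.conj_conj, mul_comm]
  rw [e]
  fun_prop

theorem continuous_fst_jet : Continuous fun x : S.Jet => x.fst :=
  continuous_fst.comp (WithLp.prod_continuous_ofLp 2 _ _)

theorem continuous_snd_jet (i : Fin 3) : Continuous fun x : S.Jet => x.snd i :=
  (continuous_apply i).comp ((PiLp.continuous_ofLp 2 _).comp
    (continuous_snd.comp (WithLp.prod_continuous_ofLp 2 _ _)))

/-- The components of a jet in the closure of the smooth functions are weak derivatives. -/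
theorem hasWeakD_of_mem_smoothJets {x : S.Jet} (hx : x ∈ S.smoothJets) (i : Fin 3) :
    HasWeakD S.dom (Pi.single i 1) x.fst (x.snd i) := by
  rw [hasWeakD_single_iff]
  intro φ hφ
  have hc : IsClosed {x : S.Jet | ∫ a in S.dom, x.fst a * pd i φ a =
      -∫ a in S.dom, x.snd i a * φ a} :=
    isClosed_eq ((S.continuous_integral_mul (hφ.pd i)).comp S.continuous_fst_jet)
      ((S.continuous_integral_mul hφ).comp (S.continuous_snd_jet i)).neg
  refine closure_minimal (fun x hx => ?_) hc hx
  obtain ⟨z, ⟨w, hw, h1, h2, -⟩, rfl⟩ := hx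
  have e1 : ∫ a in S.dom, z.1.fst a * pd i φ a = ∫ a in S.dom, w a * pd i φ a :=
    integral_congr_ae (h1.mono fun a ha => by simp only [ha])
  have e2 : ∫ a in S.dom, z.1.snd i a * φ a = ∫ a in S.dom, pd i w a * φ a :=
    integral_congr_ae ((h2 i).mono fun a ha => by simp only [ha])
  change ∫ a in S.dom, z.1.fst a * pd i φ a = -∫ a in S.dom, z.1.snd i a * φ a
  rw [e1, e2]
  exact integral_test_mul_pd hw hφ i

/-- A jet whose second component is the weak gradient of the first is the jet of the latter. -/
theorem jet_eq {x : S.Jet} (hx : ∀ i, HasWeakD S.dom (Pi.single i 1) x.fst (x.snd i)) :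
    S.jet x.fst = x := by
  have h : ∀ i, weakPD S.dom i x.fst = x.snd i := fun i => weakPD_eq S.isOpen_dom (hx i)
  unfold jet
  simp only [h]
  rfl

/-- Restrictions of smooth functions are dense in `H¹`. -/
theorem mem_smoothJets {x : S.Jet} (hx : ∀ i, HasWeakD S.dom (Pi.single i 1) x.fst (x.snd i)) :
    x ∈ S.smoothJets := by
  have : CompleteSpace S.smoothJets :=
    (Submodule.isClosed_topologicalClosure _).completeSpace_coe
  -- The component `z` orthogonal to the smooth jets solves the homogeneous Neumann problem.
  obtain ⟨y, hy, z, hz, rfl⟩ := S.smoothJets.exists_add_mem_mem_orthogonal x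
  have hyw := S.hasWeakD_of_mem_smoothJets hy
  have hzw : ∀ i, HasWeakD S.dom (Pi.single i 1) z.fst (z.snd i) := fun i => by
    have := (hx i).sub (hyw i)
    have e1 : (y + z).fst - y.fst = z.fst := add_sub_cancel_left y.fst z.fst
    have e2 : (y + z).snd i - y.snd i = z.snd i := add_sub_cancel_left (y.snd i) (z.snd i)
    rwa [e1, e2] at this
  have hz0 : z.fst = 0 := by
    refine S.eq_zero_of_neumann hzw fun φ hφ => ?_
    obtain ⟨w, hw, h1, h2, -⟩ := S.exists_mem_smoothPairs hφ.conj
    have hwm : w.1 ∈ S.smoothJets := subset_closure ⟨w, hw, rfl⟩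
    have h0 := (Submodule.mem_orthogonal _ _).1 hz w.1 hwm
    rw [S.inner_jet] at h0
    rw [← h0]
    congr 1
    · refine Finset.sum_congr rfl fun i _ => integral_congr_ae ?_
      filter_upwards [h2 i] with a ha
      rw [ha, pd_conj hφ.differentiable, Complex.conj_conj, mul_comm]
    · refine integral_congr_ae ?_
      filter_upwards [h1] with a ha
      rw [ha, Complex.conj_conj, mul_comm]
  have hz1 : ∀ i, z.snd i = 0 := fun i => by
    have h := hzw i
    rw [hz0] at h
    refine h.unique S.isOpen_dom ?_
    simpa using h.smul 0
  have hzz : z = 0 := by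
    have h3 : z = WithLp.toLp 2 (z.fst, WithLp.toLp 2 fun i => z.snd i) := rfl
    rw [h3, hz0]
    simp only [hz1]
    rfl
  rw [hzz, add_zero]; exact hy

theorem jet_mem {u : L2 S.dom} (hu : MemH S.dom 1 u) : S.jet u ∈ S.smoothJets :=
  S.mem_smoothJets fun i => hu.hasWeakD_weakPD i

/-! ### Existence and uniqueness of the weak solution -/

/-- The weak formulation in terms of jets and the trace operator. -/
theorem isWeakSolution_iff {f : L2 S.dom} {g : L2Bdry S.dom} {ψ : L2 S.dom} :
    IsWeakSolution S.dom f g ψ ↔ MemH S.dom 1 ψ ∧ ∀ x : S.smoothJets,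
      inner ℂ (S.jet ψ) (x : S.Jet) = inner ℂ f (x : S.Jet).fst + inner ℂ g (S.trace x) := by
  unfold IsWeakSolution
  refine and_congr_right fun _ => ⟨fun h x => ?_, fun h φ hφ => ?_⟩
  · have hw := S.hasWeakD_of_mem_smoothJets x.2
    have hj := S.jet_eq hw
    obtain ⟨t, ht, e⟩ := h (x : S.Jet).fst (memH_one_iff.2 fun i => ⟨_, hw i⟩)
    have ht' : t = S.trace x :=
      S.trace_unique (S.isTrace_iff.1 ht) (by rw [hj]; exact S.trace_mem x)
    have hp : ∀ i, weakPD S.dom i (x : S.Jet).fst = (x : S.Jet).snd i := fun i =>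
      weakPD_eq S.isOpen_dom (hw i)
    simp only [hp] at e
    rw [S.inner_jet, inner_eq_integral, inner_eq_integral, ← ht']
    exact e
  · refine ⟨S.trace ⟨_, S.jet_mem hφ⟩, S.isTrace_iff.2 (S.trace_mem ⟨_, S.jet_mem hφ⟩), ?_⟩
    have := h ⟨_, S.jet_mem hφ⟩
    rw [S.inner_jet, inner_eq_integral, inner_eq_integral] at this
    exact this

/-- Existence by the Riesz representation theorem. Uniqueness follows by testing the difference of
two solutions against itself. -/
theorem existsUnique_weakSolution (f : L2 S.dom) (g : L2Bdry S.dom) :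
    ∃! ψ, IsWeakSolution S.dom f g ψ := by
  have : CompleteSpace S.smoothJets :=
    (Submodule.isClosed_topologicalClosure _).completeSpace_coe
  let ℓ : S.smoothJets →L[ℂ] ℂ := (innerSL ℂ f).comp
    ((WithLp.fstL 2 ℂ _ _).comp S.smoothJets.subtypeL) + (innerSL ℂ g).comp S.trace
  let ψ : S.smoothJets := (InnerProductSpace.toDual ℂ S.smoothJets).symm ℓ
  have hψ : ∀ x : S.smoothJets, inner ℂ (ψ : S.Jet) (x : S.Jet)
      = inner ℂ f (x : S.Jet).fst + inner ℂ g (S.trace x) := fun x => by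
    have h := InnerProductSpace.toDual_symm_apply (𝕜 := ℂ) (x := x) (y := ℓ)
    rw [← Submodule.coe_inner, h]
    rfl
  have hw := S.hasWeakD_of_mem_smoothJets ψ.2
  refine ⟨(ψ : S.Jet).fst, S.isWeakSolution_iff.2 ⟨memH_one_iff.2 fun i => ⟨_, hw i⟩, ?_⟩, ?_⟩
  · rw [S.jet_eq hw]; exact hψ
  · intro u hu
    obtain ⟨hu1, hu2⟩ := S.isWeakSolution_iff.1 hu
    have hd : S.jet u - ψ ∈ S.smoothJets := S.smoothJets.sub_mem (S.jet_mem hu1) ψ.2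
    have h0 : inner ℂ (S.jet u - (ψ : S.Jet)) (S.jet u - (ψ : S.Jet)) = 0 := by
      have h1 := hu2 ⟨_, hd⟩
      have h2 := hψ ⟨_, hd⟩
      rw [inner_sub_left, sub_eq_zero]
      exact h1.trans h2.symm
    have h3 := sub_eq_zero.1 (inner_self_eq_zero.1 h0)
    exact congrArg WithLp.fst h3

/-- The weak formulation with smooth test functions, without complex conjugates. -/
theorem weakSolution_test {f : L2 S.dom} {g : L2Bdry S.dom} {ψ : L2 S.dom}
    (h : IsWeakSolution S.dom f g ψ) {φ : E3 → ℂ} (hφ : IsTest Set.univ φ) :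
    (∑ i, ∫ x in S.dom, weakPD S.dom i ψ x * pd i φ x) + ∫ x in S.dom, ψ x * φ x
      = (∫ x in S.dom, f x * φ x) + ∫ x, g x * φ x ∂(surf S.dom) := by
  obtain ⟨z, hz, h1, h2, h3⟩ := S.exists_mem_smoothPairs hφ.conj
  have hzm : z.1 ∈ S.smoothJets := subset_closure ⟨z, hz, rfl⟩
  have ht : S.trace ⟨_, hzm⟩ = z.2 := by
    have hz' : z ∈ S.traceGraph := subset_closure hz
    exact S.trace_unique (S.trace_mem ⟨_, hzm⟩) hz'
  have h4 := (S.isWeakSolution_iff.1 h).2 ⟨_, hzm⟩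
  rw [ht, S.inner_jet, inner_eq_integral, inner_eq_integral] at h4
  have h5 := congrArg (starRingEnd ℂ) h4
  simp only [map_add, map_sum, ← integral_conj, map_mul, Complex.conj_conj] at h5
  convert h5 using 2
  · refine Finset.sum_congr rfl fun i _ => integral_congr_ae ?_
    filter_upwards [h2 i] with a ha
    rw [ha, pd_conj hφ.differentiable, Complex.conj_conj]; rfl
  · refine integral_congr_ae ?_
    filter_upwards [h1] with a ha
    rw [ha, Complex.conj_conj]; rfl
  · refine integral_congr_ae ?_
    filter_upwards [h1] with a ha
    rw [ha, Complex.conj_conj]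
  · refine integral_congr_ae ?_
    filter_upwards [h3] with a ha
    rw [ha, Complex.conj_conj]

end Frame

/-! ### Homogeneous kernels on the half-space -/

namespace Frame

variable (S : Frame)

/-- The kernel `t⁻ᵐ B(t, z / t)` with `t = -⟪n, z⟫`, used at `z = x - y` with `x` in the half-space
and `y` on its boundary; `t` is then the depth of `x`. -/
def homKer (m : ℕ) (B : ℝ × E3 → ℂ) (z : E3) : ℂ :=
  (((-inner ℝ S.n z : ℝ) : ℂ) ^ m)⁻¹ * B (-inner ℝ S.n z, (-inner ℝ S.n z)⁻¹ • z)

/-- The profile of the derivative in direction `v` of the kernel with profile `B` and order `m`. The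
first term comes from the factor `t⁻ᵐ`, the second one from the arguments of `B`, whose derivatives
are `-⟪n, v⟫` and `t⁻¹ (v + ⟪n, v⟫ z / t)`. -/
def dProf (m : ℕ) (v : E3) (B : ℝ × E3 → ℂ) (p : ℝ × E3) : ℂ :=
  (m * inner ℝ S.n v : ℝ) * B p
    + fderiv ℝ B p (-inner ℝ S.n v * p.1, v + (inner ℝ S.n v : ℝ) • p.2)

theorem contDiff_dProf (m : ℕ) (v : E3) {B : ℝ × E3 → ℂ} (hB : ContDiff ℝ ∞ B) :
    ContDiff ℝ ∞ (S.dProf m v B) := by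
  have h : ContDiff ℝ ∞ (fderiv ℝ B) := hB.fderiv_right (m := ∞) (by simp)
  refine (contDiff_const.mul hB).add (h.clm_apply ?_)
  fun_prop

theorem hasCompactSupport_dProf (m : ℕ) (v : E3) {B : ℝ × E3 → ℂ} (hc : HasCompactSupport B) :
    HasCompactSupport (S.dProf m v B) := by
  refine HasCompactSupport.add hc.mul_left ?_
  refine (hc.fderiv ℝ).mono fun p hp => ?_
  intro h
  apply hp
  simp only
  rw [h]; rfl

/-- Differentiation raises the order of the kernel by one and replaces the profile by `dProf`. -/
theorem contDiffAt_homKer_and_fderiv (m : ℕ) {B : ℝ × E3 → ℂ} (hB : ContDiff ℝ ∞ B) {z : E3}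
    (hz : inner ℝ S.n z < 0) (v : E3) :
    ContDiffAt ℝ 1 (S.homKer m B) z ∧
      fderiv ℝ (S.homKer m B) z v = S.homKer (m + 1) (S.dProf m v B) z := by
  set t : ℝ := -inner ℝ S.n z with ht
  have ht0 : t ≠ 0 := by rw [ht]; linarith
  have htc : (t : ℂ) ≠ 0 := by exact_mod_cast ht0
  let T : E3 → ℝ := fun z => -inner ℝ S.n z
  have hT : ContDiff ℝ ∞ T := (contDiff_const.inner ℝ contDiff_id).neg
  have hTd : HasFDerivAt T (-(innerSL ℝ S.n)) z := (innerSL ℝ S.n).hasFDerivAt.neg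
  have h1 : HasFDerivAt (fun z => (T z)⁻¹) (-(t ^ 2)⁻¹ • -(innerSL ℝ S.n)) z :=
    (hasDerivAt_inv ht0).comp_hasFDerivAt z hTd
  have h2 := h1.smul (hasFDerivAt_id z)
  have h3 := hTd.prodMk h2
  have h4 := (hB.differentiable (by simp) (T z, (T z)⁻¹ • z)).hasFDerivAt.comp z h3
  have h5 : HasFDerivAt (fun z => ((T z : ℝ) : ℂ)) (Complex.ofRealCLM.comp (-(innerSL ℝ S.n))) z :=
    Complex.ofRealCLM.hasFDerivAt.comp z hTd
  have h6 : HasDerivAt (fun s : ℂ => (s ^ m)⁻¹) (-(m * (t : ℂ) ^ (m - 1)) / ((t : ℂ) ^ m) ^ 2)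
      (T z : ℂ) := (hasDerivAt_pow m (t : ℂ)).fun_inv (pow_ne_zero _ htc)
  have h7 := (h6.hasFDerivAt.restrictScalars ℝ).comp z h5
  have h8 := h7.mul h4
  have hh : HasFDerivAt (S.homKer m B) _ z := h8
  constructor
  · have hTc : ContDiffAt ℝ 1 T z := (hT.of_le (by simp)).contDiffAt
    have c1 : ContDiffAt ℝ 1 (fun z => ((T z : ℝ) : ℂ)) z :=
      Complex.ofRealCLM.contDiff.contDiffAt.comp z hTc
    have c2 : ContDiffAt ℝ 1 (fun z => B (T z, (T z)⁻¹ • z)) z :=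
      (hB.of_le (by simp)).contDiffAt.comp z (hTc.prodMk ((hTc.inv ht0).smul contDiffAt_id))
    exact ((c1.pow m).inv (pow_ne_zero _ htc)).mul c2
  · rw [hh.fderiv, homKer, ← ht, dProf]
    have e : ((-inner ℝ S.n v : ℝ), t⁻¹ • v + (-(t ^ 2)⁻¹ * -inner ℝ S.n v) • z) =
        t⁻¹ • ((-inner ℝ S.n v : ℝ) * t, v + (inner ℝ S.n v : ℝ) • (t⁻¹ • z)) := by
      ext1
      · simp; field_simp
      · simp only [Prod.smul_mk, smul_add, smul_smul]
        congr 2; field_simp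
    have hTz : T z = t := rfl
    simp only [add_apply, smul_apply, ContinuousLinearMap.comp_apply,
      ContinuousLinearMap.prod_apply, neg_apply, innerSL_apply_apply, smul_eq_mul, hTz,
      ContinuousLinearMap.smulRight_apply, ContinuousLinearMap.id_apply,
      ContinuousLinearMap.coe_restrictScalars', ContinuousLinearMap.toSpanSingleton_apply, id,
      Complex.ofRealCLM_apply, e, map_smul, Function.comp_apply]
    rcases m with _ | m
    · simp
    · simp only [Complex.real_smul]
      push_cast
      simp only [Pi.smul_apply', id, hTz]
      field_simp
      ring

theorem measurable_homKer (m : ℕ) {B : ℝ × E3 → ℂ} (hB : Continuous B) :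
    Measurable (S.homKer m B) := by
  have h1 : Measurable fun z : E3 => -inner ℝ S.n z := by fun_prop
  have h2 : Measurable fun z : E3 => (-inner ℝ S.n z)⁻¹ • z := h1.inv.smul measurable_id
  exact ((Complex.measurable_ofReal.comp h1).pow_const m).inv.mul
    (hB.measurable.comp (h1.prodMk h2))

/-- Bounds for the size and the support of a profile. -/
theorem exists_prof_bound {B : ℝ × E3 → ℂ} (hB : Continuous B) (hc : HasCompactSupport B) :
    ∃ R C : ℝ, 0 < R ∧ 0 ≤ C ∧ (∀ p, ‖B p‖ ≤ C) ∧ ∀ p, B p ≠ 0 → |p.1| ≤ R ∧ ‖p.2‖ ≤ R := by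
  obtain ⟨C, hC⟩ := hc.exists_bound_of_continuous hB
  obtain ⟨R, hR0, hR⟩ := hc.isBounded.exists_pos_norm_le
  refine ⟨R, C, hR0, (norm_nonneg _).trans (hC 0), hC, fun p hp => ?_⟩
  have := hR p (subset_tsupport _ hp)
  exact ⟨(norm_fst_le p).trans this, (norm_snd_le p).trans this⟩

theorem inner_sub_bd (x : E3) (y : E2) : -inner ℝ S.n (x - S.bd y) = S.depth x := by
  have := S.depth_bd y
  simp only [depth, inner_sub_right] at this ⊢
  linarith

/-- The potential with kernel `homKer m B` and density `g` on the boundary. -/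
def pot (m : ℕ) (B : ℝ × E3 → ℂ) (g : E2 → ℂ) (x : E3) : ℂ :=
  ∫ y, S.homKer m B (x - S.bd y) * g y

theorem measurable_pot_integrand (m : ℕ) {B : ℝ × E3 → ℂ} (hB : Continuous B) {g : E2 → ℂ}
    (hg : Measurable g) : Measurable fun p : E3 × E2 => S.homKer m B (p.1 - S.bd p.2) * g p.2 :=
  ((S.measurable_homKer m hB).comp (measurable_fst.sub
    (S.continuous_bd.measurable.comp measurable_snd))).mul (hg.comp measurable_snd)

theorem stronglyMeasurable_pot (m : ℕ) {B : ℝ × E3 → ℂ} (hB : Continuous B) {g : E2 → ℂ}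
    (hg : Measurable g) : StronglyMeasurable (S.pot m B g) :=
  (S.measurable_pot_integrand m hB hg).stronglyMeasurable.integral_prod_right'

/-- Absolute integrability for the exchange of integrals: on the support of `φ` the depth is bounded
below, and the kernel restricts `y` to a bounded set. -/
theorem integrable_pot_mul {m : ℕ} {B : ℝ × E3 → ℂ} (hB : Continuous B) (hc : HasCompactSupport B)
    {g : E2 → ℂ} (hgm : Measurable g) (hg : LocallyIntegrable g) {φ : E3 → ℂ}
    (hφ : IsTest S.dom φ) :
    Integrable (fun p : E3 × E2 => S.homKer m B (p.1 - S.bd p.2) * g p.2 * φ p.1)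
      ((volume.restrict S.dom).prod volume) := by
  obtain ⟨R, C, hR, hC0, hC, hsupp⟩ := exists_prof_bound hB hc
  obtain ⟨A, hA⟩ := hφ.2.1.exists_bound_of_continuous hφ.continuous
  have hA0 : 0 ≤ A := (norm_nonneg _).trans (hA 0)
  obtain ⟨δ, hδ, hdepth⟩ : ∃ δ > 0, ∀ x ∈ tsupport φ, δ ≤ S.depth x :=
    hφ.2.1.isCompact.exists_forall_le' S.continuous_depth.continuousOn
      (fun x hx => S.mem_dom.1 (hφ.2.2 hx))
  obtain ⟨ρ, hρ⟩ := hφ.2.1.isCompact.isBounded.exists_norm_le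
  let K : Set E2 := S.bd ⁻¹' Metric.closedBall 0 (ρ + R * R)
  have hK : IsCompact K :=
    S.isometry_bd.isClosedEmbedding.isCompact_preimage (isCompact_closedBall _ _)
  have hKi : Integrable (K.indicator fun y => ‖g y‖) :=
    (integrable_indicator_iff hK.measurableSet).2 (hg.integrableOn_isCompact hK).norm
  have hTi : Integrable ((tsupport φ).indicator fun _ : E3 => (δ ^ m)⁻¹ * C * A)
      (volume.restrict S.dom) := by
    refine Integrable.restrict ?_
    exact (integrable_indicator_iff (isClosed_tsupport φ).measurableSet).2
      (integrableOn_const hφ.2.1.measure_lt_top.ne)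
  refine (hTi.mul_prod hKi).mono' ?_ (Eventually.of_forall fun p => ?_)
  · exact ((S.measurable_pot_integrand m hB hgm).mul
      (hφ.continuous.measurable.comp measurable_fst)).aestronglyMeasurable
  · by_cases hx : p.1 ∈ tsupport φ
    swap
    · rw [image_eq_zero_of_notMem_tsupport hx, mul_zero, norm_zero,
        Set.indicator_of_notMem hx, zero_mul]
    have hd := hdepth _ hx
    by_cases h0 : B (S.depth p.1, (S.depth p.1)⁻¹ • (p.1 - S.bd p.2)) = 0
    · rw [homKer, S.inner_sub_bd, h0, mul_zero, zero_mul, zero_mul, norm_zero]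
      exact mul_nonneg (Set.indicator_nonneg (fun _ _ => by positivity) _)
        (Set.indicator_nonneg (fun _ _ => norm_nonneg _) _)
    have hd0 : 0 < S.depth p.1 := hδ.trans_le hd
    obtain ⟨h1, h2⟩ := hsupp _ h0
    simp only at h1 h2
    rw [abs_of_pos hd0] at h1
    rw [norm_smul, norm_inv, Real.norm_of_nonneg hd0.le, inv_mul_le_iff₀ hd0] at h2
    have hy : p.2 ∈ K := by
      simp only [K, Set.mem_preimage, mem_closedBall_zero_iff]
      have e : S.bd p.2 = p.1 - (p.1 - S.bd p.2) := by abel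
      rw [e]
      refine (norm_sub_le _ _).trans (add_le_add (hρ _ hx) (h2.trans ?_))
      gcongr
    rw [Set.indicator_of_mem hx, Set.indicator_of_mem hy, norm_mul, norm_mul, homKer,
      S.inner_sub_bd, norm_mul, norm_inv, norm_pow, Complex.norm_real,
      Real.norm_of_nonneg hd0.le]
    calc (S.depth p.1 ^ m)⁻¹ * ‖B (S.depth p.1, (S.depth p.1)⁻¹ • (p.1 - S.bd p.2))‖ * ‖g p.2‖ *
          ‖φ p.1‖ ≤ (δ ^ m)⁻¹ * C * ‖g p.2‖ * A := by
          gcongr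
          · exact hC _
          · exact hA _
      _ = _ := by ring

/-- The derivative of a potential is the potential with the differentiated kernel. -/
theorem integral_pot_mul_pd {m : ℕ} {B : ℝ × E3 → ℂ} (hB : ContDiff ℝ ∞ B)
    (hc : HasCompactSupport B) {g : E2 → ℂ} (hgm : Measurable g) (hg : LocallyIntegrable g)
    {φ : E3 → ℂ} (hφ : IsTest S.dom φ) (i : Fin 3) :
    ∫ x in S.dom, S.pot m B g x * pd i φ x =
      -∫ x in S.dom, S.pot (m + 1) (S.dProf m (EuclideanSpace.single i 1) B) g x * φ x := by
  have hswap : ∀ {m : ℕ} {B : ℝ × E3 → ℂ} (hB : Continuous B) (hc : HasCompactSupport B)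
      {φ : E3 → ℂ} (hφ : IsTest S.dom φ), ∫ x in S.dom, S.pot m B g x * φ x =
        ∫ y, g y * ∫ x, S.homKer m B (x - S.bd y) * φ x := by
    intro m B hB hc φ hφ
    have h := integral_integral_swap
      (f := fun x y => S.homKer m B (x - S.bd y) * g y * φ x)
      (S.integrable_pot_mul (m := m) hB hc hgm hg hφ)
    simp only [pot, ← integral_mul_const]
    rw [h]
    congr 1
    funext y
    rw [← setIntegral_mul_test hφ, ← integral_const_mul]
    congr 1
    funext x
    ring
  rw [hswap hB.continuous hc (hφ.pd i), hswap (S.contDiff_dProf m _ hB).continuous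
    (S.hasCompactSupport_dProf m _ hc) hφ, ← integral_neg]
  congr 1
  funext y
  rw [← mul_neg]
  congr 1
  have hlt : ∀ x ∈ tsupport φ, inner ℝ S.n (x - S.bd y) < 0 := fun x hx => by
    have := S.mem_dom.1 (hφ.2.2 hx)
    rw [← S.inner_sub_bd x y] at this
    linarith
  rw [integral_mul_pd (fun x hx => ?_) hφ i]
  · congr 1
    refine integral_congr_ae (Eventually.of_forall fun x => ?_)
    by_cases hx : x ∈ tsupport φ
    · simp only [pd]
      rw [fderiv_comp_sub, (S.contDiffAt_homKer_and_fderiv m hB (hlt x hx) _).2]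
    · simp only [image_eq_zero_of_notMem_tsupport hx, mul_zero]
  · have := (S.contDiffAt_homKer_and_fderiv m hB (hlt x hx) 0).1
    exact this.comp x (contDiff_id.sub contDiff_const).contDiffAt

end Frame

/-! ### Square integrability of the potentials -/

theorem memLp_two_of_lintegral {α : Type*} [MeasurableSpace α] {μ : Measure α} {F : α → ℂ}
    (hF : AEStronglyMeasurable F μ) (h : ∫⁻ x, ‖F x‖ₑ ^ 2 ∂μ < ⊤) : MemLp F 2 μ := by
  refine ⟨hF, ?_⟩
  have := eLpNorm_nnreal_pow_eq_lintegral (f := F) (μ := μ) (p := 2) two_ne_zero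
  norm_num at this
  rw [← this] at h
  by_contra hc
  rw [not_lt_top_iff] at hc
  rw [hc] at h
  simp at h

theorem lintegral_enorm_sq_lt_top {α : Type*} [MeasurableSpace α] {μ : Measure α} {F : α → ℂ}
    (hF : MemLp F 2 μ) : ∫⁻ x, ‖F x‖ₑ ^ 2 ∂μ < ⊤ := by
  have := eLpNorm_nnreal_pow_eq_lintegral (f := F) (μ := μ) (p := 2) two_ne_zero
  norm_num at this
  rw [← this]
  exact ENNReal.pow_lt_top hF.2

/-- The Cauchy–Schwarz inequality against the constant function one. -/
theorem sq_lintegral_le {α : Type*} [MeasurableSpace α] (μ : Measure α) {f : α → ℝ≥0∞}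
    (hf : AEMeasurable f μ) : (∫⁻ x, f x ∂μ) ^ 2 ≤ μ Set.univ * ∫⁻ x, f x ^ 2 ∂μ := by
  have h := ENNReal.lintegral_mul_le_Lp_mul_Lq μ Real.HolderConjugate.two_two
    (aemeasurable_const (b := (1 : ℝ≥0∞))) hf
  simp only [Pi.mul_apply, one_mul, ENNReal.one_rpow, lintegral_const] at h
  calc (∫⁻ x, f x ∂μ) ^ 2
      ≤ (μ Set.univ ^ (1 / 2 : ℝ) * (∫⁻ x, f x ^ (2 : ℝ) ∂μ) ^ (1 / 2 : ℝ)) ^ 2 := by gcongr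
    _ = _ := by
      rw [mul_pow, ← ENNReal.rpow_natCast, ← ENNReal.rpow_natCast, ← ENNReal.rpow_mul,
        ← ENNReal.rpow_mul]
      norm_num

theorem lintegral_comp_smul_E2 {f : E2 → ℝ≥0∞} (hf : Measurable f) {t : ℝ} (ht : 0 < t) :
    ∫⁻ w, f (t • w) = ENNReal.ofReal ((t ^ 2)⁻¹) * ∫⁻ h, f h := by
  have h := lintegral_map (μ := (volume : Measure E2)) hf (measurable_const_smul t)
  rw [Measure.map_addHaar_smul _ ht.ne', lintegral_smul_measure, finrank_euclideanSpace_fin,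
    abs_of_pos (by positivity)] at h
  exact h.symm

namespace Frame

variable (S : Frame)

/-- The profile `B` in boundary coordinates: if `z` has normal component `t` and tangential part
`t • w`, then `z / t` is `L w - n`. -/
def face (B : ℝ × E3 → ℂ) (t : ℝ) (w : E2) : ℂ := B (t, S.L w - S.n)

/-- The average of `q` with weight `face B t`. -/
def avg (B : ℝ × E3 → ℂ) (t : ℝ) (q : E2 → ℂ) : ℂ := ∫ w, S.face B t w * q w

theorem continuous_face {B : ℝ × E3 → ℂ} (hB : Continuous B) :
    Continuous fun p : ℝ × E2 => S.face B p.1 p.2 := by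
  unfold face
  exact hB.comp (continuous_fst.prodMk ((S.L.continuous.comp continuous_snd).sub continuous_const))

theorem norm_le_norm_sub_n (w : E2) : ‖w‖ ≤ ‖S.L w - S.n‖ := by
  have h : ‖S.L w - S.n‖ ^ 2 = ‖w‖ ^ 2 + 1 := by
    rw [@norm_sub_sq_real, S.L.norm_map, S.norm_n, real_inner_comm, S.perp]; norm_num
  exact (sq_le_sq₀ (norm_nonneg _) (norm_nonneg _)).1 (by rw [h]; linarith)

theorem face_ne_zero {B : ℝ × E3 → ℂ} {R : ℝ}
    (h : ∀ p, B p ≠ 0 → |p.1| ≤ R ∧ ‖p.2‖ ≤ R) {t : ℝ} {w : E2} (h0 : S.face B t w ≠ 0) :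
    |t| ≤ R ∧ w ∈ Metric.closedBall (0 : E2) R := by
  obtain ⟨h1, h2⟩ := h _ h0
  exact ⟨h1, by simpa using (S.norm_le_norm_sub_n w).trans h2⟩

theorem hasCompactSupport_face {B : ℝ × E3 → ℂ} (hB : Continuous B) (hc : HasCompactSupport B)
    (t : ℝ) : HasCompactSupport (S.face B t) := by
  obtain ⟨R, -, -, -, -, hR⟩ := exists_prof_bound hB hc
  refine HasCompactSupport.intro (isCompact_closedBall (0 : E2) R) fun w hw => ?_
  by_contra h0
  exact hw (S.face_ne_zero hR h0).2

/-- Potentials of all orders are averages of the boundary density over balls with radius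
proportional to the depth. -/
theorem pot_chart (m : ℕ) (B : ℝ × E3 → ℂ) (g : E2 → ℂ) {t : ℝ} (ht : 0 < t) (y : E2) :
    S.pot m B g (S.chart (y, t)) =
      ((t : ℂ) ^ m)⁻¹ * (t : ℂ) ^ 2 * S.avg B t (fun w => g (y - t • w)) := by
  have h1 : ∀ y' : E2, S.homKer m B (S.chart (y, t) - S.bd y') =
      ((t : ℂ) ^ m)⁻¹ * S.face B t (t⁻¹ • (y - y')) := by
    intro y'
    rw [homKer, S.inner_sub_bd, S.depth_chart, face]
    congr 3
    simp only [bd, chart, map_smul, map_sub, smul_sub, smul_add, smul_smul, sub_smul]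
    rw [inv_mul_cancel₀ ht.ne']
    simp
    abel
  simp only [pot, h1]
  rw [← integral_sub_left_eq_self (fun y' => ((t : ℂ) ^ m)⁻¹ * S.face B t (t⁻¹ • (y - y')) * g y')
    volume y]
  have h2 := Measure.integral_comp_smul (volume : Measure E2)
    (fun h => ((t : ℂ) ^ m)⁻¹ * S.face B t (t⁻¹ • h) * g (y - h)) t
  rw [finrank_euclideanSpace_fin, abs_of_pos (by positivity)] at h2
  simp only [smul_smul, inv_mul_cancel₀ ht.ne', one_smul] at h2
  have ht' : (t : ℂ) ≠ 0 := by exact_mod_cast ht.ne'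
  simp only [sub_sub_cancel]
  rw [avg, mul_comm (((t : ℂ) ^ m)⁻¹), mul_assoc, ← integral_const_mul]
  simp only [← mul_assoc]
  rw [h2, Complex.real_smul, ← mul_assoc]
  push_cast
  rw [mul_inv_cancel₀ (pow_ne_zero _ ht'), one_mul]

theorem avg_eq_zero {B : ℝ × E3 → ℂ} {R : ℝ} (h : ∀ p, B p ≠ 0 → |p.1| ≤ R ∧ ‖p.2‖ ≤ R) {t : ℝ}
    (ht : R < t) (q : E2 → ℂ) : S.avg B t q = 0 := by
  rw [avg]
  refine integral_eq_zero_of_ae (Eventually.of_forall fun w => ?_)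
  by_cases h0 : S.face B t w = 0
  · simp [h0]
  · exact absurd ((le_abs_self t).trans (S.face_ne_zero h h0).1) (not_le.2 ht)

/-- The Cauchy–Schwarz inequality for averages. -/
theorem enorm_avg_sq_le {B : ℝ × E3 → ℂ} {R C : ℝ} (hC : ∀ p, ‖B p‖ ≤ C)
    (h : ∀ p, B p ≠ 0 → |p.1| ≤ R ∧ ‖p.2‖ ≤ R) (t : ℝ) {q : E2 → ℂ} (hq : Measurable q) :
    ‖S.avg B t q‖ₑ ^ 2 ≤ ENNReal.ofReal C ^ 2 * volume (Metric.closedBall (0 : E2) R) *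
      ∫⁻ w in Metric.closedBall (0 : E2) R, ‖q w‖ₑ ^ 2 := by
  have h1 : ‖S.avg B t q‖ₑ ≤
      ENNReal.ofReal C * ∫⁻ w in Metric.closedBall (0 : E2) R, ‖q w‖ₑ := by
    rw [avg, ← lintegral_const_mul _ hq.enorm, ← lintegral_indicator measurableSet_closedBall]
    refine (enorm_integral_le_lintegral_enorm _).trans (lintegral_mono fun w => ?_)
    by_cases h0 : S.face B t w = 0
    · simp [h0]
    · rw [Set.indicator_of_mem (S.face_ne_zero h h0).2, enorm_mul]
      gcongr
      rw [← ofReal_norm]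
      exact ENNReal.ofReal_le_ofReal (hC _)
  calc ‖S.avg B t q‖ₑ ^ 2
      ≤ (ENNReal.ofReal C * ∫⁻ w in Metric.closedBall (0 : E2) R, ‖q w‖ₑ) ^ 2 := by gcongr
    _ ≤ _ := by
      rw [mul_pow, mul_assoc]
      gcongr
      refine (sq_lintegral_le _ hq.enorm.aemeasurable).trans ?_
      rw [Measure.restrict_apply_univ]

/-- A function on the half-space is square integrable if it is so in Cartesian coordinates. -/
theorem memLp_of_chart {F : E3 → ℂ} (hF : StronglyMeasurable F) {G : E2 × ℝ → ℂ}
    (hG : MemLp G 2 ((volume : Measure E2).prod (volume.restrict (Set.Ioi 0))))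
    (h : ∀ y t, 0 < t → F (S.chart (y, t)) = G (y, t)) :
    MemLp F 2 (volume.restrict S.dom) := by
  rw [← S.measurePreserving_chart_dom.map_eq]
  rw [memLp_map_measure_iff hF.aestronglyMeasurable S.continuous_chart.measurable.aemeasurable]
  refine hG.ae_eq ?_
  have hp : ∀ᵐ p : E2 × ℝ ∂((volume : Measure E2).prod (volume.restrict (Set.Ioi 0))),
      0 < p.2 :=
    Measure.quasiMeasurePreserving_snd.ae (ae_restrict_mem measurableSet_Ioi)
  filter_upwards [hp] with p hp
  exact (h p.1 p.2 hp).symm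

theorem memLp_prod_of_lintegral {G : E2 × ℝ → ℂ} (hG : StronglyMeasurable G)
    (h : ∫⁻ t in Set.Ioi (0 : ℝ), ∫⁻ y, ‖G (y, t)‖ₑ ^ 2 < ⊤) :
    MemLp G 2 ((volume : Measure E2).prod (volume.restrict (Set.Ioi 0))) := by
  refine memLp_two_of_lintegral hG.aestronglyMeasurable ?_
  rwa [lintegral_prod_symm' _ (hG.measurable.enorm.pow_const 2)]

theorem stronglyMeasurable_avg {B : ℝ × E3 → ℂ} (hB : Continuous B) {q : (E2 × ℝ) × E2 → ℂ}
    (hq : Measurable q) :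
    StronglyMeasurable fun p : E2 × ℝ => S.avg B p.2 fun w => q (p, w) := by
  have : Measurable fun z : (E2 × ℝ) × E2 => S.face B z.1.2 z.2 * q z :=
    ((S.continuous_face hB).measurable.comp
      ((measurable_snd.comp measurable_fst).prodMk measurable_snd)).mul hq
  exact this.stronglyMeasurable.integral_prod_right'

/-- Averages of an `L²` density are square integrable, because translations preserve the norm and
the support of the profile bounds the depth. -/
theorem memLp_avg {B : ℝ × E3 → ℂ} (hB : Continuous B) (hc : HasCompactSupport B) {g : E2 → ℂ}
    (hgm : Measurable g) (hg : MemLp g 2) :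
    MemLp (fun p : E2 × ℝ => S.avg B p.2 fun w => g (p.1 - p.2 • w)) 2
      ((volume : Measure E2).prod (volume.restrict (Set.Ioi 0))) := by
  obtain ⟨R, C, hR, hC0, hC, hsupp⟩ := exists_prof_bound hB hc
  refine memLp_prod_of_lintegral
    (S.stronglyMeasurable_avg hB (q := fun z => g (z.1.1 - z.1.2 • z.2)) (by fun_prop)) ?_
  set K : ℝ≥0∞ := ENNReal.ofReal C ^ 2 * volume (Metric.closedBall (0 : E2) R) with hK
  set N : ℝ≥0∞ := ∫⁻ y, ‖g y‖ₑ ^ 2 with hN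
  have hV : volume (Metric.closedBall (0 : E2) R) < ⊤ := measure_closedBall_lt_top
  have hKt : K < ⊤ := ENNReal.mul_lt_top (by simp) hV
  have hNt : N < ⊤ := lintegral_enorm_sq_lt_top hg
  have hb : ∀ t : ℝ, ∫⁻ y, ‖S.avg B t fun w => g (y - t • w)‖ₑ ^ 2 ≤
      (Set.Iic R).indicator (fun _ => K * (volume (Metric.closedBall (0 : E2) R) * N)) t := by
    intro t
    by_cases htR : t ≤ R
    swap
    · simp [S.avg_eq_zero hsupp (not_le.1 htR)]
    rw [Set.indicator_of_mem (Set.mem_Iic.2 htR)]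
    have hm : Measurable fun p : E2 × E2 => ‖g (p.1 - t • p.2)‖ₑ ^ 2 := by fun_prop
    calc ∫⁻ y, ‖S.avg B t fun w => g (y - t • w)‖ₑ ^ 2
        ≤ ∫⁻ y, K * ∫⁻ w in Metric.closedBall (0 : E2) R, ‖g (y - t • w)‖ₑ ^ 2 :=
          lintegral_mono fun y => S.enorm_avg_sq_le hC hsupp t (by fun_prop)
      _ = K * ∫⁻ w in Metric.closedBall (0 : E2) R, ∫⁻ y, ‖g (y - t • w)‖ₑ ^ 2 := by
          rw [lintegral_const_mul _ hm.lintegral_prod_right', lintegral_lintegral_swap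
            hm.aemeasurable]
      _ = _ := by
          have : ∀ w : E2, ∫⁻ y, ‖g (y - t • w)‖ₑ ^ 2 = N := fun w =>
            lintegral_sub_right_eq_self (fun y => ‖g y‖ₑ ^ 2) (t • w)
          simp only [this, lintegral_const, Measure.restrict_apply_univ]
          rw [mul_comm N]
  refine (lintegral_mono hb).trans_lt ?_
  rw [lintegral_indicator measurableSet_Iic, lintegral_const, Measure.restrict_restrict
    measurableSet_Iic, Measure.restrict_apply_univ]
  refine ENNReal.mul_lt_top (ENNReal.mul_lt_top hKt (ENNReal.mul_lt_top hV hNt)) ?_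
  rw [Set.Iic_inter_Ioi, Real.volume_Ioc]
  exact ENNReal.ofReal_lt_top

theorem memLp_pot_two {B : ℝ × E3 → ℂ} (hB : Continuous B) (hc : HasCompactSupport B) {g : E2 → ℂ}
    (hgm : Measurable g) (hg : MemLp g 2) : MemLp (S.pot 2 B g) 2 (volume.restrict S.dom) := by
  refine S.memLp_of_chart (S.stronglyMeasurable_pot 2 hB hgm) (S.memLp_avg hB hc hgm hg) ?_
  intro y t ht
  have ht' : (t : ℂ) ≠ 0 := by exact_mod_cast ht.ne'
  rw [S.pot_chart 2 B g ht, inv_mul_cancel₀ (pow_ne_zero _ ht'), one_mul]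

/-- The potential of order one is the one of order two with profile `t B`. -/
theorem memLp_pot_one {B : ℝ × E3 → ℂ} (hB : Continuous B) (hc : HasCompactSupport B) {g : E2 → ℂ}
    (hgm : Measurable g) (hg : MemLp g 2) : MemLp (S.pot 1 B g) 2 (volume.restrict S.dom) := by
  have hB' : Continuous fun p : ℝ × E3 => (p.1 : ℂ) * B p :=
    (Complex.continuous_ofReal.comp continuous_fst).mul hB
  refine S.memLp_of_chart (S.stronglyMeasurable_pot 1 hB hgm)
    (S.memLp_avg hB' hc.mul_left hgm hg) ?_
  intro y t ht
  have ht' : (t : ℂ) ≠ 0 := by exact_mod_cast ht.ne'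
  rw [S.pot_chart 1 B g ht]
  have : ((t : ℂ) ^ 1)⁻¹ * (t : ℂ) ^ 2 = t := by field_simp
  rw [this, avg, avg, ← integral_const_mul]
  simp only [face, mul_assoc]

/-- The Slobodeckij seminorm in terms of translation differences. -/
theorem lintegral_translation_lt_top {g : E2 → ℂ} (hgm : Measurable g)
    (h : ∫⁻ x, ∫⁻ y, ‖g x - g y‖ₑ ^ 2 / ‖x - y‖ₑ ^ 3 < ⊤) :
    ∫⁻ h, (∫⁻ y, ‖g (y - h) - g y‖ₑ ^ 2) / ‖h‖ₑ ^ 3 < ⊤ := by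
  refine lt_of_eq_of_lt ?_ h
  have hm : Measurable fun p : E2 × E2 => ‖g (p.1 - p.2) - g p.1‖ₑ ^ 2 / ‖p.2‖ₑ ^ 3 := by fun_prop
  have e : ∀ x : E2, ∫⁻ y, ‖g x - g y‖ₑ ^ 2 / ‖x - y‖ₑ ^ 3 =
      ∫⁻ h, ‖g (x - h) - g x‖ₑ ^ 2 / ‖h‖ₑ ^ 3 := fun x => by
    rw [← lintegral_sub_left_eq_self (fun y => ‖g x - g y‖ₑ ^ 2 / ‖x - y‖ₑ ^ 3) x]
    simp only [sub_sub_cancel]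
    congr 1
    funext h
    rw [← enorm_neg (g x - g (x - h)), neg_sub]
  simp only [e]
  rw [lintegral_lintegral_swap hm.aemeasurable]
  congr 1
  funext h
  simp only [div_eq_mul_inv]
  rw [lintegral_mul_const _ (by fun_prop)]

theorem lintegral_Ici_inv_pow_four {a : ℝ} (ha : 0 < a) :
    ∫⁻ t in Set.Ici a, ENNReal.ofReal ((t ^ 4)⁻¹) = ENNReal.ofReal ((a ^ 3)⁻¹ / 3) := by
  have h1 : ∀ t ∈ Set.Ioi a, t ^ (-4 : ℝ) = (t ^ 4)⁻¹ := fun t ht => by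
    rw [Real.rpow_neg (ha.trans ht).le]; norm_cast
  have hi := (integrableOn_Ioi_rpow_of_lt (a := -4) (by norm_num) ha).congr_fun h1 measurableSet_Ioi
  rw [setLIntegral_congr Ioi_ae_eq_Ici.symm, ← ofReal_integral_eq_lintegral_ofReal hi
    ((ae_restrict_iff' measurableSet_Ioi).2 (Eventually.of_forall fun t ht => by positivity)),
    ← setIntegral_congr_fun measurableSet_Ioi h1, integral_Ioi_rpow_of_lt (by norm_num) ha]
  congr 1
  have : a ^ (-4 + 1 : ℝ) = (a ^ 3)⁻¹ := by
    rw [show (-4 + 1 : ℝ) = -(3 : ℕ) by norm_num, Real.rpow_neg ha.le, Real.rpow_natCast]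
  rw [this]; ring

/-- The averages of the differences of `g`, divided by the depth, are controlled by the Slobodeckij
seminorm: the difference of step `h` only contributes at depths `t ≥ |h| / R`, with weight `t⁻⁴`,
and the integral of this weight is of order `|h|⁻³`. -/
theorem memLp_diff_avg {B : ℝ × E3 → ℂ} (hB : Continuous B) (hc : HasCompactSupport B)
    {g : E2 → ℂ} (hgm : Measurable g)
    (h : ∫⁻ x, ∫⁻ y, ‖g x - g y‖ₑ ^ 2 / ‖x - y‖ₑ ^ 3 < ⊤) :
    MemLp (fun p : E2 × ℝ => (p.2 : ℂ)⁻¹ * S.avg B p.2 fun w => g (p.1 - p.2 • w) - g p.1) 2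
      ((volume : Measure E2).prod (volume.restrict (Set.Ioi 0))) := by
  obtain ⟨R, C, hR, hC0, hC, hsupp⟩ := exists_prof_bound hB hc
  refine memLp_prod_of_lintegral (StronglyMeasurable.mul (by fun_prop)
    (S.stronglyMeasurable_avg hB (q := fun z => g (z.1.1 - z.1.2 • z.2) - g z.1.1)
      (by fun_prop))) ?_
  set K : ℝ≥0∞ := ENNReal.ofReal C ^ 2 * volume (Metric.closedBall (0 : E2) R) with hK
  have hV : volume (Metric.closedBall (0 : E2) R) < ⊤ := measure_closedBall_lt_top
  have hKt : K < ⊤ := ENNReal.mul_lt_top (by simp) hV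
  set τ : E2 → ℝ≥0∞ := fun h => ∫⁻ y, ‖g (y - h) - g y‖ₑ ^ 2 with hτ
  have hτm : Measurable τ := by
    have : Measurable fun p : E2 × E2 => ‖g (p.2 - p.1) - g p.2‖ₑ ^ 2 := by fun_prop
    exact this.lintegral_prod_right'
  have hb : ∀ t ∈ Set.Ioi (0 : ℝ),
      ∫⁻ y, ‖(t : ℂ)⁻¹ * S.avg B t fun w => g (y - t • w) - g y‖ₑ ^ 2 ≤
      K * ∫⁻ h, τ h * (Set.Ici (R⁻¹ * ‖h‖)).indicator
        (fun t => ENNReal.ofReal ((t ^ 4)⁻¹)) t := by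
    intro t ht
    have ht : 0 < t := ht
    have hm : Measurable fun p : E2 × E2 => ‖g (p.1 - t • p.2) - g p.1‖ₑ ^ 2 := by fun_prop
    have ht2 : ‖(t : ℂ)⁻¹‖ₑ ^ 2 = ENNReal.ofReal ((t ^ 2)⁻¹) := by
      rw [← ofReal_norm, norm_inv, Complex.norm_real, Real.norm_of_nonneg ht.le,
        ← ENNReal.ofReal_pow (by positivity), inv_pow]
    calc ∫⁻ y, ‖(t : ℂ)⁻¹ * S.avg B t fun w => g (y - t • w) - g y‖ₑ ^ 2
        ≤ ∫⁻ y, ENNReal.ofReal ((t ^ 2)⁻¹) *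
            (K * ∫⁻ w in Metric.closedBall (0 : E2) R, ‖g (y - t • w) - g y‖ₑ ^ 2) :=
          lintegral_mono fun y => by
            rw [enorm_mul, mul_pow, ht2]
            gcongr
            exact S.enorm_avg_sq_le hC hsupp t (by fun_prop)
      _ = ENNReal.ofReal ((t ^ 2)⁻¹) *
            (K * ∫⁻ w in Metric.closedBall (0 : E2) R, τ (t • w)) := by
          rw [lintegral_const_mul _ (hm.lintegral_prod_right'.const_mul _),
            lintegral_const_mul _ hm.lintegral_prod_right',
            lintegral_lintegral_swap hm.aemeasurable]
      _ = ENNReal.ofReal ((t ^ 2)⁻¹) *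
            (K * ∫⁻ w, (Metric.closedBall (0 : E2) (R * t)).indicator τ (t • w)) := by
          rw [← lintegral_indicator measurableSet_closedBall]
          congr 2
          refine lintegral_congr fun w => ?_
          have : w ∈ Metric.closedBall (0 : E2) R ↔ t • w ∈ Metric.closedBall (0 : E2) (R * t) := by
            simp only [mem_closedBall_zero_iff, norm_smul, Real.norm_of_nonneg ht.le]
            rw [mul_comm R t, mul_le_mul_iff_right₀ ht]
          by_cases hw : w ∈ Metric.closedBall (0 : E2) R
          · rw [Set.indicator_of_mem hw, Set.indicator_of_mem (this.1 hw)]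
          · rw [Set.indicator_of_notMem hw, Set.indicator_of_notMem (fun h => hw (this.2 h))]
      _ = K * (ENNReal.ofReal ((t ^ 4)⁻¹) *
            ∫⁻ h, (Metric.closedBall (0 : E2) (R * t)).indicator τ h) := by
          have e4 : ENNReal.ofReal ((t ^ 4)⁻¹) =
              ENNReal.ofReal ((t ^ 2)⁻¹) * ENNReal.ofReal ((t ^ 2)⁻¹) := by
            rw [← ENNReal.ofReal_mul (by positivity), ← mul_inv, ← pow_add]
          rw [lintegral_comp_smul_E2 (hτm.indicator measurableSet_closedBall) ht, e4]
          ring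
      _ = _ := by
          rw [← lintegral_const_mul _ (hτm.indicator measurableSet_closedBall)]
          congr 1
          refine lintegral_congr fun h => ?_
          have : h ∈ Metric.closedBall (0 : E2) (R * t) ↔ t ∈ Set.Ici (R⁻¹ * ‖h‖) := by
            simp only [mem_closedBall_zero_iff, Set.mem_Ici]
            rw [inv_mul_le_iff₀ hR]
          by_cases hh : h ∈ Metric.closedBall (0 : E2) (R * t)
          · rw [Set.indicator_of_mem hh, Set.indicator_of_mem (this.1 hh), mul_comm]
          · rw [Set.indicator_of_notMem hh, Set.indicator_of_notMem (fun h => hh (this.2 h)),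
              mul_zero, mul_zero]
  refine (setLIntegral_mono' measurableSet_Ioi hb).trans_lt ?_
  have hm2 : Measurable fun p : ℝ × E2 => τ p.2 * (Set.Ici (R⁻¹ * ‖p.2‖)).indicator
      (fun t => ENNReal.ofReal ((t ^ 4)⁻¹)) p.1 := by
    refine (hτm.comp measurable_snd).mul ?_
    have hs : MeasurableSet {p : ℝ × E2 | R⁻¹ * ‖p.2‖ ≤ p.1} :=
      measurableSet_le (by fun_prop) (by fun_prop)
    have hf : Measurable fun p : ℝ × E2 => ENNReal.ofReal ((p.1 ^ 4)⁻¹) := by fun_prop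
    exact hf.indicator hs
  rw [lintegral_const_mul _ hm2.lintegral_prod_right', lintegral_lintegral_swap hm2.aemeasurable]
  refine ENNReal.mul_lt_top hKt ?_
  have hfin := lintegral_translation_lt_top hgm h
  have hle : ∀ᵐ h : E2, (∫⁻ t in Set.Ioi (0 : ℝ), τ h * (Set.Ici (R⁻¹ * ‖h‖)).indicator
      (fun t => ENNReal.ofReal ((t ^ 4)⁻¹)) t) ≤
      ENNReal.ofReal (R ^ 3) * (τ h / ‖h‖ₑ ^ 3) := by
    filter_upwards [(volume : Measure E2).ae_ne 0] with h hh
    have hh : 0 < ‖h‖ := norm_pos_iff.2 hh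
    have hm3 : Measurable ((Set.Ici (R⁻¹ * ‖h‖)).indicator
      (fun t : ℝ => ENNReal.ofReal ((t ^ 4)⁻¹))) :=
      Measurable.indicator (by fun_prop) measurableSet_Ici
    rw [lintegral_const_mul _ hm3]
    have h1 : ∫⁻ t in Set.Ioi (0 : ℝ), (Set.Ici (R⁻¹ * ‖h‖)).indicator
        (fun t : ℝ => ENNReal.ofReal ((t ^ 4)⁻¹)) t ≤ ENNReal.ofReal (R ^ 3) / ‖h‖ₑ ^ 3 := by
      calc _ ≤ ∫⁻ t, (Set.Ici (R⁻¹ * ‖h‖)).indicator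
            (fun t : ℝ => ENNReal.ofReal ((t ^ 4)⁻¹)) t := setLIntegral_le_lintegral _ _
        _ = ENNReal.ofReal (((R⁻¹ * ‖h‖) ^ 3)⁻¹ / 3) := by
            rw [lintegral_indicator measurableSet_Ici, lintegral_Ici_inv_pow_four (by positivity)]
        _ ≤ ENNReal.ofReal (R ^ 3 / ‖h‖ ^ 3) := by
            apply ENNReal.ofReal_le_ofReal
            have : ((R⁻¹ * ‖h‖) ^ 3)⁻¹ = R ^ 3 / ‖h‖ ^ 3 := by field_simp
            rw [this]
            have : 0 ≤ R ^ 3 / ‖h‖ ^ 3 := by positivity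
            linarith
        _ = _ := by
            rw [ENNReal.ofReal_div_of_pos (by positivity), ENNReal.ofReal_pow hh.le,
              ofReal_norm]
    calc _ ≤ τ h * (ENNReal.ofReal (R ^ 3) / ‖h‖ₑ ^ 3) := by gcongr
      _ = _ := by rw [div_eq_mul_inv, div_eq_mul_inv]; ring
  refine (lintegral_mono_ae hle).trans_lt ?_
  rw [lintegral_const_mul' _ _ ENNReal.ofReal_ne_top]
  exact ENNReal.mul_lt_top ENNReal.ofReal_lt_top hfin

/-- The zeroth moment of a profile over the plane at depth `t`. -/
def moment (B : ℝ × E3 → ℂ) (t : ℝ) : ℂ := ∫ w, S.face B t w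

/-- The moment depends on the depth in a Lipschitz way. -/
theorem norm_moment_sub_le {B : ℝ × E3 → ℂ} (hB : ContDiff ℝ ∞ B) (hc : HasCompactSupport B) :
    ∃ K : ℝ, 0 ≤ K ∧ ∀ t, ‖S.moment B t - S.moment B 0‖ ≤ K * |t| := by
  obtain ⟨R, C, hR, hC0, hC, hsupp⟩ := exists_prof_bound hB.continuous hc
  obtain ⟨A, hA⟩ := ContDiff.lipschitzWith_of_hasCompactSupport hc hB (by simp)
  have hi : ∀ t, Integrable (S.face B t) := fun t =>
    ((S.continuous_face hB.continuous).comp (Continuous.prodMk_right t)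
      ).integrable_of_hasCompactSupport (S.hasCompactSupport_face hB.continuous hc t)
  refine ⟨A * (volume (Metric.closedBall (0 : E2) R)).toReal, by positivity, fun t => ?_⟩
  rw [moment, moment, ← integral_sub (hi t) (hi 0)]
  have hz : ∀ w ∉ Metric.closedBall (0 : E2) R, S.face B t w - S.face B 0 w = 0 := by
    intro w hw
    have h0 : ∀ s, S.face B s w = 0 := fun s => by
      by_contra h0
      exact hw (S.face_ne_zero hsupp h0).2
    rw [h0, h0, sub_zero]
  rw [← setIntegral_eq_integral_of_forall_compl_eq_zero hz]
  refine (norm_setIntegral_le_of_norm_le_const (C := A * |t|) measure_closedBall_lt_top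
    fun w _ => ?_).trans (le_of_eq ?_)
  · have := hA.dist_le_mul (t, S.L w - S.n) (0, S.L w - S.n)
    rw [dist_eq_norm, dist_eq_norm] at this
    simpa [face, Prod.norm_def] using this
  · rw [Measure.real]; ring

/-- The potential of order three is square integrable if the zeroth moment of its profile vanishes
on the boundary: the kernel then only sees differences of the density. -/
theorem memLp_pot_three {B : ℝ × E3 → ℂ} (hB : ContDiff ℝ ∞ B) (hc : HasCompactSupport B)
    (h0 : S.moment B 0 = 0) {g : E2 → ℂ} (hgm : Measurable g) (hg : MemLp g 2)
    (h : ∫⁻ x, ∫⁻ y, ‖g x - g y‖ₑ ^ 2 / ‖x - y‖ₑ ^ 3 < ⊤) :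
    MemLp (S.pot 3 B g) 2 (volume.restrict S.dom) := by
  obtain ⟨R, C, hR, hC0, hC, hsupp⟩ := exists_prof_bound hB.continuous hc
  obtain ⟨K, hK0, hK⟩ := S.norm_moment_sub_le hB hc
  have hmm : StronglyMeasurable (S.moment B) :=
    (S.continuous_face hB.continuous).stronglyMeasurable.integral_prod_right'
  have hL : MemLp (fun p : E2 × ℝ => (p.2 : ℂ)⁻¹ * S.moment B p.2 * g p.1) 2
      ((volume : Measure E2).prod (volume.restrict (Set.Ioi 0))) := by
    refine memLp_prod_of_lintegral (StronglyMeasurable.mul (StronglyMeasurable.mul (by fun_prop)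
      (hmm.comp_measurable measurable_snd)) (hgm.comp measurable_fst).stronglyMeasurable) ?_
    have hb : ∀ t ∈ Set.Ioi (0 : ℝ), ∫⁻ y, ‖(t : ℂ)⁻¹ * S.moment B t * g y‖ₑ ^ 2 ≤
        (Set.Iic R).indicator (fun _ => ENNReal.ofReal K ^ 2 * ∫⁻ y, ‖g y‖ₑ ^ 2) t := by
      intro t ht
      have ht : 0 < t := ht
      by_cases htR : t ≤ R
      · rw [Set.indicator_of_mem (Set.mem_Iic.2 htR), ← lintegral_const_mul _ (by fun_prop)]
        refine lintegral_mono fun y => ?_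
        rw [enorm_mul, mul_pow]
        gcongr
        rw [← ofReal_norm]
        apply ENNReal.ofReal_le_ofReal
        have := hK t
        rw [h0, sub_zero, abs_of_pos ht] at this
        rw [norm_mul, norm_inv, Complex.norm_real, Real.norm_of_nonneg ht.le, inv_mul_le_iff₀ ht]
        linarith
      · have : S.moment B t = 0 := by
          have := S.avg_eq_zero hsupp (not_le.1 htR) (fun _ => 1)
          simpa [avg, moment] using this
        simp [this]
    refine (setLIntegral_mono' measurableSet_Ioi hb).trans_lt ?_
    rw [lintegral_indicator measurableSet_Iic, lintegral_const, Measure.restrict_restrict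
      measurableSet_Iic, Measure.restrict_apply_univ, Set.Iic_inter_Ioi, Real.volume_Ioc]
    exact ENNReal.mul_lt_top (ENNReal.mul_lt_top (by simp) (lintegral_enorm_sq_lt_top hg))
      ENNReal.ofReal_lt_top
  refine S.memLp_of_chart (S.stronglyMeasurable_pot 3 hB.continuous hgm)
    ((S.memLp_diff_avg hB.continuous hc hgm h).add hL) ?_
  intro y t ht
  have ht' : (t : ℂ) ≠ 0 := by exact_mod_cast ht.ne'
  rw [S.pot_chart 3 B g ht]
  simp only [Pi.add_apply]
  have e1 : ((t : ℂ) ^ 3)⁻¹ * (t : ℂ) ^ 2 = (t : ℂ)⁻¹ := by field_simp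
  rw [e1, mul_assoc, ← mul_add]
  congr 1
  have hfc : Continuous (S.face B t) :=
    (S.continuous_face hB.continuous).comp (Continuous.prodMk_right t)
  have hfs := S.hasCompactSupport_face hB.continuous hc t
  have hgl : LocallyIntegrable (fun w => g (y - t • w)) := by
    have h1 : MemLp (fun w => g (y - t • w)) 2 := by
      refine memLp_two_of_lintegral
        (hgm.comp (by fun_prop : Measurable fun w => y - t • w)).aestronglyMeasurable ?_
      rw [lintegral_comp_smul_E2 (f := fun h => ‖g (y - h)‖ₑ ^ 2) (by fun_prop) ht,
        lintegral_sub_left_eq_self (fun h => ‖g h‖ₑ ^ 2) y]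
      exact ENNReal.mul_lt_top ENNReal.ofReal_lt_top (lintegral_enorm_sq_lt_top hg)
    exact h1.locallyIntegrable (by norm_num)
  have hi1 : Integrable fun w => S.face B t w * g (y - t • w) :=
    hgl.integrable_smul_left_of_hasCompactSupport hfc hfs
  have hi2 : Integrable fun w => S.face B t w * g y :=
    (hfc.integrable_of_hasCompactSupport hfs).mul_const _
  simp only [avg, moment, mul_sub]
  rw [integral_sub hi1 hi2, integral_mul_const]
  ring

end Frame

/-! ### Boundary values and normal derivative of the potentials -/

namespace Frame

variable (S : Frame)

theorem contDiff_face {B : ℝ × E3 → ℂ} (hB : ContDiff ℝ ∞ B) (t : ℝ) :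
    ContDiff ℝ ∞ (S.face B t) := by
  unfold face
  exact hB.comp (contDiff_const.prodMk
    (S.L.toContinuousLinearMap.contDiff.sub contDiff_const))

theorem fderiv_face {B : ℝ × E3 → ℂ} (hB : ContDiff ℝ ∞ B) (t : ℝ) (w a : E2) :
    fderiv ℝ (S.face B t) w a = fderiv ℝ B (t, S.L w - S.n) (0, S.L a) := by
  have h1 : HasFDerivAt (fun w : E2 => (t, S.L w - S.n))
      ((0 : E2 →L[ℝ] ℝ).prod S.L.toContinuousLinearMap) w :=
    (hasFDerivAt_const t w).prodMk (S.L.toContinuousLinearMap.hasFDerivAt.sub_const _)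
  have h2 := (hB.differentiable (by simp) (t, S.L w - S.n)).hasFDerivAt.comp w h1
  have h3 : fderiv ℝ (S.face B t) w = _ := h2.fderiv
  rw [h3]
  rfl

theorem integral_fderiv_eq_zero {β : E2 → ℂ} (hβ : ContDiff ℝ ∞ β) (hc : HasCompactSupport β)
    (a : E2) : ∫ w, fderiv ℝ β w a = 0 := by
  have hi : Integrable β := hβ.continuous.integrable_of_hasCompactSupport hc
  have hi' : Integrable fun w => fderiv ℝ β w a :=
    ((hβ.continuous_fderiv (by simp)).clm_apply continuous_const).integrable_of_hasCompactSupport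
      (hc.fderiv_apply ℝ a)
  have := integral_mul_fderiv_eq_neg_fderiv_mul_of_integrable (μ := (volume : Measure E2))
    (f := fun _ => (1 : ℂ)) (g := β) (v := a) (by simp) (by simpa using hi') (by simpa using hi)
    (by fun_prop) (fun x _ => hβ.differentiable (by simp) x)
  simpa using this

/-- Euler's identity, integrated over the plane. -/
theorem integral_fderiv_self {β : E2 → ℂ} (hβ : ContDiff ℝ ∞ β) (hc : HasCompactSupport β) :
    Integrable (fun w => fderiv ℝ β w w) ∧ ∫ w, fderiv ℝ β w w = -2 * ∫ w, β w := by
  have hi : Integrable β := hβ.continuous.integrable_of_hasCompactSupport hc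
  have hdc : Continuous (fderiv ℝ β) := hβ.continuous_fderiv (by simp)
  have hci : ∀ i : Fin 2, Continuous fun w : E2 => ((w i : ℝ) : ℂ) := fun i => by fun_prop
  have hdi : ∀ i : Fin 2, Integrable fun w : E2 =>
      ((w i : ℝ) : ℂ) * fderiv ℝ β w (EuclideanSpace.single i 1) := fun i =>
    ((hci i).mul (hdc.clm_apply continuous_const)).integrable_of_hasCompactSupport
      (hc.fderiv_apply ℝ _).mul_left
  have e : (fun w => fderiv ℝ β w w) = fun w : E2 =>
      ∑ i, ((w i : ℝ) : ℂ) * fderiv ℝ β w (EuclideanSpace.single i 1) := by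
    funext w
    have hw : w = ∑ i, w i • EuclideanSpace.single i (1 : ℝ) := by
      ext j; fin_cases j <;> simp
    conv_lhs => rw [hw]
    rw [map_sum, ← hw]
    simp
  rw [e]
  refine ⟨integrable_finsetSum _ fun i _ => hdi i, ?_⟩
  rw [integral_finsetSum _ fun i _ => hdi i]
  have h1 : ∀ i : Fin 2, ∫ w : E2, ((w i : ℝ) : ℂ) * fderiv ℝ β w (EuclideanSpace.single i 1) =
      -∫ w, β w := by
    intro i
    have hd : ∀ w : E2, HasFDerivAt (fun w : E2 => ((w i : ℝ) : ℂ))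
        (Complex.ofRealCLM.comp (EuclideanSpace.proj i)) w := fun w =>
      (Complex.ofRealCLM.comp
        (EuclideanSpace.proj i : EuclideanSpace ℝ (Fin 2) →L[ℝ] ℝ)).hasFDerivAt
    have hv : ∀ w : E2,
        fderiv ℝ (fun w : E2 => ((w i : ℝ) : ℂ)) w (EuclideanSpace.single i 1) = 1 :=
      fun w => by rw [(hd w).fderiv]; simp
    rw [integral_mul_fderiv_eq_neg_fderiv_mul_of_integrable (by simpa [hv] using hi) (hdi i)
      (((hci i).mul hβ.continuous).integrable_of_hasCompactSupport hc.mul_left)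
      (fun w _ => (hd w).differentiableAt) (fun x _ => hβ.differentiable (by simp) x)]
    simp [hv]
  simp only [h1, Finset.sum_const, Finset.card_univ, Fintype.card_fin]
  ring

/-- Differentiation multiplies the boundary moment of a profile by `(m - 2)⟪n, v⟫`; in particular
it annihilates the moment for `m = 2`, the order of the first derivatives of the potential. -/
theorem moment_dProf {B : ℝ × E3 → ℂ} (hB : ContDiff ℝ ∞ B) (hc : HasCompactSupport B) (m : ℕ)
    (v : E3) :
    S.moment (S.dProf m v B) 0 = ((m : ℂ) - 2) * (inner ℝ S.n v : ℝ) * S.moment B 0 := by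
  have hβ := S.contDiff_face hB 0
  have hβc := S.hasCompactSupport_face hB.continuous hc 0
  -- the tangential and normal parts of `v`
  obtain ⟨a, ha⟩ : ∃ a, v = S.L a + (inner ℝ S.n v : ℝ) • S.n := by
    obtain ⟨a, ha⟩ := S.chart_surj v
    refine ⟨a, ?_⟩
    conv_lhs => rw [← ha, chart, depth]
    simp
  have e : ∀ w, S.face (S.dProf m v B) 0 w = ((m : ℂ) * (inner ℝ S.n v : ℝ)) * S.face B 0 w +
      (fderiv ℝ (S.face B 0) w a + (inner ℝ S.n v : ℝ) * fderiv ℝ (S.face B 0) w w) := by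
    intro w
    rw [S.fderiv_face hB, S.fderiv_face hB, ← Complex.real_smul, ← map_smul, ← map_add, face, face,
      dProf]
    have : ((-inner ℝ S.n v : ℝ) * (0 : ℝ), v + (inner ℝ S.n v : ℝ) • (S.L w - S.n)) =
        ((0 : ℝ), S.L a) + (inner ℝ S.n v : ℝ) • ((0 : ℝ), S.L w) := by
      ext1
      · simp
      · simp only [Prod.snd_add, Prod.smul_snd, smul_sub]
        nth_rw 1 [ha]
        abel
    rw [this]
    push_cast
    rfl
  obtain ⟨hi, h2⟩ := integral_fderiv_self hβ hβc
  have hi0 : Integrable (S.face B 0) := hβ.continuous.integrable_of_hasCompactSupport hβc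
  have hia : Integrable fun w => fderiv ℝ (S.face B 0) w a :=
    ((hβ.continuous_fderiv (by simp)).clm_apply continuous_const).integrable_of_hasCompactSupport
      (hβc.fderiv_apply ℝ a)
  have his : Integrable fun w => fderiv ℝ (S.face B 0) w a +
      (inner ℝ S.n v : ℝ) * fderiv ℝ (S.face B 0) w w := hia.add (hi.const_mul _)
  simp only [moment, e]
  rw [integral_add (hi0.const_mul _) his,
    integral_add hia (hi.const_mul _), integral_const_mul, integral_const_mul, h2,
    integral_fderiv_eq_zero hβ hβc]
  ring

/-- There is a profile with boundary moment `-1`. -/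
theorem exists_prof : ∃ B : ℝ × E3 → ℂ, ContDiff ℝ ∞ B ∧ HasCompactSupport B ∧
    S.moment B 0 = -1 := by
  let b : ContDiffBump ((0 : ℝ), -S.n) := ⟨1, 2, one_pos, one_lt_two⟩
  let B : ℝ × E3 → ℂ := fun p => (b p : ℂ)
  have hB : ContDiff ℝ ∞ B := Complex.ofRealCLM.contDiff.comp b.contDiff
  have hc : HasCompactSupport B := b.hasCompactSupport.comp_left (g := fun r : ℝ => (r : ℂ)) rfl
  have hcont : Continuous fun w : E2 => b ((0 : ℝ), S.L w - S.n) :=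
    b.continuous.comp (continuous_const.prodMk (S.L.continuous.sub continuous_const))
  have hs : HasCompactSupport fun w : E2 => b ((0 : ℝ), S.L w - S.n) := by
    have := S.hasCompactSupport_face hB.continuous hc 0
    refine this.mono fun w hw => ?_
    simpa [face, B] using hw
  have hpos : 0 < ∫ w : E2, b ((0 : ℝ), S.L w - S.n) := by
    refine hcont.integral_pos_of_hasCompactSupport_nonneg_nonzero hs (fun w => b.nonneg) (x := 0) ?_
    have : b ((0 : ℝ), -S.n) = 1 :=
      b.one_of_mem_closedBall (Metric.mem_closedBall_self (by simp [b]))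
    simp [this]
  have hM : S.moment B 0 = ((∫ w : E2, b ((0 : ℝ), S.L w - S.n) : ℝ) : ℂ) :=
    integral_ofReal
  have hM0 : S.moment B 0 ≠ 0 := by rw [hM]; exact_mod_cast hpos.ne'
  refine ⟨fun p => -(S.moment B 0)⁻¹ * B p, contDiff_const.mul hB, hc.mul_left, ?_⟩
  have : S.moment (fun p => -(S.moment B 0)⁻¹ * B p) 0 = -(S.moment B 0)⁻¹ * S.moment B 0 := by
    conv_lhs => rw [moment]
    simp only [face]
    rw [integral_const_mul]
    rfl
  rw [this, neg_mul, inv_mul_cancel₀ hM0]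

theorem bumpDeriv_nonneg (s : ℝ) : 0 ≤ bumpDeriv s := by
  refine Monotone.deriv_nonneg fun x y hxy => ?_
  have h1 := expNegInvGlue.monotone hxy
  have h2 : expNegInvGlue (1 - y) ≤ expNegInvGlue (1 - x) :=
    expNegInvGlue.monotone (by linarith)
  rw [Real.smoothTransition, Real.smoothTransition, div_le_div_iff₀
    (Real.smoothTransition.pos_denom x) (Real.smoothTransition.pos_denom y)]
  nlinarith [mul_le_mul h1 h2 (expNegInvGlue.nonneg _) (expNegInvGlue.nonneg _)]

/-- The derivatives of the cut-off functions in the normal variable form an approximate identity at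
the boundary. -/
theorem tendsto_peak {h : ℝ → ℂ} (hi : IntegrableOn h (Set.Ioi 0)) {a : ℂ}
    (ha : Tendsto h (𝓝[>] 0) (𝓝 a)) :
    Tendsto (fun k : ℕ => ∫ t in Set.Ioi (0 : ℝ),
      (((k : ℝ) + 1) * bumpDeriv (((k : ℝ) + 1) * t - 1)) • h t) atTop (𝓝 a) := by
  have hcont : ∀ k : ℕ, Continuous fun t : ℝ =>
      ((k : ℝ) + 1) * bumpDeriv (((k : ℝ) + 1) * t - 1) := fun k =>
    continuous_const.mul (continuous_bumpDeriv.comp (by fun_prop))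
  refine tendsto_setIntegral_peak_smul_of_integrableOn_of_tendsto (x₀ := 0) measurableSet_Ioi
    (t := Set.Ioc 0 1) measurableSet_Ioc Set.Ioc_subset_Ioi_self
    (Ioc_mem_nhdsGT one_pos) (by simp) ?_ ?_ ?_ ?_ hi ha
  · exact Eventually.of_forall fun k t _ => mul_nonneg (by positivity) (bumpDeriv_nonneg _)
  · intro u hu h0
    obtain ⟨ε, hε, hu'⟩ := Metric.isOpen_iff.1 hu 0 h0
    have hk : Tendsto (fun k : ℕ => ((k : ℝ) + 1) * ε) atTop atTop :=
      Tendsto.atTop_mul_const hε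
        (tendsto_atTop_add_const_right _ _ tendsto_natCast_atTop_atTop)
    rw [Metric.tendstoUniformlyOn_iff]
    intro δ hδ
    filter_upwards [hk.eventually_gt_atTop 2] with k hk t ht
    have ht0 : 0 < t := ht.1
    have htε : ε ≤ t := by
      by_contra hlt
      refine ht.2 (hu' ?_)
      rw [mem_ball_zero_iff, Real.norm_of_nonneg ht0.le]
      exact not_le.1 hlt
    have : ((k : ℝ) + 1) * ε ≤ ((k : ℝ) + 1) * t := by gcongr
    rw [bumpDeriv_of_gt (by linarith)]
    simpa using hδ
  · refine tendsto_const_nhds.congr' ?_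
    filter_upwards [eventually_ge_atTop 1] with k hk
    rw [← intervalIntegral.integral_of_le zero_le_one,
      intervalIntegral.integral_eq_sub_of_hasDerivAt
        (f := fun t => Real.smoothTransition (((k : ℝ) + 1) * t - 1)) (fun t _ => ?_)
        ((hcont k).intervalIntegrable _ _)]
    · have hk' : (1 : ℝ) ≤ k := by exact_mod_cast hk
      rw [Real.smoothTransition.one_of_one_le (by linarith),
        Real.smoothTransition.zero_of_nonpos (by linarith)]
      norm_num
    · have h1 : HasDerivAt (fun t : ℝ => ((k : ℝ) + 1) * t - 1) ((k : ℝ) + 1) t := by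
        simpa using ((hasDerivAt_id t).const_mul ((k : ℝ) + 1)).sub_const 1
      have := (hasDerivAt_smoothTransition (((k : ℝ) + 1) * t - 1)).comp t h1
      rw [mul_comm]
      exact this
  · exact Eventually.of_forall fun k => (hcont k).aestronglyMeasurable

/-- A potential of order two has boundary values `moment B 0 • g`, in the weak sense. -/
theorem tendsto_layer {B : ℝ × E3 → ℂ} (hB : Continuous B) (hc : HasCompactSupport B) {g : E2 → ℂ}
    (hgm : Measurable g) (hg : LocallyIntegrable g) {φ : E3 → ℂ} (hφ : IsTest Set.univ φ) :
    Tendsto (fun t => ∫ y, S.pot 2 B g (S.chart (y, t)) * φ (S.chart (y, t))) (𝓝[>] 0)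
      (𝓝 (S.moment B 0 * ∫ y, g y * φ (S.bd y))) := by
  obtain ⟨R, C, hR, hC0, hC, hsupp⟩ := exists_prof_bound hB hc
  obtain ⟨A, hA⟩ := hφ.2.1.exists_bound_of_continuous hφ.continuous
  have hA0 : 0 ≤ A := (norm_nonneg _).trans (hA 0)
  obtain ⟨ρ, hρ⟩ := hφ.2.1.isCompact.isBounded.exists_norm_le
  let Q : ℝ → E2 × E2 → ℂ := fun t p =>
    S.face B t p.1 * g p.2 * φ (S.chart (p.2 + t • p.1, t))
  let K1 := Metric.closedBall (0 : E2) R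
  let K2 := Metric.closedBall (0 : E2) (ρ + (|S.c| + 1) + R)
  let bnd : E2 × E2 → ℝ := fun p =>
    K1.indicator (fun _ => C * A) p.1 * K2.indicator (fun y => ‖g y‖) p.2
  have hbi : Integrable bnd := by
    refine Integrable.mul_prod ?_ ?_
    · exact (integrable_indicator_iff measurableSet_closedBall).2
        (integrableOn_const measure_closedBall_lt_top.ne)
    · exact (integrable_indicator_iff measurableSet_closedBall).2
        (hg.integrableOn_isCompact (isCompact_closedBall _ _)).norm
  have hQm : ∀ t, Measurable (Q t) := fun t => by
    have h1 : Measurable fun p : E2 × E2 => S.face B t p.1 :=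
      ((S.continuous_face hB).comp (Continuous.prodMk_right t)).measurable.comp measurable_fst
    have h2 : Measurable fun p : E2 × E2 => φ (S.chart (p.2 + t • p.1, t)) :=
      (hφ.continuous.comp (S.continuous_chart.comp (by fun_prop))).measurable
    exact (h1.mul (hgm.comp measurable_snd)).mul h2
  have hQb : ∀ t, 0 ≤ t → t ≤ 1 → ∀ p, ‖Q t p‖ ≤ bnd p := by
    intro t ht0 ht1 p
    by_cases hf : S.face B t p.1 = 0
    · simp only [Q, hf, zero_mul, norm_zero]
      exact mul_nonneg (Set.indicator_nonneg (fun _ _ => by positivity) _)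
        (Set.indicator_nonneg (fun _ _ => norm_nonneg _) _)
    by_cases hp : φ (S.chart (p.2 + t • p.1, t)) = 0
    · simp only [Q, hp, mul_zero, norm_zero]
      exact mul_nonneg (Set.indicator_nonneg (fun _ _ => by positivity) _)
        (Set.indicator_nonneg (fun _ _ => norm_nonneg _) _)
    have hm1 : p.1 ∈ K1 := (S.face_ne_zero hsupp hf).2
    have hw : ‖p.1‖ ≤ R := by simpa [K1] using hm1
    have hn := hρ _ (subset_tsupport _ hp)
    have hm2 : p.2 ∈ K2 := by
      simp only [K2, mem_closedBall_zero_iff]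
      have e1 : ‖p.2 + t • p.1‖ ≤ ρ + (|S.c| + 1) := by
        have : S.L (p.2 + t • p.1) = S.chart (p.2 + t • p.1, t) - (S.c - t) • S.n := by
          simp [chart]
        rw [← S.L.norm_map, this]
        refine (norm_sub_le _ _).trans (add_le_add hn ?_)
        rw [norm_smul, S.norm_n, mul_one]
        refine (norm_sub_le _ _).trans (add_le_add le_rfl ?_)
        rwa [Real.norm_of_nonneg ht0]
      have e2 : p.2 = (p.2 + t • p.1) - t • p.1 := by abel
      rw [e2]
      refine (norm_sub_le _ _).trans (add_le_add e1 ?_)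
      rw [norm_smul, Real.norm_of_nonneg ht0]
      calc t * ‖p.1‖ ≤ 1 * R := by gcongr
        _ = R := one_mul R
    simp only [Q, bnd, Set.indicator_of_mem hm1, Set.indicator_of_mem hm2, norm_mul]
    calc ‖S.face B t p.1‖ * ‖g p.2‖ * ‖φ (S.chart (p.2 + t • p.1, t))‖ ≤ C * ‖g p.2‖ * A := by
          gcongr
          · exact hC _
          · exact hA _
      _ = _ := by ring
  have hQi : ∀ t, 0 ≤ t → t ≤ 1 → Integrable (Q t) := fun t h0 h1 =>
    hbi.mono' (hQm t).aestronglyMeasurable (Eventually.of_forall (hQb t h0 h1))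
  -- The shear `(w, y) ↦ (w, y - t w)` exchanges the roles of the two boundary points.
  have hh : ∀ t, 0 < t → t ≤ 1 →
      ∫ y, S.pot 2 B g (S.chart (y, t)) * φ (S.chart (y, t)) = ∫ p, Q t p := by
    intro t ht ht1
    have hT : MeasurePreserving (fun p : E2 × E2 => (p.1, p.2 - t • p.1)) :=
      (MeasurePreserving.id (volume : Measure E2)).skew_product (g := fun w y => y - t • w)
        (by fun_prop) (Eventually.of_forall fun w => map_sub_right_eq_self volume (t • w))
    have hQT : Integrable (fun p : E2 × E2 => Q t (p.1, p.2 - t • p.1)) :=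
      hT.integrable_comp_of_integrable (hQi t ht.le ht1)
    have e1 : ∫ p, Q t p = ∫ p : E2 × E2, Q t (p.1, p.2 - t • p.1) := by
      conv_lhs => rw [← hT.map_eq]
      exact integral_map hT.measurable.aemeasurable (hQm t).aestronglyMeasurable
    refine Eq.trans ?_ (e1.trans (integral_prod_symm _ hQT)).symm
    congr 1
    funext y
    have ht' : (t : ℂ) ≠ 0 := by exact_mod_cast ht.ne'
    rw [S.pot_chart 2 B g ht, inv_mul_cancel₀ (pow_ne_zero _ ht'), one_mul, avg,
      ← integral_mul_const]
    simp only [Q, sub_add_cancel]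
  have h0 : ∫ p, Q 0 p = S.moment B 0 * ∫ y, g y * φ (S.bd y) := by
    rw [moment, ← integral_prod_mul]
    simp only [Q, zero_smul, add_zero, bd, mul_assoc]
    rfl
  rw [← h0]
  have hev : ∀ᶠ t : ℝ in 𝓝[>] 0, 0 < t ∧ t ≤ 1 := by
    filter_upwards [Ioc_mem_nhdsGT (one_pos : (0 : ℝ) < 1)] with t ht using ht
  refine Tendsto.congr' (f₁ := fun t => ∫ p, Q t p) ?_ ?_
  · filter_upwards [hev] with t ht using (hh t ht.1 ht.2).symm
  · refine tendsto_integral_filter_of_dominated_convergence bnd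
      (Eventually.of_forall fun t => (hQm t).aestronglyMeasurable) ?_ hbi
      (Eventually.of_forall fun p => ?_)
    · filter_upwards [hev] with t ht using Eventually.of_forall (hQb t ht.1.le ht.2)
    · have hcont : Continuous fun t : ℝ => Q t p := by
        have h1 : Continuous fun t : ℝ => S.face B t p.1 :=
          (S.continuous_face hB).comp (Continuous.prodMk_left p.1)
        have h2 : Continuous fun t : ℝ => φ (S.chart (p.2 + t • p.1, t)) :=
          hφ.continuous.comp (S.continuous_chart.comp (by fun_prop))
        exact (h1.mul continuous_const).mul h2
      exact (hcont.tendsto 0).mono_left nhdsWithin_le_nhds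

/-- Integration by parts up to the boundary for a potential of order two. -/
theorem integral_pot_two_mul_pd {B : ℝ × E3 → ℂ} (hB : ContDiff ℝ ∞ B) (hc : HasCompactSupport B)
    {g : E2 → ℂ} (hgm : Measurable g) (hg : MemLp g 2) (i : Fin 3)
    (h3 : MemLp (S.pot 3 (S.dProf 2 (EuclideanSpace.single i 1) B) g) 2 (volume.restrict S.dom))
    {φ : E3 → ℂ} (hφ : IsTest Set.univ φ) :
    (∫ x in S.dom, S.pot 2 B g x * pd i φ x) +
      ∫ x in S.dom, S.pot 3 (S.dProf 2 (EuclideanSpace.single i 1) B) g x * φ x =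
      S.n i * (S.moment B 0 * ∫ y, g y * φ (S.bd y)) := by
  have hgl : LocallyIntegrable g := hg.locallyIntegrable (by norm_num)
  have h2 := S.memLp_pot_two hB.continuous hc hgm hg
  set U := S.pot 2 B g with hU
  set V := S.pot 3 (S.dProf 2 (EuclideanSpace.single i 1) B) g with hV
  have hi1 : Integrable (fun x => U x * pd i φ x) (volume.restrict S.dom) :=
    h2.integrable_mul (memLp_test (hφ.pd i) 2 S.dom)
  have hi2 : Integrable (fun x => V x * φ x) (volume.restrict S.dom) :=
    h3.integrable_mul (memLp_test hφ 2 S.dom)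
  have hi3 : Integrable (fun x => U x * φ x) (volume.restrict S.dom) :=
    h2.integrable_mul (memLp_test hφ 2 S.dom)
  have hcutm : ∀ k, AEStronglyMeasurable (S.cut k) (volume.restrict S.dom) := fun k =>
    (S.contDiff_cut k).continuous.aestronglyMeasurable
  have hlim : ∀ {F : E3 → ℂ}, Integrable F (volume.restrict S.dom) →
      Tendsto (fun k => ∫ x in S.dom, S.cut k x * F x) atTop (𝓝 (∫ x in S.dom, F x)) := by
    intro F hF
    refine tendsto_integral_of_dominated_convergence (fun x => ‖F x‖)
      (fun k => (hcutm k).mul hF.1) hF.norm (fun k => Eventually.of_forall fun x => ?_) ?_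
    · rw [norm_mul]
      exact mul_le_of_le_one_left (norm_nonneg _) (S.norm_cut_le k x)
    · filter_upwards [ae_restrict_mem S.isOpen_dom.measurableSet] with x hx
      simpa using (S.tendsto_cut hx).mul_const (F x)
  -- `-P k n` is the gradient of the cutoff, concentrated in a boundary layer
  let P : ℕ → E3 → ℝ := fun k x => ((k : ℝ) + 1) * bumpDeriv (((k : ℝ) + 1) * S.depth x - 1)
  have hPi : ∀ k, Integrable (fun x => P k x • (U x * φ x)) (volume.restrict S.dom) := by
    intro k
    obtain ⟨M, hM⟩ := hasCompactSupport_bumpDeriv.exists_bound_of_continuous continuous_bumpDeriv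
    have hPc : Continuous (P k) :=
      continuous_const.mul (continuous_bumpDeriv.comp (by fun_prop))
    refine hi3.bdd_smul (((k : ℝ) + 1) * M) hPc.aestronglyMeasurable
      (Eventually.of_forall fun x => ?_)
    rw [norm_mul, Real.norm_of_nonneg (by positivity)]
    gcongr
    exact hM _
  have hlayer : Tendsto (fun k => ∫ x in S.dom, P k x • (U x * φ x)) atTop
      (𝓝 (S.moment B 0 * ∫ y, g y * φ (S.bd y))) := by
    have hch : ∀ {F : E3 → ℂ}, Integrable F (volume.restrict S.dom) →
        IntegrableOn (fun t => ∫ y, F (S.chart (y, t))) (Set.Ioi 0) ∧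
        ∫ x in S.dom, F x = ∫ t in Set.Ioi (0 : ℝ), ∫ y, F (S.chart (y, t)) := by
      intro F hF
      have hFc := S.measurePreserving_chart_dom.integrable_comp_of_integrable hF
      exact ⟨hFc.integral_prod_right,
        (S.measurePreserving_chart_dom.integral_comp S.measurableEmbedding_chart F).symm.trans
          (integral_prod_symm _ hFc)⟩
    have hpk := tendsto_peak (hch hi3).1 (S.tendsto_layer hB.continuous hc hgm hgl hφ)
    refine hpk.congr fun k => ?_
    rw [(hch (hPi k)).2]
    refine setIntegral_congr_fun measurableSet_Ioi fun t _ => ?_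
    simp only [P, S.depth_chart]
    rw [integral_smul]
  have hk : ∀ k, (∫ x in S.dom, S.cut k x * (U x * pd i φ x)) +
      ∫ x in S.dom, S.cut k x * (V x * φ x) =
      S.n i * ∫ x in S.dom, P k x • (U x * φ x) := by
    intro k
    have ht := S.isTest_cut_mul hφ k
    have h := S.integral_pot_mul_pd (m := 2) hB hc hgm hgl ht i
    have e1 : ∀ x, pd i (fun x => S.cut k x * φ x) x =
        S.cut k x * pd i φ x - P k x * S.n i * φ x := by
      intro x
      rw [pd_mul i ((S.contDiff_cut k).differentiable (by simp) x) (hφ.differentiable x), S.pd_cut]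
      push_cast [P]
      ring
    have hcut1 : Integrable (fun x => S.cut k x * (U x * pd i φ x)) (volume.restrict S.dom) :=
      hi1.bdd_mul (hcutm k) (Eventually.of_forall (S.norm_cut_le k))
    have e2 : ∀ x, S.pot 2 B g x * pd i (fun x => S.cut k x * φ x) x =
        S.cut k x * (U x * pd i φ x) - S.n i * (P k x • (U x * φ x)) := by
      intro x
      rw [e1, Complex.real_smul]
      ring
    have e3 : ∀ x, S.pot (2 + 1) (S.dProf 2 (EuclideanSpace.single i 1) B) g x *
        (S.cut k x * φ x) = S.cut k x * (V x * φ x) := fun x => by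
      simp only [hV]; ring
    simp only [e2, e3] at h
    rw [integral_sub hcut1 ((hPi k).const_mul _), integral_const_mul] at h
    linear_combination h
  exact tendsto_nhds_unique (((hlim hi1).add (hlim hi2)).congr hk)
    (hlayer.const_mul _)

end Frame

/-! ### Regularity of weak solutions -/

theorem integral_toLp_mul {Ω : Set E3} {u : E3 → ℂ} (hu : MemLp u 2 (volume.restrict Ω))
    (φ : E3 → ℂ) : ∫ x in Ω, hu.toLp u x * φ x = ∫ x in Ω, u x * φ x := by
  refine integral_congr_ae ?_
  filter_upwards [hu.coeFn_toLp] with x hx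
  rw [hx]

theorem integral_finsetSum_mul {Ω Ω' : Set E3} {ι : Type*} (s : Finset ι) (u : ι → L2 Ω)
    {φ : E3 → ℂ} (hφ : IsTest Ω' φ) :
    ∫ x in Ω, (∑ i ∈ s, u i : L2 Ω) x * φ x = ∑ i ∈ s, ∫ x in Ω, u i x * φ x := by
  classical
  induction s using Finset.induction_on with
  | empty =>
    have := integral_smul_mul (0 : ℂ) (0 : L2 Ω) φ
    simpa using this
  | insert i s hi ih => rw [Finset.sum_insert hi, Finset.sum_insert hi, integral_add_mul _ _ hφ, ih]

namespace Frame

variable (S : Frame)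

theorem lintegral_slobodeckij {g : L2Bdry S.dom} (hg : MemHHalf S.dom g) :
    ∫⁻ x, ∫⁻ y, ‖g (S.bd x) - g (S.bd y)‖ₑ ^ 2 / ‖x - y‖ₑ ^ 3 < ⊤ := by
  refine lt_of_eq_of_lt ?_ hg
  rw [← S.measurePreserving_bd.lintegral_comp_emb S.measurableEmbedding_bd]
  refine lintegral_congr fun x => ?_
  rw [← S.measurePreserving_bd.lintegral_comp_emb S.measurableEmbedding_bd]
  refine lintegral_congr fun y => ?_
  have : ‖S.bd x - S.bd y‖ₑ = ‖x - y‖ₑ := by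
    rw [← edist_eq_enorm_sub, ← edist_eq_enorm_sub, S.isometry_bd.edist_eq]
  rw [this]

/-- Boundary data in `H^{1/2}` are the Neumann data of a function in `H²`, whose gradient `p` and
Laplacian `w` are given. -/
theorem exists_lift {g : L2Bdry S.dom} (hg : MemHHalf S.dom g) :
    ∃ (u w : L2 S.dom) (p : Fin 3 → L2 S.dom), MemH S.dom 2 u ∧
      (∀ i, HasWeakD S.dom (Pi.single i 1) u (p i)) ∧
      ∀ φ, IsTest Set.univ φ → (∑ i, ∫ x in S.dom, p i x * pd i φ x) + ∫ x in S.dom, w x * φ x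
        = ∫ x, g x * φ x ∂(surf S.dom) := by
  -- With moment `-1` for `B`, the moment of the profile of the `i`-th derivative is `n i`.
  obtain ⟨B, hB, hc, hM⟩ := S.exists_prof
  have hgm : Measurable fun y => g (S.bd y) :=
    (Lp.stronglyMeasurable g).measurable.comp S.continuous_bd.measurable
  have hg2 : MemLp (fun y => g (S.bd y)) 2 :=
    (Lp.memLp g).comp_measurePreserving S.measurePreserving_bd
  have hgl : LocallyIntegrable fun y => g (S.bd y) := hg2.locallyIntegrable (by norm_num)
  set e : Fin 3 → E3 := fun i => EuclideanSpace.single i 1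
  set D : Fin 3 → ℝ × E3 → ℂ := fun i => S.dProf 1 (e i) B
  have hD : ∀ i, ContDiff ℝ ∞ (D i) := fun i => S.contDiff_dProf 1 (e i) hB
  have hDc : ∀ i, HasCompactSupport (D i) := fun i => S.hasCompactSupport_dProf 1 (e i) hc
  have hDD : ∀ i j, ContDiff ℝ ∞ (S.dProf 2 (e j) (D i)) := fun i j => S.contDiff_dProf 2 _ (hD i)
  have hDDc : ∀ i j, HasCompactSupport (S.dProf 2 (e j) (D i)) :=
    fun i j => S.hasCompactSupport_dProf 2 _ (hDc i)
  have h1 := S.memLp_pot_one hB.continuous hc hgm hg2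
  have h2 : ∀ i, MemLp (S.pot 2 (D i) fun y => g (S.bd y)) 2 (volume.restrict S.dom) :=
    fun i => S.memLp_pot_two (hD i).continuous (hDc i) hgm hg2
  have h3 : ∀ i j, MemLp (S.pot 3 (S.dProf 2 (e j) (D i)) fun y => g (S.bd y)) 2
      (volume.restrict S.dom) := fun i j => by
    refine S.memLp_pot_three (hDD i j) (hDDc i j) ?_ hgm hg2 (S.lintegral_slobodeckij hg)
    rw [S.moment_dProf (hD i) (hDc i)]
    norm_num
  have hd1 : ∀ i, HasWeakD S.dom (Pi.single i 1) (h1.toLp _) ((h2 i).toLp _) := fun i => by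
    rw [hasWeakD_single_iff]
    intro φ hφ
    rw [integral_toLp_mul, integral_toLp_mul]
    exact S.integral_pot_mul_pd hB hc hgm hgl hφ i
  refine ⟨h1.toLp _, ∑ i, (h3 i i).toLp _, fun i => (h2 i).toLp _, ?_, hd1, ?_⟩
  · refine memH_two_of (fun i => ⟨_, hd1 i⟩) fun i j => ⟨(h3 i j).toLp _, fun φ hφ => ?_⟩
    rw [hasWeakD_single_iff.1 (hd1 i) _ (hφ.pd j), integral_toLp_mul, integral_toLp_mul,
      S.integral_pot_mul_pd (hD i) (hDc i) hgm hgl hφ j, neg_neg]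
  · intro φ hφ
    rw [integral_finsetSum_mul _ _ hφ, ← Finset.sum_add_distrib,
      ← S.measurePreserving_bd.integral_comp S.measurableEmbedding_bd]
    have hi : ∀ i, (∫ x in S.dom, (h2 i).toLp _ x * pd i φ x) +
        ∫ x in S.dom, (h3 i i).toLp _ x * φ x =
        (S.n i : ℂ) ^ 2 * ∫ y, g (S.bd y) * φ (S.bd y) := fun i => by
      rw [integral_toLp_mul, integral_toLp_mul,
        S.integral_pot_two_mul_pd (hD i) (hDc i) hgm hg2 i (h3 i i) hφ,
        S.moment_dProf hB hc, hM]
      have : inner ℝ S.n (e i) = S.n i := by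
        simp only [e]
        rw [EuclideanSpace.inner_single_right]; simp
      rw [this]
      push_cast
      ring
    simp only [hi]
    rw [← Finset.sum_mul, S.sum_n_sq, one_mul]

/-- Subtracting a lifting of the boundary datum reduces regularity to the homogeneous problem. -/
theorem memH_two_of_isWeakSolution {f : L2 S.dom} {g : L2Bdry S.dom} (hg : MemHHalf S.dom g)
    {ψ : L2 S.dom} (h : IsWeakSolution S.dom f g ψ) : MemH S.dom 2 ψ := by
  obtain ⟨u, w, p, hu, hp, hlift⟩ := S.exists_lift hg
  have hd : ∀ i, HasWeakD S.dom (Pi.single i 1) (ψ - u) (weakPD S.dom i ψ - p i) := fun i =>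
    (h.1.hasWeakD_weakPD i).sub (hp i)
  have key : MemH S.dom 2 (ψ - u) := by
    refine S.memH_two_of_neumann (F := f - u + w) hd fun φ hφ => ?_
    have e1 := S.weakSolution_test h hφ
    have e2 := hlift φ hφ
    simp only [integral_sub_mul _ _ (hφ.pd _), Finset.sum_sub_distrib]
    rw [integral_sub_mul _ _ hφ, integral_add_mul _ _ hφ, integral_sub_mul _ _ hφ]
    linear_combination e1 - e2
  have := key.add hu
  rwa [sub_add_cancel] at this

end Frame

end HalfSpaceNeumann

end

theorem mainTheorem8 (Ω : Set HalfSpaceNeumann.E3) (hΩ : HalfSpaceNeumann.IsHalfSpace Ω)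
    (f : HalfSpaceNeumann.L2 Ω) (g : HalfSpaceNeumann.L2Bdry Ω)
    (hg : HalfSpaceNeumann.MemHHalf Ω g) :
    (∃! ψ : HalfSpaceNeumann.L2 Ω, HalfSpaceNeumann.IsWeakSolution Ω f g ψ) ∧
    ∀ ψ : HalfSpaceNeumann.L2 Ω, HalfSpaceNeumann.IsWeakSolution Ω f g ψ →
      HalfSpaceNeumann.MemH Ω 2 ψ := by
  obtain ⟨S, rfl⟩ := hΩ.exists_frame
  exact ⟨S.existsUnique_weakSolution f g, fun ψ hψ => S.memH_two_of_isWeakSolution hg hψ⟩
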